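/- Let $X$ be a compact complex manifold of dimension $n$ with a Kähler metric $\langle\cdot,\cdot\rangle$, complex structure $J$ and Kähler form $\omega(v,w)=\langle Jv,w\rangle$, and let $E\to X$ be a smooth complex vector bundle of finite rank with a smooth Hermitian metric (for instance a holomorphic vector bundle). Let $\tau\in\mathbb R$. For a smooth unitary connection $A$ on $E$ with curvature $F_A$ and a smooth section $\phi$ of $E$, let $\Lambda F_A=(F_A,\omega)$ be the pointwise contraction with $\omega$ and put $$F_{A,\phi}=\Lambda F_A-\tfrac i2(\phi\otimes\phi^*-\tau I),\qquad J_{A,\phi}=\tfrac12\big(d_A\phi\otimes\phi^*-\phi\otimes(d_A\phi)^*\big),$$ $$\mathcal F(A,\phi)=\|F_{A,\phi}\|_{L^2}^2,\qquad \mathcal{YMH}(A,\phi)=\|F_A\|_{L^2}^2+\|d_A\phi\|_{L^2}^2+\tfrac14\|\phi\otimes\phi^*-\tau I\|_{L^2}^2 .$$ Let $\mathcal H$ be the space of gauged holomorphic maps, that is, of pairs $(A,\phi)$ with $F_A^{0,2}=F_A^{2,0}=0$ and $\bar\partial_A\phi=0$. (a) The two functionals differ on $\mathcal H$ by a topological constant: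 for every $(A,\phi)\in\mathcal H$, $$\mathcal{YMH}(A,\phi)=\mathcal F(A,\phi)+2\pi\tau\, C_1(E,\omega)-8\pi^2\, Ch_2(E,\omega),$$ where $C_1(E,\omega)=\int_X c_1(E)\wedge\frac{\omega^{n-1}}{(n-1)!}$ and $Ch_2(E,\omega)=\int_X ch_2(E)\wedge\frac{\omega^{n-2}}{(n-2)!}$ (zero if the exponent is negative), the classes $c_1(E)$ and $ch_2(E)$ being represented by $\frac{i}{2\pi}\operatorname{tr}F_B$ and $-\frac1{8\pi^2}\operatorname{tr}(F_B\wedge F_B)$ for an arbitrary smooth complex connection $B$ on $E$ (real parts of the integrals are taken). (b) Let $S\subset\mathbb R$ be an interval with more than one point and $(A(t),\phi(t))_{t\in S}$ a path in $\mathcal H$. Then it satisfies the gradient flow equations of the vortex functional $\mathcal F$, $$\frac{\partial A}{\partial t}=-{*d_A}F_{A,\phi},\qquad \frac{\partial\phi}{\partial t}=-iF_{A,\phi}\,\phi ,$$ at every $t\in S$ and every point of $X$, if and only if it satisfies the gradient flow equations of the Yang–Mills–Higgs functional $\mathcal{YMH}$, $$\frac{\partial A}{\partial t}=-d_A^*F_A-J_{A,\phi},\qquad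 \frac{\partial\phi}{\partial t}=-d_A^*d_A\phi+\tfrac12\phi(\tau-|\phi|^2),$$ at every $t\in S$ and every point of $X$. Here $*$ is the complex structure $(*\alpha)(v)=\alpha(Jv)$ on one-forms, so that $*d_A=i(\partial_A-\bar\partial_A)$ on sections of $\operatorname{End}E$, and $d_A^*$ is the $L^2$ adjoint of $d_A$. -/

import Mathlib

open Bundle Set MeasureTheory
open scoped Manifold ContDiff Topology

namespace VortexFlow

/-! ## Kähler manifolds

`X` is a complex manifold modelled on the finite-dimensional complex vector space `V`. Its
underlying real manifold has the model `𝓘(ℝ, V)`, and its real tangent spaces are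
`TangentSpace 𝓘(ℝ, V) x`. -/

section Manifold

variable (V : Type*) [NormedAddCommGroup V] [NormedSpace ℂ V]
  (X : Type*) [TopologicalSpace X] [ChartedSpace V X]

/-- A complex manifold is in particular a real (analytic) manifold. -/
instance isManifold_real [IsManifold 𝓘(ℂ, V) ω X] : IsManifold 𝓘(ℝ, V) ω X := by
  refine isManifold_of_contDiffOn _ _ _ fun e e' he he' => ?_
  have h := (contDiffGroupoid ω 𝓘(ℂ, V)).compatible he he'
  rw [contDiffGroupoid, mem_groupoid_of_pregroupoid] at h
  exact ContDiffOn.restrict_scalars ℝ h.1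

variable {V X}

/-- The complex structure on the real tangent spaces. A tangent vector at `x` is represented by
its coordinates in the preferred (holomorphic) chart at `x`, and `J` multiplies them by `i`;
coordinate changes being holomorphic, any other holomorphic chart gives the same map. -/
noncomputable def J (x : X) : TangentSpace 𝓘(ℝ, V) x →L[ℝ] TangentSpace 𝓘(ℝ, V) x :=
  (Complex.I • ContinuousLinearMap.id ℝ V : V →L[ℝ] V)

instance (x : X) [FiniteDimensional ℂ V] : FiniteDimensional ℝ (TangentSpace 𝓘(ℝ, V) x) :=
  inferInstanceAs (FiniteDimensional ℝ V)

variable (V X) in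
/-- The Riemannian metric of the complex manifold `X` is a Kähler metric: it is `J`-invariant, and
`J` is parallel for the Levi-Civita connection (the torsion-free metric connection). -/
structure IsKahler [IsManifold 𝓘(ℂ, V) ω X] [FiniteDimensional ℂ V]
    [RiemannianBundle (fun x : X => TangentSpace 𝓘(ℝ, V) x)]
    [IsContMDiffRiemannianBundle 𝓘(ℝ, V) ∞ V (fun x : X => TangentSpace 𝓘(ℝ, V) x)] :
    Prop where
  hermitian : ∀ (x : X) (v w : TangentSpace 𝓘(ℝ, V) x), inner ℝ (J x v) (J x w) = inner ℝ v w
  parallel : ∃ D : CovariantDerivative 𝓘(ℝ, V) V (fun x : X => TangentSpace 𝓘(ℝ, V) x),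
    D.ContMDiffCovariantDerivative ∞ ∧ D.IsMetricCompatible ∧ D.torsion = 0 ∧
    ∀ (Y : Π x : X, TangentSpace 𝓘(ℝ, V) x) (x : X) (v : TangentSpace 𝓘(ℝ, V) x),
      MDifferentiableAt 𝓘(ℝ, V) (𝓘(ℝ, V).prod 𝓘(ℝ, V))
        (fun y => (TotalSpace.mk' V y (Y y) : TotalSpace V (TangentSpace 𝓘(ℝ, V)))) x →
      D (fun y => J y (Y y)) x v = J x (D Y x v)

section Integral

variable [RiemannianBundle (fun x : X => TangentSpace 𝓘(ℝ, V) x)]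

/-- The Riemannian volume density in the chart at `i`, relative to Lebesgue measure in the
coordinates given by a basis `b` of `V`: the square root of the Gram determinant of the
coordinate vector fields, at the point with coordinates `y`. -/
noncomputable def volumeDensity {m : ℕ} (b : Module.Basis (Fin m) ℝ V) (i : X) (y : V) : ℝ :=
  √(Matrix.det (Matrix.of fun k l : Fin m =>
    (inner ℝ
      (mfderiv 𝓘(ℝ, V) 𝓘(ℝ, V) (chartAt V i).symm y (b k) :
        TangentSpace 𝓘(ℝ, V) ((chartAt V i).symm y))
      (mfderiv 𝓘(ℝ, V) 𝓘(ℝ, V) (chartAt V i).symm y (b l) :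
        TangentSpace 𝓘(ℝ, V) ((chartAt V i).symm y)) : ℝ)))

variable [IsManifold 𝓘(ℂ, V) ω X] [FiniteDimensional ℂ V] [T2Space X] [SigmaCompactSpace X]
  [MeasurableSpace V] [BorelSpace V]

variable (V) in
/-- The integral of a function over `X` against the Riemannian volume, computed with a smooth
partition of unity subordinate to the chart domains. (For continuous `f` on a compact `X`, the
result does not depend on the partition of unity or on the basis.) -/
noncomputable def integral (f : X → ℝ) : ℝ :=
  let ρ := Classical.choose
    (SmoothPartitionOfUnity.exists_isSubordinate_chartAt_source (I := 𝓘(ℝ, V)) X)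
  let b := Module.finBasis ℝ V
  ∑ᶠ i : X, ∫ y in (chartAt V i).target,
    ρ i ((chartAt V i).symm y) * f ((chartAt V i).symm y) * volumeDensity b i y ∂b.addHaar

end Integral

end Manifold

/-! ## Connections on a Hermitian vector bundle -/

section Bundle

variable {V : Type*} [NormedAddCommGroup V] [NormedSpace ℂ V] [FiniteDimensional ℂ V]
  {X : Type*} [TopologicalSpace X] [ChartedSpace V X] [IsManifold 𝓘(ℂ, V) ω X]
  (F : Type*) [NormedAddCommGroup F] [NormedSpace ℂ F] [FiniteDimensional ℂ F]
  {E : X → Type*} [TopologicalSpace (TotalSpace F E)]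
  [∀ x, NormedAddCommGroup (E x)] [∀ x, InnerProductSpace ℂ (E x)]
  [FiberBundle F E] [VectorBundle ℝ F E]

variable (V E) in
/-- The Hermitian metric of `E` is smooth: its real part is a smooth Riemannian metric on the real
vector bundle underlying `E`. -/
def IsSmoothHermitian : Prop :=
  letI (x : X) : InnerProductSpace ℝ (E x) := InnerProductSpace.complexToReal
  IsContMDiffRiemannianBundle 𝓘(ℝ, V) ∞ F E

/-- Smoothness of a section of `E`. -/
def IsSmoothSection (V : Type*) [NormedAddCommGroup V] [NormedSpace ℂ V] [ChartedSpace V X]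
    (σ : Π x, E x) : Prop :=
  ContMDiff 𝓘(ℝ, V) (𝓘(ℝ, V).prod 𝓘(ℝ, F)) ∞ (fun x => TotalSpace.mk' F x (σ x))

/-- Smoothness of a vector field on `X`. -/
def IsSmoothVectorField (Y : Π x : X, TangentSpace 𝓘(ℝ, V) x) : Prop :=
  ContMDiff 𝓘(ℝ, V) (𝓘(ℝ, V).prod 𝓘(ℝ, V)) ∞
    (fun x => (TotalSpace.mk' V x (Y x) : TotalSpace V (TangentSpace 𝓘(ℝ, V))))

variable (V E) in
/-- A smooth `ℂ`-linear connection `σ ↦ ∇σ` on `E`. -/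
structure Connection where
  /-- the covariant derivative: `∇ σ x v` is the derivative of `σ` at `x` in the direction `v` -/
  nabla : CovariantDerivative 𝓘(ℝ, V) F E
  smooth : nabla.ContMDiffCovariantDerivative ∞
  map_I_smul : ∀ (σ : Π x, E x) (x : X) (v : TangentSpace 𝓘(ℝ, V) x),
    MDifferentiableAt 𝓘(ℝ, V) (𝓘(ℝ, V).prod 𝓘(ℝ, F)) (fun y => TotalSpace.mk' F y (σ y)) x →
    nabla (fun y => Complex.I • σ y) x v = Complex.I • nabla σ x v

variable {F} in
/-- The connection preserves the Hermitian metric of `E`: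
`d⟪σ, τ⟫ = ⟪∇σ, τ⟫ + ⟪σ, ∇τ⟫`. -/
def Connection.IsUnitary (A : Connection V F E) : Prop :=
  ∀ (σ τ : Π x, E x) (x : X) (v : TangentSpace 𝓘(ℝ, V) x),
    MDifferentiableAt 𝓘(ℝ, V) (𝓘(ℝ, V).prod 𝓘(ℝ, F)) (fun y => TotalSpace.mk' F y (σ y)) x →
    MDifferentiableAt 𝓘(ℝ, V) (𝓘(ℝ, V).prod 𝓘(ℝ, F)) (fun y => TotalSpace.mk' F y (τ y)) x →
    (mfderiv 𝓘(ℝ, V) 𝓘(ℝ, ℂ) (fun y => inner ℂ (σ y) (τ y)) x v : ℂ) =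
      inner ℂ (A.nabla σ x v) (τ x) + inner ℂ (σ x) (A.nabla τ x v)

variable (V E) in
/-- A one-form on `X` with values in the skew-Hermitian endomorphisms of `E`, that is, a tangent
vector to the space of unitary connections. -/
structure SkewOneForm where
  toFun : Π x : X, TangentSpace 𝓘(ℝ, V) x →L[ℝ] E x →L[ℂ] E x
  skew : ∀ (x : X) (v : TangentSpace 𝓘(ℝ, V) x) (e e' : E x),
    inner ℂ (toFun x v e) e' = - inner ℂ e (toFun x v e')
  smooth : ∀ (Y : Π x : X, TangentSpace 𝓘(ℝ, V) x) (σ : Π x, E x),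
    IsSmoothVectorField Y → IsSmoothSection F V σ →
    IsSmoothSection F V (fun x => toFun x (Y x) (σ x))

namespace Connection

variable {F}
variable (A : Connection V F E)

/-- The curvature `F_A(v, w) e = ∇_v ∇_w e - ∇_w ∇_v e - ∇_[v,w] e`, computed with any
extensions of `v`, `w`, `e` to vector fields and to a section that are smooth near `x`. -/
noncomputable def curv (x : X) (v w : TangentSpace 𝓘(ℝ, V) x) (e : E x) : E x :=
  let Y : Π y : X, TangentSpace 𝓘(ℝ, V) y := FiberBundle.extend V v
  let Z : Π y : X, TangentSpace 𝓘(ℝ, V) y := FiberBundle.extend V w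
  let σ : Π y : X, E y := FiberBundle.extend F e
  A.nabla (fun y => A.nabla σ y (Z y)) x v - A.nabla (fun y => A.nabla σ y (Y y)) x w
    - A.nabla σ x (VectorField.mlieBracket 𝓘(ℝ, V) Y Z x)

/-- `d_A Ψ` for a section `Ψ` of `End E`: `(d_A Ψ)(v) e = ∇_v (Ψ e) - Ψ (∇_v e)`. -/
noncomputable def dEnd (Ψ : Π x : X, E x → E x) (x : X) (v : TangentSpace 𝓘(ℝ, V) x)
    (e : E x) : E x :=
  let σ : Π y : X, E y := FiberBundle.extend F e
  A.nabla (fun y => Ψ y (σ y)) x v - Ψ x (A.nabla σ x v)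

/-- `d_A a` for a one-form `a` with values in `End E`:
`(d_A a)(v, w) = (d_A (a w))(v) - (d_A (a v))(w) - a [v, w]`. -/
noncomputable def dOneForm (a : SkewOneForm V F E) (x : X) (v w : TangentSpace 𝓘(ℝ, V) x)
    (e : E x) : E x :=
  let Y : Π y : X, TangentSpace 𝓘(ℝ, V) y := FiberBundle.extend V v
  let Z : Π y : X, TangentSpace 𝓘(ℝ, V) y := FiberBundle.extend V w
  A.dEnd (fun y => a.toFun y (Z y)) x v e - A.dEnd (fun y => a.toFun y (Y y)) x w e
    - a.toFun x (VectorField.mlieBracket 𝓘(ℝ, V) Y Z x) e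

/-- `∂̄_A σ`, the `(0, 1)` part of `d_A σ`. -/
noncomputable def dbar (σ : Π x, E x) (x : X) (v : TangentSpace 𝓘(ℝ, V) x) : E x :=
  (2⁻¹ : ℂ) • (A.nabla σ x v + Complex.I • A.nabla σ x (J x v))

/-- The `(0, 2)` part of the curvature. -/
noncomputable def curv02 (x : X) (v w : TangentSpace 𝓘(ℝ, V) x) (e : E x) : E x :=
  (4⁻¹ : ℂ) • (A.curv x v w e - A.curv x (J x v) (J x w) e
    + Complex.I • (A.curv x v (J x w) e + A.curv x (J x v) w e))

/-- The `(2, 0)` part of the curvature. -/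
noncomputable def curv20 (x : X) (v w : TangentSpace 𝓘(ℝ, V) x) (e : E x) : E x :=
  (4⁻¹ : ℂ) • (A.curv x v w e - A.curv x (J x v) (J x w) e
    - Complex.I • (A.curv x v (J x w) e + A.curv x (J x v) w e))

/-- `(A, φ)` is a gauged holomorphic map, i.e. belongs to the space `ℋ`: the connection `A` is
unitary with curvature of type `(1, 1)`, and `φ` is a smooth section with `∂̄_A φ = 0`. -/
structure IsGaugedHolomorphic (φ : Π x, E x) : Prop where
  unitary : A.IsUnitary
  curv02_eq_zero : ∀ x v w e, A.curv02 x v w e = 0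
  curv20_eq_zero : ∀ x v w e, A.curv20 x v w e = 0
  smooth : IsSmoothSection F V φ
  dbar_eq_zero : ∀ x v, A.dbar φ x v = 0

end Connection

/-- `φ ⊗ φ*` minus `τ` times the identity. -/
noncomputable def phiPhiStarSub (τ : ℝ) (φ : Π x, E x) (x : X) (e : E x) : E x :=
  (inner ℂ (φ x) e : ℂ) • φ x - (τ : ℂ) • e

variable {F} in
/-- `J_{A, φ}(v) = ½ (d_A φ(v) ⊗ φ* - φ ⊗ (d_A φ(v))*)`. -/
noncomputable def current (A : Connection V F E) (φ : Π x, E x) (x : X)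
    (v : TangentSpace 𝓘(ℝ, V) x) (e : E x) : E x :=
  (2⁻¹ : ℂ) • ((inner ℂ (φ x) e : ℂ) • A.nabla φ x v - (inner ℂ (A.nabla φ x v) e : ℂ) • φ x)

section Fiber

variable {W : Type*} [NormedAddCommGroup W] [InnerProductSpace ℂ W] [FiniteDimensional ℂ W]

/-- The trace of an endomorphism of a finite-dimensional Hermitian space. -/
noncomputable def endTrace (a : W → W) : ℂ :=
  ∑ k, inner ℂ (stdOrthonormalBasis ℂ W k) (a (stdOrthonormalBasis ℂ W k))

/-- The real inner product `Re tr (a b*)` of endomorphisms of a Hermitian space. -/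
noncomputable def endInner (a b : W → W) : ℝ :=
  ∑ k, (inner ℂ (b (stdOrthonormalBasis ℂ W k)) (a (stdOrthonormalBasis ℂ W k))).re

end Fiber

/-! ### Pointwise inner products, contractions and the functionals -/

variable [VectorBundle ℂ F E] [RiemannianBundle (fun x : X => TangentSpace 𝓘(ℝ, V) x)]

/-- The trace of an endomorphism of the fibre `E x`. -/
noncomputable def fiberTrace (x : X) (a : E x → E x) : ℂ :=
  haveI := VectorBundle.finiteDimensional ℂ F E x
  endTrace a

/-- The inner product `Re tr (a b*)` of endomorphisms of the fibre `E x`. -/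
noncomputable def fiberInner (x : X) (a b : E x → E x) : ℝ :=
  haveI := VectorBundle.finiteDimensional ℂ F E x
  endInner a b

/-- An orthonormal basis of the real tangent space at `x`. -/
noncomputable def frame (x : X) :
    OrthonormalBasis (Fin (Module.finrank ℝ (TangentSpace 𝓘(ℝ, V) x))) ℝ
      (TangentSpace 𝓘(ℝ, V) x) :=
  stdOrthonormalBasis ℝ (TangentSpace 𝓘(ℝ, V) x)

/-- The inner product of `E`-valued one-forms at `x`. -/
noncomputable def innerOne (x : X) (α β : TangentSpace 𝓘(ℝ, V) x → E x) : ℝ :=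
  ∑ k, (inner ℂ (β (frame x k)) (α (frame x k))).re

/-- The inner product of `End E`-valued one-forms at `x`. -/
noncomputable def innerOneEnd (x : X) (α β : TangentSpace 𝓘(ℝ, V) x → E x → E x) : ℝ :=
  ∑ k, fiberInner F x (α (frame x k)) (β (frame x k))

/-- The inner product of `End E`-valued two-forms at `x`: the sum over the pairs `k < l` of
vectors of an orthonormal basis. -/
noncomputable def innerTwoEnd (x : X)
    (α β : TangentSpace 𝓘(ℝ, V) x → TangentSpace 𝓘(ℝ, V) x → E x → E x) : ℝ :=
  2⁻¹ * ∑ k, ∑ l, fiberInner F x (α (frame x k) (frame x l)) (β (frame x k) (frame x l))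

variable {F}

/-- `Λ F_A = (F_A, ω)`, the contraction of the curvature with the Kähler form
`ω(v, w) = ⟪J v, w⟫`. -/
noncomputable def lambdaCurv (A : Connection V F E) (x : X) (e : E x) : E x :=
  (2⁻¹ : ℂ) • ∑ k, A.curv x (frame x k) (J x (frame x k)) e

/-- The moment map `F_{A, φ} = Λ F_A - (i/2) (φ ⊗ φ* - τ I)`. -/
noncomputable def momentMap (τ : ℝ) (A : Connection V F E) (φ : Π x, E x) (x : X) (e : E x) :
    E x :=
  lambdaCurv A x e - (Complex.I / 2) • phiPhiStarSub τ φ x e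

/-- The value on four tangent vectors of the form
`ch₂(A) = ½ tr ((i / 2π) F_A)² = -(1 / 8π²) tr (F_A ∧ F_A)`. -/
noncomputable def ch2Form (A : Connection V F E) (x : X) (u v w z : TangentSpace 𝓘(ℝ, V) x) : ℂ :=
  -(8 * (Real.pi : ℂ) ^ 2)⁻¹ * (2 *
    (fiberTrace F x (fun e => A.curv x u v (A.curv x w z e))
      - fiberTrace F x (fun e => A.curv x u w (A.curv x v z e))
      + fiberTrace F x (fun e => A.curv x u z (A.curv x v w e))))

section L2

variable [T2Space X] [SigmaCompactSpace X] [MeasurableSpace V] [BorelSpace V]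

/-- `C₁(E, ω) = ∫ c₁ ∧ ω^(n-1) / (n-1)!` (`n = dim X`), with `c₁` represented by the form
`(i / 2π) tr F_A`; for a two-form `c`, the integrand is `(Λ c) dvol`. -/
noncomputable def chernNumberOne (A : Connection V F E) : ℝ :=
  integral V (fun x : X =>
    ((Complex.I / (2 * (Real.pi : ℂ))) * fiberTrace F x (lambdaCurv A x)).re)

/-- `Ch₂(E, ω) = ∫ ch₂ ∧ ω^(n-2) / (n-2)!` (`n = dim X`), with `ch₂` represented by the form
`-(1 / 8π²) tr (F_A ∧ F_A)`; for a four-form `c`, the integrand is `½ (Λ² c) dvol`, and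
`Λ² c = ¼ ∑ c(e_k, J e_k, e_l, J e_l)`. It is `0` if `n = 1`. -/
noncomputable def chernNumberTwo (A : Connection V F E) : ℝ :=
  integral V (fun x : X =>
    8⁻¹ * ∑ k, ∑ l,
      (ch2Form A x (frame x k) (J x (frame x k)) (frame x l) (J x (frame x l))).re)

/-- The Yang–Mills–Higgs functional
`‖F_A‖² + ‖d_A φ‖² + ¼ ‖φ ⊗ φ* - τ I‖²` (all norms are `L²` norms). -/
noncomputable def yangMillsHiggs (τ : ℝ) (A : Connection V F E) (φ : Π x, E x) : ℝ :=
  integral V (fun x : X => innerTwoEnd F x (A.curv x) (A.curv x))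
    + integral V (fun x : X => innerOne x (fun v => A.nabla φ x v) (fun v => A.nabla φ x v))
    + 4⁻¹ * integral V (fun x : X => fiberInner F x (phiPhiStarSub τ φ x) (phiPhiStarSub τ φ x))

/-- The vortex functional `‖Λ F_A - (i/2) (φ ⊗ φ* - τ I)‖²` (the `L²` norm). -/
noncomputable def vortexFunctional (τ : ℝ) (A : Connection V F E) (φ : Π x, E x) : ℝ :=
  integral V (fun x : X => fiberInner F x (momentMap τ A φ x) (momentMap τ A φ x))

/-- `β = d_A* F_A`, where `d_A*` is the `L²` adjoint of `d_A`. -/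
def IsAdjointCurv (A : Connection V F E) (β : SkewOneForm V F E) : Prop :=
  ∀ a : SkewOneForm V F E,
    integral V (fun x : X => innerOneEnd F x (fun v => β.toFun x v) (fun v => a.toFun x v)) =
      integral V (fun x : X => innerTwoEnd F x (A.curv x) (A.dOneForm a x))

/-- `ψ = d_A* d_A φ`, where `d_A*` is the `L²` adjoint of `d_A`. -/
def IsAdjointCov (A : Connection V F E) (φ ψ : Π x, E x) : Prop :=
  IsSmoothSection F V ψ ∧ ∀ σ : Π x, E x, IsSmoothSection F V σ →
    integral V (fun x : X => (inner ℂ (σ x) (ψ x)).re) =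
      integral V (fun x : X => innerOne x (fun v => A.nabla φ x v) (fun v => A.nabla σ x v))

end L2

/-! ### The two flows -/

/-- `∂A/∂t = a` at the time `t` (within the time interval `S`): the `End E`-valued one-form `a` is
the time derivative of the connections `A s`. -/
def HasTimeDeriv (A : ℝ → Connection V F E) (a : Π x : X, TangentSpace 𝓘(ℝ, V) x → E x → E x)
    (S : Set ℝ) (t : ℝ) : Prop :=
  ∀ (σ : Π x, E x), IsSmoothSection F V σ → ∀ (x : X) (v : TangentSpace 𝓘(ℝ, V) x),
    HasDerivWithinAt (fun s => ((A s).nabla σ x v : E x)) (a x v (σ x)) S t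

/-- The gradient flow equations of the vortex functional on the time interval `S`:
`∂A/∂t = - * d_A F_{A, φ}` and `∂φ/∂t = - J L_φ F_{A, φ}`. Here `*` is the complex structure of
the space of `End E`-valued one-forms, `(* α)(v) = α (J v)`, so that
`* d_A = i (∂_A - ∂̄_A)` on sections of `End E`; and `J L_φ` is the infinitesimal action of
endomorphisms on `φ` followed by multiplication by `i`. -/
def IsVortexFlow (τ : ℝ) (S : Set ℝ) (A : ℝ → Connection V F E) (φ : ℝ → Π x, E x) : Prop :=
  ∀ t ∈ S,
    HasTimeDeriv A (fun x v e => - (A t).dEnd (momentMap τ (A t) (φ t)) x (J x v) e) S t ∧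
    ∀ x : X, HasDerivWithinAt (fun s => φ s x)
      (- (Complex.I • momentMap τ (A t) (φ t) x (φ t x))) S t

/-- The gradient flow equations of the Yang–Mills–Higgs functional on the time interval `S`:
`∂A/∂t = - d_A* F_A - J_{A, φ}` and `∂φ/∂t = - d_A* d_A φ + ½ φ (τ - |φ|²)`. -/
def IsYangMillsHiggsFlow [T2Space X] [SigmaCompactSpace X] [MeasurableSpace V] [BorelSpace V]
    (τ : ℝ) (S : Set ℝ) (A : ℝ → Connection V F E) (φ : ℝ → Π x, E x) : Prop :=
  ∀ t ∈ S,
    (∃ β : SkewOneForm V F E, IsAdjointCurv (A t) β ∧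
      HasTimeDeriv A (fun x v e => - β.toFun x v e - current (A t) (φ t) x v e) S t) ∧
    ∃ ψ : Π x, E x, IsAdjointCov (A t) (φ t) ψ ∧
      ∀ x : X, HasDerivWithinAt (fun s => φ s x)
        (- ψ x + (2⁻¹ * (τ - ‖φ t x‖ ^ 2) : ℝ) • φ t x) S t

end Bundle

end VortexFlow

set_option linter.unusedSectionVars false

/-! Two Kähler identities carry both claims. If `A` is unitary with curvature of type (1,1), the
contracted Bianchi identity gives d_A^* F_A = * d_A ΛF_A (`sum_covCurv`, `isAdjointCurv`). If also
the (0,1) part of d_A φ vanishes, then d_A^* d_A φ = i ΛF_A φ: the second derivative ∇²φ(u, v) is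
complex linear in v, so its trace is a J-contraction of its antisymmetric part, which is the
curvature applied to φ (`sum_hess`). Finally ∇_{Jv} φ = i ∇_v φ turns the derivative of -(i/2) φ ⊗
φ* along Jv into the current (`dEnd_momentMap`). So at each time the right-hand sides of the two
flows are the same. The Yang–Mills–Higgs flow only asks for some sections with the adjoint property;
the L² products determine them, which gives the converse direction.

For the energies, expand |F_{A,φ}|² pointwise (`fiberInner_momentMap`). The cross term with φ
integrates to ‖d_A φ‖² by the second identity, the cross term with τ is the first Chern density, and
for a skew curvature of type (1,1) the difference |F_A|² - |ΛF_A|² is, up to a constant, the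
Chern–Weil density of ch₂ (`chernForm_curvature`). This proves the formula with the Chern numbers of
`A` itself; it remains to replace `A` by an arbitrary connection `B = A + b`. For c₁ the change is
the trace of an exact form. For ch₂ the curvature of A + t b is quadratic in t, so the derivative of
the quadratic density is a cubic in t, and Simpson's rule integrates it exactly from the three
connections t = 0, 1/2, 1 (`chernForm_simpson`). At each node the integral over X vanishes by the
Bianchi identity (`integral_chernForm`), and no integral over t is needed.

Every integration by parts is an instance of ∫ div Y = 0 (`integral_divergence`), proved from charts
and a partition of unity. Pointwise computations use extensions of tangent vectors that are parallel
at the point and commute with J. The orthonormal bases are chosen point by point without continuity,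
so contractions are first rewritten in a smooth frame through the inverse Gram matrix, which is the
identity to first order at the point. -/

namespace VortexFlow

/-! ### Global smooth sections, cutoffs and tensoriality. -/

section SmoothSections

/-- Global smoothness of a section of a real vector bundle. -/
abbrev SmoothSec (F : Type*) [NormedAddCommGroup F] [NormedSpace ℝ F]
    {X : Type*} [TopologicalSpace X] {Z : X → Type*} [TopologicalSpace (TotalSpace F Z)]
    [∀ x, TopologicalSpace (Z x)] [FiberBundle F Z]
    (V : Type*) [NormedAddCommGroup V] [NormedSpace ℝ V] [ChartedSpace V X]
    (σ : Π x, Z x) : Prop :=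
  ContMDiff 𝓘(ℝ, V) (𝓘(ℝ, V).prod 𝓘(ℝ, F)) ∞ (fun x => TotalSpace.mk' F x (σ x))

/-- Smooth real functions on the manifold. -/
abbrev SmoothFun (V : Type*) [NormedAddCommGroup V] [NormedSpace ℝ V]
    {X : Type*} [TopologicalSpace X] [ChartedSpace V X] (f : X → ℝ) : Prop :=
  ContMDiff 𝓘(ℝ, V) 𝓘(ℝ, ℝ) ∞ f

variable {V : Type*} [NormedAddCommGroup V] [NormedSpace ℝ V]
  {X : Type*} [TopologicalSpace X] [ChartedSpace V X]
  {F : Type*} [NormedAddCommGroup F] [NormedSpace ℝ F]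
  {Z : X → Type*} [TopologicalSpace (TotalSpace F Z)]
  [∀ x, TopologicalSpace (Z x)] [FiberBundle F Z]

theorem SmoothFun.mdifferentiableAt {f : X → ℝ} (hf : SmoothFun V f) (x : X) :
    MDifferentiableAt 𝓘(ℝ, V) 𝓘(ℝ, ℝ) f x :=
  ContMDiffAt.mdifferentiableAt (hf x) (by simp)

theorem SmoothSec.mdifferentiableAt {σ : Π x, Z x} (hσ : SmoothSec F V σ) (x : X) :
    MDifferentiableAt 𝓘(ℝ, V) (𝓘(ℝ, V).prod 𝓘(ℝ, F)) (fun y => TotalSpace.mk' F y (σ y)) x :=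
  ContMDiffAt.mdifferentiableAt (hσ x) (by simp)

theorem mdifferentiableAt_congr_section {σ τ : Π x, Z x} {x : X}
    (hσ : MDifferentiableAt 𝓘(ℝ, V) (𝓘(ℝ, V).prod 𝓘(ℝ, F))
      (fun y => TotalSpace.mk' F y (σ y)) x) (h : ∀ᶠ y in 𝓝 x, τ y = σ y) :
    MDifferentiableAt 𝓘(ℝ, V) (𝓘(ℝ, V).prod 𝓘(ℝ, F)) (fun y => TotalSpace.mk' F y (τ y)) x :=
  hσ.congr_of_eventuallyEq (h.mono fun y hy => by simp [hy])

theorem smoothSec_of_local {σ : Π x, Z x}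
    (h : ∀ x, ∃ τ : Π x, Z x, SmoothSec F V τ ∧ ∀ᶠ y in 𝓝 x, σ y = τ y) : SmoothSec F V σ := by
  intro x
  obtain ⟨τ, hτ, he⟩ := h x
  exact (hτ x).congr_of_eventuallyEq (he.mono fun y hy => by simp [hy])

theorem smoothFun_of_local {f : X → ℝ}
    (h : ∀ x, ∃ g : X → ℝ, SmoothFun V g ∧ ∀ᶠ y in 𝓝 x, f y = g y) : SmoothFun V f := by
  intro x
  obtain ⟨τ, hτ, he⟩ := h x
  exact (hτ x).congr_of_eventuallyEq he

variable [∀ x, AddCommGroup (Z x)] [∀ x, Module ℝ (Z x)] [VectorBundle ℝ F Z]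

theorem SmoothSec.smul {f : X → ℝ} {σ : Π x, Z x} (hf : SmoothFun V f) (hσ : SmoothSec F V σ) :
    SmoothSec F V (fun x => f x • σ x) :=
  ContMDiff.smul_section hf hσ

theorem SmoothSec.add {σ τ : Π x, Z x} (hσ : SmoothSec F V σ) (hτ : SmoothSec F V τ) :
    SmoothSec F V (fun x => σ x + τ x) :=
  ContMDiff.add_section hσ hτ

theorem SmoothSec.sub {σ τ : Π x, Z x} (hσ : SmoothSec F V σ) (hτ : SmoothSec F V τ) :
    SmoothSec F V (fun x => σ x - τ x) :=
  ContMDiff.sub_section hσ hτ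

theorem SmoothSec.neg {σ : Π x, Z x} (hσ : SmoothSec F V σ) :
    SmoothSec F V (fun x => - σ x) :=
  ContMDiff.neg_section hσ

theorem SmoothSec.const_smul {σ : Π x, Z x} (c : ℝ) (hσ : SmoothSec F V σ) :
    SmoothSec F V (fun x => c • σ x) :=
  ContMDiff.const_smul_section hσ

theorem SmoothSec.zero : SmoothSec F V (fun x => (0 : Z x)) :=
  contMDiff_zeroSection ℝ Z

theorem SmoothSec.sum {ι : Type*} (s : Finset ι) {σ : ι → Π x, Z x}
    (hσ : ∀ i ∈ s, SmoothSec F V (σ i)) : SmoothSec F V (fun x => ∑ i ∈ s, σ i x) :=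
  ContMDiff.sum_section hσ

theorem SmoothFun.sum {ι : Type*} (s : Finset ι) {f : ι → X → ℝ}
    (hf : ∀ i ∈ s, SmoothFun V (f i)) : SmoothFun V (fun x => ∑ i ∈ s, f i x) :=
  contMDiff_finsetSum hf

variable [FiniteDimensional ℝ V] [T2Space X] [IsManifold 𝓘(ℝ, V) ∞ X]

variable (V) in
theorem exists_smooth_cutoff {x : X} {U : Set X} (hU : U ∈ 𝓝 x) :
    ∃ χ : X → ℝ, SmoothFun V χ ∧ tsupport χ ⊆ U ∧ ∀ᶠ y in 𝓝 x, χ y = 1 := by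
  obtain ⟨f, -, hf⟩ := (SmoothBumpFunction.nhds_basis_tsupport (I := 𝓘(ℝ, V)) x).mem_iff.1 hU
  exact ⟨f, f.contMDiff, hf, f.eventuallyEq_one⟩

/-- The form is read in the preferred chart at `x`, whose derivative at `x` is the identity, and
then cut off. Since the coordinate expression vanishes at `x`, the derivative of the cutoff does not
contribute. -/
theorem exists_smoothFun_mvfderiv_eq (x : X) (l : TangentSpace 𝓘(ℝ, V) x →L[ℝ] ℝ) :
    ∃ f : X → ℝ, SmoothFun V f ∧ f x = 0 ∧ mvfderiv 𝓘(ℝ, V) f x = l := by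
  obtain ⟨χ, hχ, hs, h1⟩ := exists_smooth_cutoff V (chart_source_mem_nhds V x)
  let l' : V →L[ℝ] ℝ := l
  let g : X → ℝ := fun y => l' (extChartAt 𝓘(ℝ, V) x y - extChartAt 𝓘(ℝ, V) x x)
  have hg : ContMDiffOn 𝓘(ℝ, V) 𝓘(ℝ, ℝ) ∞ g (chartAt V x).source := by
    refine ContMDiff.comp_contMDiffOn (I' := 𝓘(ℝ, V))
      (g := fun v : V => l' (v - extChartAt 𝓘(ℝ, V) x x)) ?_ contMDiffOn_extChartAt
    rw [contMDiff_iff_contDiff]; fun_prop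
  refine ⟨fun y => χ y * g y, ?_, by simp [g], ?_⟩
  · refine contMDiff_of_tsupport fun y hy => ?_
    have hy' := hs ((tsupport_mul_subset_left) hy)
    exact (hχ y).mul (hg.contMDiffAt ((chartAt V x).open_source.mem_nhds hy'))
  · have hgx : g x = 0 := by simp [g]
    have hd : MDifferentiableAt 𝓘(ℝ, V) 𝓘(ℝ, ℝ) g x :=
      (hg.contMDiffAt (chart_source_mem_nhds V x)).mdifferentiableAt (by simp)
    have : mvfderiv 𝓘(ℝ, V) (fun y => χ y * g y) x = mvfderiv 𝓘(ℝ, V) g x := by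
      have := mvfderiv_mul (hχ.mdifferentiableAt x) hd
      rw [show (fun y => χ y * g y) = χ * g from rfl, this, hgx, h1.self_of_nhds]
      simp
    rw [this]
    have h2 : HasMFDerivAt 𝓘(ℝ, V) 𝓘(ℝ, ℝ) g x
        (l'.comp (mfderiv 𝓘(ℝ, V) 𝓘(ℝ, V) (extChartAt 𝓘(ℝ, V) x) x)) := by
      refine HasMFDerivAt.comp (I' := 𝓘(ℝ, V)) x
        (g := fun v : V => l' (v - extChartAt 𝓘(ℝ, V) x x)) ?_
        (mdifferentiableAt_extChartAt (mem_chart_source V x)).hasMFDerivAt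
      exact (l'.hasFDerivAt.comp _ ((hasFDerivAt_id _).sub_const _)).hasMFDerivAt
    rw [mvfderiv, h2.mfderiv, mfderiv_extChartAt_self]
    rfl

variable [FiniteDimensional ℝ F] [ContMDiffVectorBundle ∞ F Z 𝓘(ℝ, V)]

theorem exists_smoothSec_eventuallyEq {σ : Π x, Z x} {u : Set X} {x : X} (hu : u ∈ 𝓝 x)
    (hσ : ContMDiffOn 𝓘(ℝ, V) (𝓘(ℝ, V).prod 𝓘(ℝ, F)) ∞ (fun y => TotalSpace.mk' F y (σ y)) u) :
    ∃ τ : Π x, Z x, SmoothSec F V τ ∧ ∀ᶠ y in 𝓝 x, τ y = σ y := by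
  obtain ⟨χ, hχ, hs, h1⟩ := exists_smooth_cutoff V (interior_mem_nhds.2 hu)
  exact ⟨_, ContMDiffOn.smul_section_of_tsupport hχ.contMDiffOn isOpen_interior hs
    (hσ.mono interior_subset), h1.mono fun y hy => by simp [hy]⟩

variable (F) in
/-- A smooth frame near `x`, cut off to global sections and coframe. -/
theorem exists_smooth_frame (x : X) :
    ∃ (s : Fin (Module.finrank ℝ F) → Π y, Z y)
      (c : Fin (Module.finrank ℝ F) → Π y, Z y →ₗ[ℝ] ℝ),
      (∀ i, SmoothSec F V (s i)) ∧
      (∀ i (σ : Π y, Z y), SmoothSec F V σ → SmoothFun V (fun y => c i y (σ y))) ∧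
      ∀ᶠ y in 𝓝 x, ∃ b : Module.Basis (Fin (Module.finrank ℝ F)) ℝ (Z y),
        (∀ i, b i = s i y) ∧ ∀ i, b.coord i = c i y := by
  let t := trivializationAt F Z x
  have hx : t.baseSet ∈ 𝓝 x := t.open_baseSet.mem_nhds (FiberBundle.mem_baseSet_trivializationAt' x)
  obtain ⟨χ, hχ, hs, h1⟩ := exists_smooth_cutoff V hx
  have : ContMDiffVectorBundle 1 F Z 𝓘(ℝ, V) :=
    ContMDiffVectorBundle.of_le (n := ∞) (by simp)
  let b := Module.finBasis ℝ F
  refine ⟨fun i y => χ y • t.localFrame b i y, fun i y => χ y • t.localFrameCoeff 𝓘(ℝ, V) b i y,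
    fun i => ?_, fun i σ hσ => ?_, ?_⟩
  · exact ContMDiffOn.smul_section_of_tsupport hχ.contMDiffOn t.open_baseSet hs
      (t.contMDiffOn_localFrame_baseSet ∞ b i)
  · refine contMDiff_of_tsupport fun y hy => ?_
    have hy' := hs (tsupport_smul_subset_left _ _ hy)
    exact (hχ y).mul (contMDiffAt_localFrameCoeff b hy' (hσ y) i)
  · filter_upwards [hx, h1] with y hy hy1
    refine ⟨t.basisAt b hy, fun i => ?_, fun i => ?_⟩
    · simp [hy1, hy]
    · ext z
      obtain ⟨σ, rfl⟩ : ∃ σ : Π y, Z y, σ y = z := by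
        classical
        exact ⟨Function.update 0 y z, by simp⟩
      simp only [hy1, one_smul]
      rw [t.localFrameCoeff_apply_of_mem_baseSet b hy σ i]
      rfl

variable (V F) in
-- The curvature and the exterior derivatives are defined through `FiberBundle.extend`, whose
-- smoothness is only known near the point. Passing to a global section with the same germ lets all
-- later rules be stated for global smooth sections.
theorem exists_smoothSec_eq_extend {x : X} (z : Z x) :
    ∃ σ : Π y, Z y, SmoothSec F V σ ∧ ∀ᶠ y in 𝓝 x, σ y = FiberBundle.extend F z y := by
  obtain ⟨s, hs, h⟩ := FiberBundle.exists_contMDiffOn_extend (k := ∞) 𝓘(ℝ, V) F z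
  exact exists_smoothSec_eventuallyEq hs h

variable (V F) in
theorem exists_smoothSec_apply_eq {x : X} (z : Z x) :
    ∃ σ : Π y, Z y, SmoothSec F V σ ∧ σ x = z := by
  obtain ⟨σ, hσ, h⟩ := exists_smoothSec_eq_extend V F z
  exact ⟨σ, hσ, by simp [h.self_of_nhds]⟩

/-- A map on smooth sections that is linear over smooth functions at `x` depends only on the
value at `x`. -/
theorem eq_zero_of_tensorial {A : Type*} [AddCommGroup A] [Module ℝ A] {x : X}
    (L : (Π y, Z y) → A)
    (hadd : ∀ σ τ : Π y, Z y, SmoothSec F V σ → SmoothSec F V τ →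
      L (fun y => σ y + τ y) = L σ + L τ)
    (hsmul : ∀ (f : X → ℝ) (σ : Π y, Z y), SmoothFun V f → SmoothSec F V σ →
      L (fun y => f y • σ y) = f x • L σ)
    {σ : Π y, Z y} (hσ : SmoothSec F V σ) (h0 : σ x = 0) : L σ = 0 := by
  obtain ⟨s, c, hs, hc, hb⟩ := exists_smooth_frame (V := V) F (Z := Z) x
  obtain ⟨χ, hχ, hsupp, h1⟩ := exists_smooth_cutoff V hb
  have hcσ : ∀ i, SmoothSec F V (fun y => (χ y * c i y (σ y)) • s i y) := fun i =>
    SmoothSec.smul (f := fun y => χ y * c i y (σ y)) (hχ.mul (hc i σ hσ)) (hs i)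
  have hsum : ∀ (S : Finset (Fin (Module.finrank ℝ F))),
      L (fun y => ∑ i ∈ S, (χ y * c i y (σ y)) • s i y) = 0 := by
    intro S
    induction S using Finset.induction_on with
    | empty =>
      have := hsmul (fun _ => 0) σ contMDiff_const hσ
      simpa using this
    | insert a S ha ih =>
      simp only [Finset.sum_insert ha]
      rw [hadd _ _ (hcσ a) (SmoothSec.sum _ fun i _ => hcσ i), ih,
        hsmul (fun y => χ y * c a y (σ y)) _ (hχ.mul (hc a σ hσ)) (hs a)]
      simp [h0]
  -- `L` is not assumed local, so the section is split globally: the first summand is a combination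
  -- of frame sections whose coefficients vanish at `x`, the second carries the factor `1 - χ`,
  -- which also vanishes at `x`.
  have hσ' : σ = fun y => χ y • σ y + (1 - χ y) • σ y := by
    ext y; module
  have hχσ : (fun y => χ y • σ y) = fun y => ∑ i, (χ y * c i y (σ y)) • s i y := by
    ext y
    by_cases hy : χ y = 0
    · simp [hy]
    · obtain ⟨b, hb1, hb2⟩ := hsupp (subset_tsupport _ hy)
      conv_lhs => rw [← b.sum_repr (σ y), Finset.smul_sum]
      refine Finset.sum_congr rfl fun i _ => ?_
      rw [← hb1, ← hb2, mul_smul]; rfl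
  have hχ' : SmoothFun V (fun y => 1 - χ y) := contMDiff_const.sub hχ
  rw [hσ', hadd _ _ (SmoothSec.smul hχ hσ) (SmoothSec.smul hχ' hσ), hχσ, hsum, hsmul _ _ hχ' hσ,
    h1.self_of_nhds]
  simp

theorem eq_of_tensorial {A : Type*} [AddCommGroup A] [Module ℝ A] {x : X}
    (L : (Π y, Z y) → A)
    (hadd : ∀ σ τ : Π y, Z y, SmoothSec F V σ → SmoothSec F V τ →
      L (fun y => σ y + τ y) = L σ + L τ)
    (hsmul : ∀ (f : X → ℝ) (σ : Π y, Z y), SmoothFun V f → SmoothSec F V σ →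
      L (fun y => f y • σ y) = f x • L σ)
    {σ τ : Π y, Z y} (hσ : SmoothSec F V σ) (hτ : SmoothSec F V τ) (h : σ x = τ x) :
    L σ = L τ := by
  have h0 := eq_zero_of_tensorial L hadd hsmul (hσ.sub hτ) (by simp [h])
  have h1 := hadd _ _ (hσ.sub hτ) hτ
  simp only [sub_add_cancel] at h1
  rw [h1, h0, zero_add]

end SmoothSections

/-! ### Covariant derivatives of smooth sections. -/

section Covariant

variable {V : Type*} [NormedAddCommGroup V] [NormedSpace ℝ V]
  {X : Type*} [TopologicalSpace X] [ChartedSpace V X]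
  {F : Type*} [NormedAddCommGroup F] [NormedSpace ℝ F]
  {Z : X → Type*} [TopologicalSpace (TotalSpace F Z)]
  [∀ x, TopologicalSpace (Z x)] [FiberBundle F Z]
  [∀ x, AddCommGroup (Z x)] [∀ x, Module ℝ (Z x)] [VectorBundle ℝ F Z]
  [∀ x, IsTopologicalAddGroup (Z x)] [∀ x, ContinuousSMul ℝ (Z x)]
  (D : CovariantDerivative 𝓘(ℝ, V) F Z)

theorem cov_add {σ τ : Π x, Z x} (hσ : SmoothSec F V σ) (hτ : SmoothSec F V τ) (x : X)
    (v : TangentSpace 𝓘(ℝ, V) x) : D (fun y => σ y + τ y) x v = D σ x v + D τ x v := by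
  rw [show (fun y => σ y + τ y) = σ + τ from rfl,
    D.isCovariantDerivativeOnUniv.add (hσ.mdifferentiableAt x) (hτ.mdifferentiableAt x)]
  rfl

theorem cov_smul {f : X → ℝ} {σ : Π x, Z x} (hf : SmoothFun V f) (hσ : SmoothSec F V σ) (x : X)
    (v : TangentSpace 𝓘(ℝ, V) x) :
    D (fun y => f y • σ y) x v = f x • D σ x v + mvfderiv 𝓘(ℝ, V) f x v • σ x := by
  rw [show (fun y => f y • σ y) = f • σ from rfl,
    D.isCovariantDerivativeOnUniv.leibniz (hσ.mdifferentiableAt x) (hf.mdifferentiableAt x)]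
  rfl

theorem cov_const_smul {σ : Π x, Z x} (c : ℝ) (hσ : SmoothSec F V σ) (x : X)
    (v : TangentSpace 𝓘(ℝ, V) x) : D (fun y => c • σ y) x v = c • D σ x v := by
  rw [show (fun y => c • σ y) = c • σ from rfl,
    D.isCovariantDerivativeOnUniv.smul_const c (hσ.mdifferentiableAt x)]
  rfl

theorem cov_neg {σ : Π x, Z x} (hσ : SmoothSec F V σ) (x : X)
    (v : TangentSpace 𝓘(ℝ, V) x) : D (fun y => - σ y) x v = - D σ x v := by
  have := cov_const_smul D (-1) hσ x v
  simpa using this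

theorem cov_sub {σ τ : Π x, Z x} (hσ : SmoothSec F V σ) (hτ : SmoothSec F V τ) (x : X)
    (v : TangentSpace 𝓘(ℝ, V) x) : D (fun y => σ y - τ y) x v = D σ x v - D τ x v := by
  simp only [sub_eq_add_neg]
  rw [cov_add D hσ hτ.neg, cov_neg D hτ]

theorem cov_zero (x : X) (v : TangentSpace 𝓘(ℝ, V) x) :
    D (fun y => (0 : Z y)) x v = 0 := by
  have := cov_const_smul D 0 (SmoothSec.zero (F := F) (V := V) (Z := Z)) x v
  simpa using this

theorem cov_sum {ι : Type*} (s : Finset ι) {σ : ι → Π x, Z x}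
    (hσ : ∀ i ∈ s, SmoothSec F V (σ i)) (x : X) (v : TangentSpace 𝓘(ℝ, V) x) :
    D (fun y => ∑ i ∈ s, σ i y) x v = ∑ i ∈ s, D (σ i) x v := by
  classical
  induction s using Finset.induction_on with
  | empty => simpa using cov_zero D x v
  | insert a s ha ih =>
    simp only [Finset.sum_insert ha]
    rw [cov_add D (hσ a (by simp)) (SmoothSec.sum s fun i hi => hσ i (by simp [hi])),
      ih fun i hi => hσ i (by simp [hi])]

theorem cov_congr {σ τ : Π x, Z x} (hσ : SmoothSec F V σ) {x : X}
    (h : ∀ᶠ y in 𝓝 x, τ y = σ y) : D τ x = D σ x :=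
  D.isCovariantDerivativeOnUniv.congr_of_eventuallyEq
    (mdifferentiableAt_congr_section (hσ.mdifferentiableAt x) h) (hσ.mdifferentiableAt x)
    Filter.univ_mem h

variable [IsManifold 𝓘(ℝ, V) ∞ X]

theorem SmoothSec.cov {D : CovariantDerivative 𝓘(ℝ, V) F Z} [IsManifold 𝓘(ℝ, V) 1 X]
    (hD : D.ContMDiffCovariantDerivative ∞)
    {σ : Π x, Z x} {W : Π x : X, TangentSpace 𝓘(ℝ, V) x} (hσ : SmoothSec F V σ)
    (hW : SmoothSec V V W) : SmoothSec F V (fun y => D σ y (W y)) := by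
  have h := hD.contMDiff.contMDiff (σ := σ) (by simpa using hσ.contMDiffOn)
  exact ContMDiff.clm_bundle_apply (contMDiffOn_univ.1 h) hW

variable [FiniteDimensional ℝ V] [T2Space X]
  [FiniteDimensional ℝ F] [ContMDiffVectorBundle ∞ F Z 𝓘(ℝ, V)]

/-- Start from any extension and subtract a sum of f_i τ_i, where f_i vanishes at `x` with
differential the i-th dual basis form and τ_i has value the i-th derivative of the extension. The
value at `x` is unchanged and the derivative is cancelled. -/
theorem exists_smoothSec_cov_eq_zero {x : X} (z : Z x) :
    ∃ σ : Π y, Z y, SmoothSec F V σ ∧ σ x = z ∧ D σ x = 0 := by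
  obtain ⟨σ₀, hσ₀, rfl⟩ := exists_smoothSec_apply_eq V F z
  have : FiniteDimensional ℝ (TangentSpace 𝓘(ℝ, V) x) := inferInstanceAs (FiniteDimensional ℝ V)
  have : T2Space (TangentSpace 𝓘(ℝ, V) x) := inferInstanceAs (T2Space V)
  let b := Module.finBasis ℝ (TangentSpace 𝓘(ℝ, V) x)
  choose f hf hf0 hdf using fun i => exists_smoothFun_mvfderiv_eq (V := V) x
    (LinearMap.toContinuousLinearMap (b.coord i))
  choose τ hτ hτx using fun i => exists_smoothSec_apply_eq V F (D σ₀ x (b i))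
  have hs : SmoothSec F V (fun y => ∑ i, f i y • τ i y) :=
    SmoothSec.sum _ fun i _ => SmoothSec.smul (hf i) (hτ i)
  refine ⟨fun y => σ₀ y - ∑ i, f i y • τ i y, hσ₀.sub hs, by simp [hf0], ?_⟩
  ext v
  rw [cov_sub D hσ₀ hs, cov_sum D _ fun i _ => SmoothSec.smul (hf i) (hτ i)]
  simp_rw [cov_smul D (hf _) (hτ _), hf0, hτx, hdf]
  have hv : D σ₀ x v = ∑ i, b.coord i v • D σ₀ x (b i) := by
    conv_lhs => rw [← b.sum_repr v, map_sum]
    exact Finset.sum_congr rfl fun i _ => map_smul _ _ _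
  simp [hv]

end Covariant

/-! ### Differentials of real functions. -/

section SmoothFunctions

variable {V : Type*} [NormedAddCommGroup V] [NormedSpace ℝ V]
  {X : Type*} [TopologicalSpace X] [ChartedSpace V X]

theorem mvfderiv_congr {f g : X → ℝ} {x : X} (h : ∀ᶠ y in 𝓝 x, f y = g y) :
    mvfderiv 𝓘(ℝ, V) f x = mvfderiv 𝓘(ℝ, V) g x := by
  have h' : f =ᶠ[𝓝 x] g := h
  ext v
  exact DFunLike.congr_fun (h'.mfderiv_eq (I := 𝓘(ℝ, V)) (I' := 𝓘(ℝ, ℝ))) v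

theorem mvfderiv_mul_apply {f g : X → ℝ} (hf : SmoothFun V f) (hg : SmoothFun V g) (x : X)
    (v : TangentSpace 𝓘(ℝ, V) x) :
    mvfderiv 𝓘(ℝ, V) (fun y => f y * g y) x v =
      f x * mvfderiv 𝓘(ℝ, V) g x v + mvfderiv 𝓘(ℝ, V) f x v * g x := by
  rw [show (fun y => f y * g y) = f * g from rfl,
    mvfderiv_mul (hf.mdifferentiableAt x) (hg.mdifferentiableAt x)]
  simp [mul_comm]

theorem mvfderiv_add_apply {f g : X → ℝ} (hf : SmoothFun V f) (hg : SmoothFun V g) (x : X)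
    (v : TangentSpace 𝓘(ℝ, V) x) :
    mvfderiv 𝓘(ℝ, V) (fun y => f y + g y) x v =
      mvfderiv 𝓘(ℝ, V) f x v + mvfderiv 𝓘(ℝ, V) g x v := by
  rw [show (fun y => f y + g y) = f + g from rfl,
    mvfderiv_add (hf.mdifferentiableAt x) (hg.mdifferentiableAt x)]
  rfl

theorem mvfderiv_const_apply (c : ℝ) (x : X) (v : TangentSpace 𝓘(ℝ, V) x) :
    mvfderiv 𝓘(ℝ, V) (fun _ => c) x v = 0 := by
  rw [mvfderiv_const]; rfl

theorem mvfderiv_const_mul_apply {f : X → ℝ} (c : ℝ) (hf : SmoothFun V f) (x : X)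
    (v : TangentSpace 𝓘(ℝ, V) x) :
    mvfderiv 𝓘(ℝ, V) (fun y => c * f y) x v = c * mvfderiv 𝓘(ℝ, V) f x v := by
  rw [mvfderiv_mul_apply contMDiff_const hf, mvfderiv_const_apply]
  ring

theorem mvfderiv_sum_apply {ι : Type*} (s : Finset ι) {f : ι → X → ℝ}
    (hf : ∀ i ∈ s, SmoothFun V (f i)) (x : X) (v : TangentSpace 𝓘(ℝ, V) x) :
    mvfderiv 𝓘(ℝ, V) (fun y => ∑ i ∈ s, f i y) x v = ∑ i ∈ s, mvfderiv 𝓘(ℝ, V) (f i) x v := by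
  classical
  induction s using Finset.induction_on with
  | empty => simpa using mvfderiv_const_apply 0 x v
  | insert a s ha ih =>
    simp only [Finset.sum_insert ha]
    rw [mvfderiv_add_apply (hf a (by simp)) (SmoothFun.sum s fun i hi => hf i (by simp [hi])),
      ih fun i hi => hf i (by simp [hi])]

theorem SmoothFun.det {ι : Type*} [Fintype ι] [DecidableEq ι] {M : X → Matrix ι ι ℝ}
    (hM : ∀ i j, SmoothFun V (fun x => M x i j)) : SmoothFun V (fun x => (M x).det) := by
  simp only [Matrix.det_apply]
  refine SmoothFun.sum _ fun σ _ => ?_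
  have : SmoothFun V (fun x => ∏ i, M x (σ i) i) := contMDiff_finsetProd fun i _ => hM _ _
  exact contMDiff_const (c := ((Equiv.Perm.sign σ : ℤ) : ℝ)) |>.mul this |>.congr
    fun x => by simp [Units.smul_def]

theorem SmoothFun.adjugate {ι : Type*} [Fintype ι] [DecidableEq ι] {M : X → Matrix ι ι ℝ}
    (hM : ∀ i j, SmoothFun V (fun x => M x i j)) (k l : ι) :
    SmoothFun V (fun x => (M x).adjugate k l) := by
  simp only [Matrix.adjugate_apply]
  refine SmoothFun.det fun i j => ?_
  by_cases h : i = l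
  · subst h; simpa using contMDiff_const
  · simpa [Matrix.updateRow_ne h] using hM i j

variable [FiniteDimensional ℝ V] [T2Space X] [IsManifold 𝓘(ℝ, V) ∞ X]

theorem exists_smoothFun_eventuallyEq {f : X → ℝ} {u : Set X} {x : X} (hu : u ∈ 𝓝 x)
    (hf : ContMDiffOn 𝓘(ℝ, V) 𝓘(ℝ, ℝ) ∞ f u) :
    ∃ g : X → ℝ, SmoothFun V g ∧ ∀ᶠ y in 𝓝 x, g y = f y := by
  obtain ⟨χ, hχ, hs, h1⟩ := exists_smooth_cutoff V (interior_mem_nhds.2 hu)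
  refine ⟨fun y => χ y * f y, ?_, h1.mono fun y hy => by simp [hy]⟩
  refine contMDiff_of_tsupport fun y hy => ?_
  have hy' := hs (tsupport_mul_subset_left hy)
  exact (hχ y).mul (hf.contMDiffAt (mem_interior_iff_mem_nhds.1 hy'))

end SmoothFunctions

/-! ### Differentiating the trace of an endomorphism field. -/

section EndTrace

variable {V : Type*} [NormedAddCommGroup V] [NormedSpace ℝ V] [FiniteDimensional ℝ V]
  {X : Type*} [TopologicalSpace X] [ChartedSpace V X] [T2Space X] [IsManifold 𝓘(ℝ, V) ∞ X]
  {F : Type*} [NormedAddCommGroup F] [NormedSpace ℝ F] [FiniteDimensional ℝ F]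
  {Z : X → Type*} [TopologicalSpace (TotalSpace F Z)]
  [∀ x, TopologicalSpace (Z x)] [FiberBundle F Z]
  [∀ x, AddCommGroup (Z x)] [∀ x, Module ℝ (Z x)] [VectorBundle ℝ F Z]
  [∀ x, IsTopologicalAddGroup (Z x)] [∀ x, ContinuousSMul ℝ (Z x)]
  [ContMDiffVectorBundle ∞ F Z 𝓘(ℝ, V)]
  (D : CovariantDerivative 𝓘(ℝ, V) F Z)
  {Ψ : Π x : X, Z x →ₗ[ℝ] Z x}

/-- The Leibniz terms df(v) Ψσ of the two summands cancel, so the commutator of ∇ with Ψ is linear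
over functions. -/
theorem endCov_welldefined (hΨ : ∀ σ : Π x, Z x, SmoothSec F V σ → SmoothSec F V (fun x => Ψ x (σ x)))
    {x : X} (v : TangentSpace 𝓘(ℝ, V) x) {σ τ : Π x, Z x} (hσ : SmoothSec F V σ)
    (hτ : SmoothSec F V τ) (h : σ x = τ x) :
    D (fun y => Ψ y (σ y)) x v - Ψ x (D σ x v) = D (fun y => Ψ y (τ y)) x v - Ψ x (D τ x v) := by
  refine eq_of_tensorial (V := V) (F := F) (x := x)
    (fun σ => D (fun y => Ψ y (σ y)) x v - Ψ x (D σ x v)) ?_ ?_ hσ hτ h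
  · intro σ τ hσ hτ
    simp only [map_add]
    rw [cov_add D (hΨ _ hσ) (hΨ _ hτ), cov_add D hσ hτ, map_add]
    abel
  · intro f σ hf hσ
    simp only [map_smul]
    rw [cov_smul D hf (hΨ _ hσ), cov_smul D hf hσ, map_add, map_smul, map_smul, smul_sub]
    abel

theorem SmoothFun.trace
    (hΨ : ∀ σ : Π x, Z x, SmoothSec F V σ → SmoothSec F V (fun x => Ψ x (σ x))) :
    SmoothFun V (fun x => LinearMap.trace ℝ (Z x) (Ψ x)) := by
  refine smoothFun_of_local fun x => ?_
  obtain ⟨s, c, hs, hc, hb⟩ := exists_smooth_frame (V := V) F (Z := Z) x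
  refine ⟨fun y => ∑ i, c i y (Ψ y (s i y)), SmoothFun.sum _ fun i _ => hc i _ (hΨ _ (hs i)), ?_⟩
  filter_upwards [hb] with y ⟨b, h1, h2⟩
  rw [LinearMap.trace_eq_matrix_trace ℝ b, Matrix.trace]
  refine Finset.sum_congr rfl fun i _ => ?_
  rw [← h1, ← h2, Matrix.diag_apply, LinearMap.toMatrix_apply]
  rfl

/-- In a local frame with connection matrix P, the derivative of the trace is the trace of Q + ΨP -
PΨ, and the commutator has trace zero. No parallel frame is needed. -/
theorem mvfderiv_trace
    (hΨ : ∀ σ : Π x, Z x, SmoothSec F V σ → SmoothSec F V (fun x => Ψ x (σ x)))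
    {x : X} (v : TangentSpace 𝓘(ℝ, V) x) (Q : Z x →ₗ[ℝ] Z x)
    (hQ : ∀ σ : Π x, Z x, SmoothSec F V σ →
      Q (σ x) = D (fun y => Ψ y (σ y)) x v - Ψ x (D σ x v)) :
    mvfderiv 𝓘(ℝ, V) (fun y => LinearMap.trace ℝ (Z y) (Ψ y)) x v = LinearMap.trace ℝ (Z x) Q := by
  obtain ⟨s, c, hs, hc, hb⟩ := exists_smooth_frame (V := V) F (Z := Z) x
  have h1 : ∀ᶠ y in 𝓝 x, LinearMap.trace ℝ (Z y) (Ψ y) = ∑ i, c i y (Ψ y (s i y)) := by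
    filter_upwards [hb] with y ⟨b, h1, h2⟩
    rw [LinearMap.trace_eq_matrix_trace ℝ b, Matrix.trace]
    refine Finset.sum_congr rfl fun i _ => ?_
    rw [← h1, ← h2, Matrix.diag_apply, LinearMap.toMatrix_apply]
    rfl
  rw [mvfderiv_congr h1, mvfderiv_sum_apply _ fun i _ => hc i _ (hΨ _ (hs i))]
  obtain ⟨b, hb1, hb2⟩ := hb.self_of_nhds
  have hcs : ∀ i j, c i x (s j x) = if j = i then 1 else 0 := fun i j => by
    rw [← hb1, ← hb2, Module.Basis.coord_apply, b.repr_self, Finsupp.single_apply]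
  -- The derivative of a frame coefficient: the coefficient of the covariant derivative, corrected
  -- by the connection matrix of the frame.
  have key : ∀ (σ : Π x, Z x), SmoothSec F V σ → ∀ i,
      mvfderiv 𝓘(ℝ, V) (fun y => c i y (σ y)) x v =
        c i x (D σ x v) - ∑ j, c j x (σ x) * c i x (D (s j) x v) := by
    intro σ hσ i
    have h2 : ∀ᶠ y in 𝓝 x, σ y = ∑ j, c j y (σ y) • s j y := by
      filter_upwards [hb] with y ⟨b, h1, h2⟩
      conv_lhs => rw [← b.sum_repr (σ y)]
      refine Finset.sum_congr rfl fun i _ => ?_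
      rw [← h1, ← h2]; rfl
    have h3 : SmoothSec F V (fun y => ∑ j, c j y (σ y) • s j y) :=
      SmoothSec.sum _ fun j _ => SmoothSec.smul (hc j σ hσ) (hs j)
    rw [cov_congr D h3 h2, cov_sum D _ fun j _ => SmoothSec.smul (hc j σ hσ) (hs j)]
    simp_rw [cov_smul D (hc _ σ hσ) (hs _), map_sum, map_add, map_smul, smul_eq_mul, hcs,
      Finset.sum_add_distrib]
    simp
  let P : Z x →ₗ[ℝ] Z x := ∑ j, (c j x).smulRight (D (s j) x v)
  have hP : ∀ i, P (s i x) = D (s i) x v := fun i => by simp [P, hcs]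
  have htr : ∀ R : Z x →ₗ[ℝ] Z x, LinearMap.trace ℝ (Z x) R = ∑ i, c i x (R (s i x)) := by
    intro R
    rw [LinearMap.trace_eq_matrix_trace ℝ b, Matrix.trace]
    refine Finset.sum_congr rfl fun i _ => ?_
    rw [← hb1, ← hb2, Matrix.diag_apply, LinearMap.toMatrix_apply]
    rfl
  have hsum : ∀ i, mvfderiv 𝓘(ℝ, V) (fun y => c i y (Ψ y (s i y))) x v =
      c i x ((Q + Ψ x * P - P * Ψ x) (s i x)) := by
    intro i
    have h4 : D (fun y => Ψ y (s i y)) x v = Q (s i x) + Ψ x (P (s i x)) := by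
      rw [hQ _ (hs i), hP]; abel
    rw [key _ (hΨ _ (hs i)), h4]
    simp [P]
  simp_rw [hsum]
  rw [← htr, map_sub, map_add, LinearMap.trace_mul_comm]
  abel

end EndTrace

/-! ### Contractions in a frame that is not orthonormal. -/

section GramMatrix

variable {T : Type*} [NormedAddCommGroup T] [InnerProductSpace ℝ T]
  {ι : Type*} [Fintype ι] [DecidableEq ι]

/-- An invertible Gram matrix forces the vectors to be a basis, by the dimension count; it is then
enough to compare inner products with each of them. -/
theorem eq_sum_gram_inv_smul [FiniteDimensional ℝ T] (hι : Fintype.card ι = Module.finrank ℝ T)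
    (w : ι → T) (G : Matrix ι ι ℝ) (hG : ∀ i j, G i j = inner ℝ (w i) (w j)) (hdet : IsUnit G.det)
    (v : T) : v = ∑ k, ∑ l, (G⁻¹ k l * inner ℝ (w k) v) • w l := by
  have hli : LinearIndependent ℝ w := by
    rw [Fintype.linearIndependent_iff]
    intro a ha i
    have h0 : G.mulVec a = 0 := by
      ext j
      have : inner ℝ (w j) (∑ i, a i • w i) = 0 := by rw [ha, inner_zero_right]
      rw [inner_sum] at this
      simpa [Matrix.mulVec, dotProduct, hG, inner_smul_right, mul_comm] using this
    have := congrArg (G⁻¹).mulVec h0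
    rw [Matrix.mulVec_mulVec, Matrix.nonsing_inv_mul _ hdet] at this
    simpa using congrFun this i
  let b := Module.Basis.mk hli (hli.span_eq_top_of_card_eq_finrank' hι).ge
  refine InnerProductSpace.ext_inner_left_basis (𝕜 := ℝ) b fun j => ?_
  have hb : b j = w j := by simp [b]
  rw [hb, inner_sum]
  simp_rw [inner_sum, inner_smul_right, ← hG]
  have h1 : ∀ k, ∑ l, G⁻¹ k l * inner ℝ (w k) v * G j l = (if k = j then 1 else 0) * inner ℝ (w k) v := by
    intro k
    have hsym : ∀ l, G j l = G l j := fun l => by rw [hG, hG, real_inner_comm]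
    have : (G⁻¹ * G) k j = (1 : Matrix ι ι ℝ) k j := by rw [Matrix.nonsing_inv_mul _ hdet]
    rw [Matrix.mul_apply, Matrix.one_apply] at this
    rw [← this, Finset.sum_mul]
    exact Finset.sum_congr rfl fun l _ => by rw [hsym]; ring
  simp_rw [h1]
  simp

/-- The basis `frame x` is chosen separately at each point and need not vary continuously. This
formula trades it for a smooth frame `w` with coefficients `h`, which is what makes contractions
smooth and differentiable. -/
theorem sum_orthonormal_eq_sum_gram {κ : Type*} [Fintype κ] {A : Type*} [AddCommGroup A]
    [Module ℝ A] (e : OrthonormalBasis κ ℝ T) (w : ι → T) (h : ι → ι → ℝ)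
    (hw : ∀ v : T, v = ∑ k, ∑ l, (h k l * inner ℝ (w k) v) • w l) (B : T →ₗ[ℝ] T →ₗ[ℝ] A) :
    ∑ m, B (e m) (e m) = ∑ k, ∑ l, h k l • B (w k) (w l) := by
  calc ∑ m, B (e m) (e m)
      = ∑ m, ∑ k, ∑ l, (h k l * inner ℝ (w k) (e m)) • B (e m) (w l) := by
        refine Finset.sum_congr rfl fun m _ => ?_
        conv_lhs => enter [2]; rw [hw (e m)]
        simp only [map_sum, map_smul]
    _ = ∑ k, ∑ l, h k l • B (∑ m, inner ℝ (w k) (e m) • e m) (w l) := by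
        rw [Finset.sum_comm]
        refine Finset.sum_congr rfl fun k _ => ?_
        rw [Finset.sum_comm]
        refine Finset.sum_congr rfl fun l _ => ?_
        simp only [map_sum, map_smul, LinearMap.sum_apply, LinearMap.smul_apply, Finset.smul_sum,
          mul_smul]
    _ = _ := by
        have : ∀ k, ∑ m, inner ℝ (w k) (e m) • e m = w k := fun k => by
          simp_rw [real_inner_comm (e _) (w k)]
          exact e.sum_repr' (w k)
        simp_rw [this]

end GramMatrix

theorem SmoothFun.mul {V : Type*} [NormedAddCommGroup V] [NormedSpace ℝ V]
    {X : Type*} [TopologicalSpace X] [ChartedSpace V X] {f g : X → ℝ} (hf : SmoothFun V f)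
    (hg : SmoothFun V g) : SmoothFun V (fun x => f x * g x) :=
  ContMDiff.mul hf hg

/-! ### The Kähler connection and frames parallel at a point. -/

section Contraction

variable {V : Type*} [NormedAddCommGroup V] [NormedSpace ℂ V] [FiniteDimensional ℂ V]
  {X : Type*} [TopologicalSpace X] [T2Space X] [ChartedSpace V X] [IsManifold 𝓘(ℂ, V) ω X]
  [RiemannianBundle (fun x : X => TangentSpace 𝓘(ℝ, V) x)]
  [IsContMDiffRiemannianBundle 𝓘(ℝ, V) ∞ V (fun x : X => TangentSpace 𝓘(ℝ, V) x)]

theorem SmoothSec.inner {U W : Π x : X, TangentSpace 𝓘(ℝ, V) x} (hU : SmoothSec V V U)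
    (hW : SmoothSec V V W) : SmoothFun V (fun x => inner ℝ (U x) (W x)) :=
  ContMDiff.inner_bundle hU hW

/-- The Levi-Civita connection of a Kähler metric, tested on smooth fields. -/
structure IsKahlerConnection
    (D : CovariantDerivative 𝓘(ℝ, V) V (fun x : X => TangentSpace 𝓘(ℝ, V) x)) : Prop where
  smooth : D.ContMDiffCovariantDerivative ∞
  inner : ∀ (U W : Π x : X, TangentSpace 𝓘(ℝ, V) x), SmoothSec V V U → SmoothSec V V W →
    ∀ (x : X) (v : TangentSpace 𝓘(ℝ, V) x),
      mvfderiv 𝓘(ℝ, V) (fun y => inner ℝ (U y) (W y)) x v =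
        inner ℝ (D U x v) (W x) + inner ℝ (U x) (D W x v)
  torsion : ∀ (U W : Π x : X, TangentSpace 𝓘(ℝ, V) x), SmoothSec V V U → SmoothSec V V W →
    ∀ x : X, VectorField.mlieBracket 𝓘(ℝ, V) U W x = D W x (U x) - D U x (W x)
  parallel : ∀ (W : Π x : X, TangentSpace 𝓘(ℝ, V) x), SmoothSec V V W →
    ∀ (x : X) (v : TangentSpace 𝓘(ℝ, V) x), D (fun y => J y (W y)) x v = J x (D W x v)

theorem IsKahler.exists_connection (hX : IsKahler V X) :
    ∃ D : CovariantDerivative 𝓘(ℝ, V) V (fun x : X => TangentSpace 𝓘(ℝ, V) x),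
      IsKahlerConnection D := by
  obtain ⟨D, h1, h2, h3, h4⟩ := hX.parallel
  refine ⟨D, h1, fun U W hU hW x v => ?_, fun U W hU hW x => ?_, fun W hW x v => ?_⟩
  · obtain ⟨Y, -, rfl⟩ := exists_smoothSec_apply_eq V V v
    exact h2.mvfderiv_inner_eq Y (hU.mdifferentiableAt x) (hW.mdifferentiableAt x)
  · exact ((CovariantDerivative.torsion_eq_zero_iff D).1 h3 (hU.mdifferentiableAt x)
      (hW.mdifferentiableAt x)).symm
  · exact h4 W x v (hW.mdifferentiableAt x)

/-- Smooth fields extending the orthonormal frame at `x` that are parallel at `x` for `D`. -/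
structure IsNormalFrame (D : CovariantDerivative 𝓘(ℝ, V) V (fun x : X => TangentSpace 𝓘(ℝ, V) x))
    (x : X) (W : Fin (Module.finrank ℝ (TangentSpace 𝓘(ℝ, V) x)) → Π y : X, TangentSpace 𝓘(ℝ, V) y) :
    Prop where
  smooth : ∀ k, SmoothSec V V (W k)
  apply_self : ∀ k, W k x = frame x k
  cov_eq_zero : ∀ k, D (W k) x = 0

theorem exists_isNormalFrame
    (D : CovariantDerivative 𝓘(ℝ, V) V (fun x : X => TangentSpace 𝓘(ℝ, V) x)) (x : X) :
    ∃ W, IsNormalFrame D x W := by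
  choose W h1 h2 h3 using fun k => exists_smoothSec_cov_eq_zero D (frame x k)
  exact ⟨W, h1, h2, h3⟩

/-- By metric compatibility, the Gram matrix of a frame that is orthonormal and parallel at `x`
equals the identity to first order there, and so does its inverse. A contraction may therefore be
differentiated at `x` as if the frame were orthonormal nearby. -/
theorem IsNormalFrame.exists_gram_inv
    {D : CovariantDerivative 𝓘(ℝ, V) V (fun x : X => TangentSpace 𝓘(ℝ, V) x)}
    (hD : IsKahlerConnection D) {x : X}
    {W : Fin (Module.finrank ℝ (TangentSpace 𝓘(ℝ, V) x)) → Π y : X, TangentSpace 𝓘(ℝ, V) y}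
    (hW : IsNormalFrame D x W) :
    ∃ h : Fin (Module.finrank ℝ (TangentSpace 𝓘(ℝ, V) x)) →
        Fin (Module.finrank ℝ (TangentSpace 𝓘(ℝ, V) x)) → X → ℝ,
      (∀ k l, SmoothFun V (h k l)) ∧ (∀ k l, h k l x = if k = l then 1 else 0) ∧
      (∀ k l v, mvfderiv 𝓘(ℝ, V) (h k l) x v = 0) ∧
      ∀ᶠ y in 𝓝 x, ∀ v : TangentSpace 𝓘(ℝ, V) y,
        v = ∑ k, ∑ l, (h k l y * inner ℝ (W k y) v) • W l y := by
  let G : X → Matrix (Fin (Module.finrank ℝ (TangentSpace 𝓘(ℝ, V) x)))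
    (Fin (Module.finrank ℝ (TangentSpace 𝓘(ℝ, V) x))) ℝ :=
    fun y => Matrix.of fun i j => inner ℝ (W i y) (W j y)
  have hG : ∀ i j, SmoothFun V (fun y => G y i j) := fun i j =>
    SmoothSec.inner (hW.smooth i) (hW.smooth j)
  have hGx : G x = 1 := by
    ext i j
    simp only [G, Matrix.of_apply, hW.apply_self, Matrix.one_apply]
    exact orthonormal_iff_ite.1 (frame x).orthonormal i j
  have hdG : ∀ i j v, mvfderiv 𝓘(ℝ, V) (fun y => G y i j) x v = 0 := fun i j v => by
    have := hD.inner _ _ (hW.smooth i) (hW.smooth j) x v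
    simp only [hW.cov_eq_zero] at this
    simpa [G] using this
  have hdet : SmoothFun V (fun y => (G y).det) := SmoothFun.det hG
  have hU : ∀ᶠ y in 𝓝 x, (G y).det ≠ 0 := by
    have hc : ContinuousAt (fun y => (G y).det) x := hdet.continuous.continuousAt
    exact hc.eventually_ne (by simp [hGx])
  have hinv : ∀ k l, ∃ g : X → ℝ, SmoothFun V g ∧ ∀ᶠ y in 𝓝 x, g y = (G y)⁻¹ k l := by
    intro k l
    refine exists_smoothFun_eventuallyEq hU fun y hy => ContMDiffAt.contMDiffWithinAt ?_
    have h1 : ContMDiffAt 𝓘(ℝ, V) 𝓘(ℝ, ℝ) ∞ (fun y => (G y).det⁻¹) y :=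
      ContDiffAt.comp_contMDiffAt (g := fun t : ℝ => t⁻¹) (contDiffAt_inv ℝ hy) (hdet y)
    have h2 := h1.mul (SmoothFun.adjugate hG k l y)
    refine h2.congr_of_eventuallyEq ?_
    filter_upwards [] with z
    simp [Matrix.inv_def]
  choose h hh he using hinv
  have hx : ∀ k l, h k l x = if k = l then 1 else 0 := fun k l => by
    rw [(he k l).self_of_nhds, hGx, inv_one, Matrix.one_apply]
  have hee : ∀ᶠ y in 𝓝 x, ∀ k l, h k l y = (G y)⁻¹ k l := by
    simpa only [Filter.eventually_all] using he
  refine ⟨h, hh, hx, fun k l v => ?_, ?_⟩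
  -- Differentiate G h = 1 at `x`, where G = 1 and dG = 0.
  · have h1 : ∀ᶠ y in 𝓝 x, ∑ j, G y k j * h j l y = if k = l then 1 else 0 := by
      filter_upwards [hee, hU] with y hy hy'
      simp_rw [hy]
      rw [← Matrix.mul_apply, Matrix.mul_nonsing_inv _ (isUnit_iff_ne_zero.2 hy'), Matrix.one_apply]
    have h2 := congrArg (fun f => f v) (mvfderiv_congr (V := V) h1)
    simp only [mvfderiv_const_apply] at h2
    rw [mvfderiv_sum_apply _ fun j _ => SmoothFun.mul (hG k j) (hh j l)] at h2
    simp_rw [mvfderiv_mul_apply (hG k _) (hh _ l), hdG, hGx, Matrix.one_apply] at h2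
    simpa using h2
  · filter_upwards [hee, hU] with y hy hy' v
    have := eq_sum_gram_inv_smul (T := TangentSpace 𝓘(ℝ, V) y) (by simp; rfl) (fun k => W k y) (G y)
      (fun _ _ => rfl) (isUnit_iff_ne_zero.2 hy') v
    simp_rw [hy]
    exact this

end Contraction

/-! ### Smoothness of the complex structure. -/

section ComplexStructure

variable {V : Type*} [NormedAddCommGroup V] [NormedSpace ℂ V] [FiniteDimensional ℂ V]
  {X : Type*} [TopologicalSpace X] [ChartedSpace V X] [IsManifold 𝓘(ℂ, V) ω X]

/-- Transition maps are holomorphic, so their real derivatives commute with multiplication by i.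
This makes the pointwise definition of `J` through preferred charts the same as multiplication by i
in one fixed trivialization, and hence smooth. -/
theorem trivializationAt_J {x₀ x : X} (hx : x ∈ (chartAt V x₀).source)
    (w : TangentSpace 𝓘(ℝ, V) x) :
    (trivializationAt V (TangentSpace 𝓘(ℝ, V) : X → Type _) x₀ ⟨x, J x w⟩).2 =
      Complex.I • (trivializationAt V (TangentSpace 𝓘(ℝ, V) : X → Type _) x₀ ⟨x, w⟩).2 := by
  rw [TangentBundle.trivializationAt_apply, TangentBundle.trivializationAt_apply]
  simp only [OpenPartialHomeomorph.extend, modelWithCornersSelf_partialEquiv, PartialEquiv.trans_refl,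
    modelWithCornersSelf_coe, range_id, fderivWithin_univ, OpenPartialHomeomorph.coe_toPartialEquiv,
    OpenPartialHomeomorph.coe_toPartialEquiv_symm]
  have hc := (contDiffGroupoid ω 𝓘(ℂ, V)).compatible (chart_mem_atlas V x) (chart_mem_atlas V x₀)
  rw [contDiffGroupoid, mem_groupoid_of_pregroupoid] at hc
  have hc1 := hc.1
  simp only [contDiffPregroupoid, modelWithCornersSelf_coe, modelWithCornersSelf_coe_symm,
    Function.comp_id, Function.id_comp, preimage_id_eq, id, range_id, inter_univ] at hc1
  have hmem : chartAt V x x ∈ ((chartAt V x).symm ≫ₕ chartAt V x₀).source := by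
    simp [hx]
  have hd : DifferentiableAt ℂ ((chartAt V x).symm ≫ₕ chartAt V x₀) (chartAt V x x) :=
    (hc1.contDiffAt (((chartAt V x).symm ≫ₕ chartAt V x₀).open_source.mem_nhds hmem)).differentiableAt
      (by simp)
  have hf := (hd.hasFDerivAt.restrictScalars ℝ).fderiv
  rw [OpenPartialHomeomorph.coe_trans] at hf
  rw [hf]
  exact map_smul (fderiv ℂ ((chartAt V x).symm ≫ₕ chartAt V x₀) (chartAt V x x)) Complex.I (show V from w)

theorem SmoothSec.J {W : Π x : X, TangentSpace 𝓘(ℝ, V) x} (hW : SmoothSec V V W) :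
    SmoothSec V V (fun x => J x (W x)) := by
  intro x₀
  rw [contMDiffAt_section]
  have h := (contMDiffAt_section _).1 (hW x₀)
  have h2 : ContMDiffAt 𝓘(ℝ, V) 𝓘(ℝ, V) ∞ (fun x : X => Complex.I •
      (trivializationAt V (TangentSpace 𝓘(ℝ, V) : X → Type _) x₀ ⟨x, W x⟩).2) x₀ :=
    ContDiffAt.comp_contMDiffAt (g := fun v : V => Complex.I • v)
      (contDiff_const_smul Complex.I).contDiffAt h
  refine h2.congr_of_eventuallyEq ?_
  filter_upwards [chart_source_mem_nhds V x₀] with x hx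
  exact trivializationAt_J hx (W x)

theorem J_J (x : X) (v : TangentSpace 𝓘(ℝ, V) x) : J x (J x v) = - v := by
  have h : ∀ w : V, Complex.I • Complex.I • w = - w := fun w => by
    rw [smul_smul, Complex.I_mul_I, neg_one_smul]
  exact h v

end ComplexStructure

/-! ### Smoothness and derivatives of contractions. -/

section Contraction

variable {V : Type*} [NormedAddCommGroup V] [NormedSpace ℂ V] [FiniteDimensional ℂ V]
  {X : Type*} [TopologicalSpace X] [T2Space X] [ChartedSpace V X] [IsManifold 𝓘(ℂ, V) ω X]
  [RiemannianBundle (fun x : X => TangentSpace 𝓘(ℝ, V) x)]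
  [IsContMDiffRiemannianBundle 𝓘(ℝ, V) ∞ V (fun x : X => TangentSpace 𝓘(ℝ, V) x)]
  {D : CovariantDerivative 𝓘(ℝ, V) V (fun x : X => TangentSpace 𝓘(ℝ, V) x)}

section Functions

variable {B : Π x : X, TangentSpace 𝓘(ℝ, V) x →ₗ[ℝ] TangentSpace 𝓘(ℝ, V) x →ₗ[ℝ] ℝ}

theorem SmoothFun.contraction (hD : IsKahlerConnection D)
    (hB : ∀ U W : Π x : X, TangentSpace 𝓘(ℝ, V) x, SmoothSec V V U → SmoothSec V V W →
      SmoothFun V (fun x => B x (U x) (W x))) :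
    SmoothFun V (fun x => ∑ k, B x (frame x k) (frame x k)) := by
  refine smoothFun_of_local fun x => ?_
  obtain ⟨W, hW⟩ := exists_isNormalFrame D x
  obtain ⟨h, hh, -, -, he⟩ := hW.exists_gram_inv hD
  refine ⟨fun y => ∑ k, ∑ l, h k l y * B y (W k y) (W l y),
    SmoothFun.sum _ fun k _ => SmoothFun.sum _ fun l _ => SmoothFun.mul (hh k l)
      (hB _ _ (hW.smooth k) (hW.smooth l)), ?_⟩
  filter_upwards [he] with y hy
  exact sum_orthonormal_eq_sum_gram (frame y) (fun k => W k y) (fun k l => h k l y) hy (B y)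

end Functions

variable {F : Type*} [NormedAddCommGroup F] [NormedSpace ℝ F] [FiniteDimensional ℝ F]
  {Z : X → Type*} [TopologicalSpace (TotalSpace F Z)]
  [∀ x, TopologicalSpace (Z x)] [FiberBundle F Z]
  [∀ x, AddCommGroup (Z x)] [∀ x, Module ℝ (Z x)] [VectorBundle ℝ F Z]
  [∀ x, IsTopologicalAddGroup (Z x)] [∀ x, ContinuousSMul ℝ (Z x)]
  [ContMDiffVectorBundle ∞ F Z 𝓘(ℝ, V)]
  {B : Π x : X, TangentSpace 𝓘(ℝ, V) x →ₗ[ℝ] TangentSpace 𝓘(ℝ, V) x →ₗ[ℝ] Z x}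

theorem SmoothSec.contraction (hD : IsKahlerConnection D)
    (hB : ∀ U W : Π x : X, TangentSpace 𝓘(ℝ, V) x, SmoothSec V V U → SmoothSec V V W →
      SmoothSec F V (fun x => B x (U x) (W x))) :
    SmoothSec F V (fun x => ∑ k, B x (frame x k) (frame x k)) := by
  refine smoothSec_of_local fun x => ?_
  obtain ⟨W, hW⟩ := exists_isNormalFrame D x
  obtain ⟨h, hh, -, -, he⟩ := hW.exists_gram_inv hD
  refine ⟨fun y => ∑ k, ∑ l, h k l y • B y (W k y) (W l y),
    SmoothSec.sum _ fun k _ => SmoothSec.sum _ fun l _ => SmoothSec.smul (hh k l)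
      (hB _ _ (hW.smooth k) (hW.smooth l)), ?_⟩
  filter_upwards [he] with y hy
  exact sum_orthonormal_eq_sum_gram (frame y) (fun k => W k y) (fun k l => h k l y) hy (B y)

/-- Near `x` the contraction is a double sum with the inverse Gram coefficients; these are the
Kronecker delta at `x` with zero differential, so only the diagonal terms survive and no derivative
falls on the coefficients. -/
theorem IsNormalFrame.cov_contraction (hD : IsKahlerConnection D)
    (hB : ∀ U W : Π x : X, TangentSpace 𝓘(ℝ, V) x, SmoothSec V V U → SmoothSec V V W →
      SmoothSec F V (fun x => B x (U x) (W x)))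
    (D' : CovariantDerivative 𝓘(ℝ, V) F Z) {x : X}
    {W : Fin (Module.finrank ℝ (TangentSpace 𝓘(ℝ, V) x)) → Π y : X, TangentSpace 𝓘(ℝ, V) y}
    (hW : IsNormalFrame D x W) (v : TangentSpace 𝓘(ℝ, V) x) :
    D' (fun y => ∑ k, B y (frame y k) (frame y k)) x v =
      ∑ k, D' (fun y => B y (W k y) (W k y)) x v := by
  obtain ⟨h, hh, hx, hd, he⟩ := hW.exists_gram_inv hD
  have hs : ∀ k l, SmoothSec F V (fun y => h k l y • B y (W k y) (W l y)) := fun k l =>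
    SmoothSec.smul (hh k l) (hB _ _ (hW.smooth k) (hW.smooth l))
  have h1 : ∀ᶠ y in 𝓝 x, ∑ k, B y (frame y k) (frame y k) =
      ∑ k, ∑ l, h k l y • B y (W k y) (W l y) := by
    filter_upwards [he] with y hy
    exact sum_orthonormal_eq_sum_gram (frame y) (fun k => W k y) (fun k l => h k l y) hy (B y)
  rw [cov_congr D' (SmoothSec.sum _ fun k _ => SmoothSec.sum _ fun l _ => hs k l) h1,
    cov_sum D' _ fun k _ => SmoothSec.sum _ fun l _ => hs k l]
  refine Finset.sum_congr rfl fun k _ => ?_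
  rw [cov_sum D' _ fun l _ => hs k l]
  simp_rw [cov_smul D' (hh k _) (hB _ _ (hW.smooth k) (hW.smooth _)), hx, hd]
  simp

end Contraction

/-! ### Coordinate vector fields. -/

section CoordField

variable {V : Type*} [NormedAddCommGroup V] [NormedSpace ℂ V] [FiniteDimensional ℂ V]
  {X : Type*} [TopologicalSpace X] [ChartedSpace V X] [IsManifold 𝓘(ℂ, V) ω X]

/-- The constant vector field on the model space. -/
def constField (v : V) : Π y : V, TangentSpace 𝓘(ℝ, V) y := fun _ => v

/-- The vector field with constant coordinates `v` in the chart at `i`. -/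
noncomputable def coordField (i : X) (v : V) : Π p : X, TangentSpace 𝓘(ℝ, V) p :=
  VectorField.mpullback 𝓘(ℝ, V) 𝓘(ℝ, V) (chartAt V i)
    (constField v)

theorem contMDiff_constField (v : V) : ContMDiff 𝓘(ℝ, V) (𝓘(ℝ, V).prod 𝓘(ℝ, V)) ∞
    (fun y => (TotalSpace.mk' V y (constField v y) :
      TotalSpace V (TangentSpace 𝓘(ℝ, V) : V → Type _))) := by
  intro y
  rw [contMDiffAt_section]
  refine (contMDiffAt_const (c := v)).congr_of_eventuallyEq ?_
  filter_upwards [] with z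
  rw [TangentBundle.trivializationAt_apply]
  simp only [constField, chartAt_self_eq]
  simp

theorem isInvertible_mfderiv_chartAt {i p : X} (hp : p ∈ (chartAt V i).source) :
    (mfderiv 𝓘(ℝ, V) 𝓘(ℝ, V) (chartAt V i) p).IsInvertible :=
  ⟨(mdifferentiable_chart (I := 𝓘(ℝ, V)) i).mfderiv hp, by ext; rfl⟩

theorem mfderiv_chartAt_coordField {i p : X} (hp : p ∈ (chartAt V i).source) (v : V) :
    mfderiv 𝓘(ℝ, V) 𝓘(ℝ, V) (chartAt V i) p (coordField i v p) = v :=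
  congrArg (fun f => f v) (isInvertible_mfderiv_chartAt hp).self_comp_inverse

theorem coordField_mfderiv_chartAt {i p : X} (hp : p ∈ (chartAt V i).source)
    (w : TangentSpace 𝓘(ℝ, V) p) :
    coordField (V := V) i (mfderiv 𝓘(ℝ, V) 𝓘(ℝ, V) (chartAt V i) p w) p = w :=
  congrArg (fun f => f w) (isInvertible_mfderiv_chartAt hp).inverse_comp_self

theorem coordField_eq_mfderiv_symm {i p : X} (hp : p ∈ (chartAt V i).source) (v : V) :
    coordField i v p =
      (mfderiv 𝓘(ℝ, V) 𝓘(ℝ, V) (chartAt V i).symm (chartAt V i p) v : V) := by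
  have h := congrArg (fun f => f (coordField i v p))
    ((mdifferentiable_chart (I := 𝓘(ℝ, V)) i).symm_comp_deriv hp)
  simp only [ContinuousLinearMap.comp_apply, mfderiv_chartAt_coordField hp] at h
  exact h.symm

theorem contMDiffAt_coordField {i p : X} (hp : p ∈ (chartAt V i).source) (v : V) :
    ContMDiffAt 𝓘(ℝ, V) (𝓘(ℝ, V).prod 𝓘(ℝ, V)) ∞
      (fun x => (TotalSpace.mk' V x (coordField i v x) : TotalSpace V (TangentSpace 𝓘(ℝ, V)))) p := by
  have hc : ContMDiffAt 𝓘(ℝ, V) 𝓘(ℝ, V) ∞ (chartAt V i) p :=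
    (contMDiffOn_chart (x := i)).contMDiffAt ((chartAt V i).open_source.mem_nhds hp)
  exact ContMDiffAt.mpullback_vectorField_preimage (contMDiff_constField v _) hc (isInvertible_mfderiv_chartAt hp)
    (by simp)

/-- Pullback by the chart commutes with the bracket, and constant fields on the model space commute.
-/
theorem mlieBracket_coordField {i p : X} (hp : p ∈ (chartAt V i).source) (v w : V) :
    VectorField.mlieBracket 𝓘(ℝ, V) (coordField i v) (coordField i w) p = 0 := by
  have hc : ContMDiffAt 𝓘(ℝ, V) 𝓘(ℝ, V) ∞ (chartAt V i) p :=
    (contMDiffOn_chart (x := i)).contMDiffAt ((chartAt V i).open_source.mem_nhds hp)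
  have h := VectorField.mpullback_mlieBracket (I := 𝓘(ℝ, V)) (I' := 𝓘(ℝ, V))
    (f := chartAt V i) (x₀ := p) (n := ∞)
    (V := (constField v))
    (W := (constField w))
    ((contMDiff_constField v _).mdifferentiableAt (by simp)) ((contMDiff_constField w _).mdifferentiableAt (by simp)) hc (by simp; exact WithTop.coe_le_coe.2 le_top)
  have h0 : VectorField.mlieBracket 𝓘(ℝ, V) (constField v)
      (constField w) (chartAt V i p) = 0 := by
    rw [← VectorField.mlieBracketWithin_univ, VectorField.mlieBracketWithin_eq_lieBracketWithin]
    exact (by simp [VectorField.lieBracketWithin] :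
      VectorField.lieBracketWithin ℝ (fun _ : V => v) (fun _ => w) univ (chartAt V i p) = 0)
  rw [coordField, coordField, ← h, VectorField.mpullback_apply, h0, map_zero]

theorem coordField_change {i j p : X} (hi : p ∈ (chartAt V i).source)
    (hj : p ∈ (chartAt V j).source) (v : V) :
    coordField i v p =
      coordField j (fderiv ℝ (chartAt V j ∘ (chartAt V i).symm) (chartAt V i p) v) p := by
  refine (coordField_mfderiv_chartAt hj (coordField i v p)).symm.trans
    (congrArg (fun u : V => coordField j u p) ?_)
  have h1 : MDifferentiableAt 𝓘(ℝ, V) 𝓘(ℝ, V) (chartAt V i).symm (chartAt V i p) :=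
    (mdifferentiable_chart (I := 𝓘(ℝ, V)) i).mdifferentiableAt_symm ((chartAt V i).map_source hi)
  have h2 : MDifferentiableAt 𝓘(ℝ, V) 𝓘(ℝ, V) (chartAt V j)
      ((chartAt V i).symm (chartAt V i p)) := by
    rw [(chartAt V i).left_inv hi]
    exact (mdifferentiable_chart (I := 𝓘(ℝ, V)) j).mdifferentiableAt hj
  rw [← mfderiv_eq_fderiv, mfderiv_comp _ h2 h1, coordField_eq_mfderiv_symm hi]
  -- The chain rule puts the chart derivative at the point obtained by going to coordinates and
  -- back, which equals `p` only propositionally; the tangent spaces are identified by substituting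
  -- the equality.
  have key : ∀ q : X, q = p → ∀ u : V,
      (mfderiv 𝓘(ℝ, V) 𝓘(ℝ, V) (chartAt V j) p u : V) =
        mfderiv 𝓘(ℝ, V) 𝓘(ℝ, V) (chartAt V j) q u := by
    rintro _ rfl u; rfl
  exact key _ ((chartAt V i).left_inv hi) _

end CoordField

/-! ### The Riemannian density in a chart. -/

section Density

theorem det_gram_pos {ι T : Type*} [Fintype ι] [DecidableEq ι] [NormedAddCommGroup T]
    [InnerProductSpace ℝ T] {w : ι → T} (hw : LinearIndependent ℝ w) :
    0 < (Matrix.of fun k l => (inner ℝ (w k) (w l) : ℝ)).det :=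
  (Matrix.posDef_gram_of_linearIndependent hw).det_pos

theorem det_gram_linear_combination {ι T : Type*} [Fintype ι] [DecidableEq ι]
    [NormedAddCommGroup T] [InnerProductSpace ℝ T] {w w' : ι → T} (M : Matrix ι ι ℝ)
    (h : ∀ k, w k = ∑ r, M r k • w' r) :
    (Matrix.of fun k l => (inner ℝ (w k) (w l) : ℝ)).det =
      M.det ^ 2 * (Matrix.of fun k l => (inner ℝ (w' k) (w' l) : ℝ)).det := by
  have hM : (Matrix.of fun k l => (inner ℝ (w k) (w l) : ℝ)) =
      M.transpose * (Matrix.of fun k l => (inner ℝ (w' k) (w' l) : ℝ)) * M := by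
    ext k l
    simp only [h, Matrix.of_apply, Matrix.mul_apply, Matrix.transpose_apply, sum_inner,
      inner_sum, real_inner_smul_left, real_inner_smul_right, Finset.sum_mul]
    exact Finset.sum_congr rfl fun _ _ => Finset.sum_congr rfl fun _ _ => by ring
  rw [hM, Matrix.det_mul, Matrix.det_mul, Matrix.det_transpose]
  ring

variable {V : Type*} [NormedAddCommGroup V] [NormedSpace ℂ V] [FiniteDimensional ℂ V]
  {X : Type*} [TopologicalSpace X] [T2Space X] [ChartedSpace V X] [IsManifold 𝓘(ℂ, V) ω X]
  [RiemannianBundle (fun x : X => TangentSpace 𝓘(ℝ, V) x)]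
  [IsContMDiffRiemannianBundle 𝓘(ℝ, V) ∞ V (fun x : X => TangentSpace 𝓘(ℝ, V) x)]
  {m : ℕ} (b : Module.Basis (Fin m) ℝ V)

/-- The Gram matrix of the coordinate vector fields. -/
noncomputable def coordGram (i p : X) : Matrix (Fin m) (Fin m) ℝ :=
  Matrix.of fun k l => inner ℝ (coordField i (b k) p) (coordField i (b l) p)

/-- The Riemannian volume density as a function on the chart domain. -/
noncomputable def coordDensity (i p : X) : ℝ := √(coordGram b i p).det

theorem volumeDensity_eq {i : X} {y : V} (hy : y ∈ (chartAt V i).target) :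
    volumeDensity b i y = coordDensity b i ((chartAt V i).symm y) := by
  rw [volumeDensity, coordDensity, coordGram]
  congr 4
  ext k l
  rw [coordField_eq_mfderiv_symm ((chartAt V i).map_target hy),
    coordField_eq_mfderiv_symm ((chartAt V i).map_target hy), (chartAt V i).right_inv hy]

theorem linearIndependent_coordField {i p : X} (hp : p ∈ (chartAt V i).source) :
    LinearIndependent ℝ (fun k => coordField i (b k) p) := by
  have : (fun k => coordField i (b k) p) =
      ((mdifferentiable_chart (I := 𝓘(ℝ, V)) i).mfderiv hp).symm.toLinearEquiv.toLinearMap ∘ b := by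
    ext k
    exact ((mdifferentiable_chart (I := 𝓘(ℝ, V)) i).mfderiv hp).injective
      ((mfderiv_chartAt_coordField hp (b k)).trans
        (((mdifferentiable_chart (I := 𝓘(ℝ, V)) i).mfderiv hp).apply_symm_apply (b k)).symm)
  rw [this]
  exact b.linearIndependent.map' _ (LinearEquiv.ker _)

theorem det_coordGram_pos {i p : X} (hp : p ∈ (chartAt V i).source) :
    0 < (coordGram b i p).det :=
  det_gram_pos (linearIndependent_coordField b hp)

theorem coordDensity_pos {i p : X} (hp : p ∈ (chartAt V i).source) : 0 < coordDensity b i p :=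
  Real.sqrt_pos.2 (det_coordGram_pos b hp)

theorem exists_smoothSec_coordField {i p : X} (hp : p ∈ (chartAt V i).source) :
    ∃ S : Fin m → Π q : X, TangentSpace 𝓘(ℝ, V) q, (∀ k, SmoothSec V V (S k)) ∧
      ∀ᶠ q in 𝓝 p, ∀ k, S k q = coordField i (b k) q := by
  have hn := (chartAt V i).open_source.mem_nhds hp
  choose S h1 h2 using fun k => exists_smoothSec_eventuallyEq hn
    (fun q hq => (contMDiffAt_coordField hq (b k)).contMDiffWithinAt)
  exact ⟨S, h1, Filter.eventually_all.2 h2⟩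

theorem contMDiffAt_coordDensity {i p : X} (hp : p ∈ (chartAt V i).source) :
    ContMDiffAt 𝓘(ℝ, V) 𝓘(ℝ, ℝ) ∞ (fun x => coordDensity b i x) p := by
  obtain ⟨S, hS, he⟩ := exists_smoothSec_coordField b hp
  have h1 : SmoothFun V (fun q => (Matrix.of fun k l => inner ℝ (S k q) (S l q)).det) :=
    SmoothFun.det fun k l => SmoothSec.inner (hS k) (hS l)
  have h2 : (Matrix.of fun k l => (inner ℝ (S k p) (S l p) : ℝ)).det ≠ 0 := by
    simp_rw [he.self_of_nhds]
    exact (det_coordGram_pos b hp).ne'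
  have h3 := ContDiffAt.comp_contMDiffAt (g := fun t : ℝ => √t)
    (f := fun q => (Matrix.of fun k l => (inner ℝ (S k q) (S l q) : ℝ)).det) (Real.contDiffAt_sqrt h2) (h1 p)
  refine h3.congr_of_eventuallyEq ?_
  filter_upwards [he] with q hq
  simp only [coordDensity, coordGram, ← hq, Function.comp]

/-- The two coordinate frames are related by the matrix of the transition derivative, so the Gram
determinants differ by the square of its determinant. The resulting factor cancels the Jacobian in
the change of variables. -/
theorem coordDensity_change {i j p : X} (hi : p ∈ (chartAt V i).source)
    (hj : p ∈ (chartAt V j).source) :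
    coordDensity b i p =
      |(fderiv ℝ (chartAt V j ∘ (chartAt V i).symm) (chartAt V i p)).det| * coordDensity b j p := by
  set T := fderiv ℝ (chartAt V j ∘ (chartAt V i).symm) (chartAt V i p)
  let M := LinearMap.toMatrix b b (T : V →ₗ[ℝ] V)
  have h1 : ∀ k, coordField i (b k) p = ∑ r, M r k • coordField j (b r) p := by
    intro k
    have h2 : T (b k) = ∑ r, M r k • b r := by
      simp only [M, LinearMap.toMatrix_apply]
      exact (b.sum_repr _).symm
    refine ((mdifferentiable_chart (I := 𝓘(ℝ, V)) j).mfderiv hj).injective ?_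
    simp only [map_sum, map_smul]
    refine Eq.trans ?_ (h2.trans (Finset.sum_congr rfl fun r _ => congrArg (M r k • ·)
      (mfderiv_chartAt_coordField hj (b r)).symm))
    rw [coordField_change hi hj]
    exact mfderiv_chartAt_coordField hj _
  have h3 : M.det = T.det := LinearMap.det_toMatrix b _
  rw [coordDensity, coordGram, det_gram_linear_combination M h1, h3,
    Real.sqrt_mul (sq_nonneg _), Real.sqrt_sq_eq_abs]
  rfl

end Density

/-! ### The derivative of a determinant. -/

section Jacobi

variable {V : Type*} [NormedAddCommGroup V] [NormedSpace ℝ V]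
  {X : Type*} [TopologicalSpace X] [ChartedSpace V X]

theorem SmoothFun.prod {ι : Type*} (s : Finset ι) {f : ι → X → ℝ}
    (hf : ∀ i ∈ s, SmoothFun V (f i)) : SmoothFun V (fun x => ∏ i ∈ s, f i x) :=
  contMDiff_finsetProd hf

theorem mvfderiv_prod_apply {ι : Type*} [DecidableEq ι] (s : Finset ι) {f : ι → X → ℝ}
    (hf : ∀ i ∈ s, SmoothFun V (f i)) (x : X) (v : TangentSpace 𝓘(ℝ, V) x) :
    mvfderiv 𝓘(ℝ, V) (fun y => ∏ i ∈ s, f i y) x v =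
      ∑ j ∈ s, (∏ i ∈ s.erase j, f i x) * mvfderiv 𝓘(ℝ, V) (f j) x v := by
  induction s using Finset.induction_on with
  | empty => simpa using mvfderiv_const_apply 1 x v
  | insert a s ha ih =>
    have hs : ∀ i ∈ s, SmoothFun V (f i) := fun i hi => hf i (by simp [hi])
    simp only [Finset.prod_insert ha, Finset.sum_insert ha]
    rw [mvfderiv_mul_apply (hf a (by simp)) (SmoothFun.prod s hs), ih hs,
      Finset.erase_insert ha, Finset.mul_sum, add_comm]
    congr 1
    · ring
    · refine Finset.sum_congr rfl fun j hj => ?_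
      have hja : a ≠ j := fun h => ha (h ▸ hj)
      rw [Finset.erase_insert_of_ne hja, Finset.prod_insert (by simp [ha])]
      ring

/-- Jacobi's formula for the derivative of a determinant. -/
theorem mvfderiv_det {ι : Type*} [Fintype ι] [DecidableEq ι] {M : X → Matrix ι ι ℝ}
    (hM : ∀ i j, SmoothFun V (fun x => M x i j)) (x : X) (v : TangentSpace 𝓘(ℝ, V) x) :
    mvfderiv 𝓘(ℝ, V) (fun y => (M y).det) x v = ((M x).adjugate *
      Matrix.of fun i j => mvfderiv 𝓘(ℝ, V) (fun y => M y i j) x v).trace := by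
  have h1 : ∀ σ : Equiv.Perm ι, SmoothFun V (fun y => ∏ i, M y (σ i) i) := fun σ =>
    SmoothFun.prod _ fun i _ => hM _ _
  have h2 : (fun y => (M y).det) = fun y => ∑ σ : Equiv.Perm ι,
      ((Equiv.Perm.sign σ : ℤ) : ℝ) * ∏ i, M y (σ i) i := by
    ext y
    exact Matrix.det_apply' _
  rw [h2, mvfderiv_sum_apply _ fun σ _ => SmoothFun.mul contMDiff_const (h1 σ)]
  simp_rw [mvfderiv_const_mul_apply _ (h1 _), mvfderiv_prod_apply _ fun i _ => hM _ i]
  simp only [Matrix.trace, Matrix.diag, Finset.mul_sum]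
  rw [Finset.sum_comm]
  refine Finset.sum_congr rfl fun j _ => ?_
  -- Each diagonal entry is, by Cramer's rule, the determinant with one column replaced by its
  -- derivative; this matches the terms of the Leibniz expansion in which that column is
  -- differentiated.
  have h3 : ((M x).adjugate * Matrix.of fun i j => mvfderiv 𝓘(ℝ, V) (fun y => M y i j) x v) j j =
      Matrix.cramer (M x) (fun i => mvfderiv 𝓘(ℝ, V) (fun y => M y i j) x v) j := by
    rw [Matrix.cramer_eq_adjugate_mulVec]
    rfl
  rw [h3, Matrix.cramer_apply, Matrix.det_apply']
  refine Finset.sum_congr rfl fun σ _ => ?_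
  rw [← Finset.mul_prod_erase _ _ (Finset.mem_univ j)]
  congr 1
  rw [Matrix.updateCol_self, mul_comm]
  congr 1
  refine Finset.prod_congr rfl fun i hi => ?_
  rw [Matrix.updateCol_ne (Finset.ne_of_mem_erase hi)]

end Jacobi

/-! ### The coordinate formula for the divergence. -/

section Divergence

variable {V : Type*} [NormedAddCommGroup V] [NormedSpace ℂ V] [FiniteDimensional ℂ V]
  {X : Type*} [TopologicalSpace X] [T2Space X] [ChartedSpace V X] [IsManifold 𝓘(ℂ, V) ω X]
  [RiemannianBundle (fun x : X => TangentSpace 𝓘(ℝ, V) x)]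
  [IsContMDiffRiemannianBundle 𝓘(ℝ, V) ∞ V (fun x : X => TangentSpace 𝓘(ℝ, V) x)]
  {D : CovariantDerivative 𝓘(ℝ, V) V (fun x : X => TangentSpace 𝓘(ℝ, V) x)}

/-- The divergence of a vector field. -/
noncomputable def divergence
    (D : CovariantDerivative 𝓘(ℝ, V) V (fun x : X => TangentSpace 𝓘(ℝ, V) x))
    (Y : Π x : X, TangentSpace 𝓘(ℝ, V) x) (x : X) : ℝ :=
  LinearMap.trace ℝ (TangentSpace 𝓘(ℝ, V) x) (D Y x).toLinearMap

/-- With Γ the connection matrix of the frame, metric compatibility gives dG = ΓG + GΓᵀ. Jacobi's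
formula then yields 2 n dn = 2 tr(Γ) n², and n is divided out. -/
theorem mvfderiv_sqrt_det_gram (hD : IsKahlerConnection D) {m : ℕ}
    {S : Fin m → Π q : X, TangentSpace 𝓘(ℝ, V) q} (hS : ∀ k, SmoothSec V V (S k)) {p : X}
    (e : Module.Basis (Fin m) ℝ (TangentSpace 𝓘(ℝ, V) p)) (he : ∀ k, e k = S k p)
    {n : X → ℝ} (hn : SmoothFun V n) (hn0 : n p ≠ 0)
    (hnS : ∀ᶠ q in 𝓝 p, n q ^ 2 = (Matrix.of fun k l => (inner ℝ (S k q) (S l q) : ℝ)).det)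
    (v : TangentSpace 𝓘(ℝ, V) p) :
    mvfderiv 𝓘(ℝ, V) n p v = (∑ k, e.coord k (D (S k) p v)) * n p := by
  let G : X → Matrix (Fin m) (Fin m) ℝ := fun q => Matrix.of fun k l => inner ℝ (S k q) (S l q)
  let Γ : Matrix (Fin m) (Fin m) ℝ := Matrix.of fun k j => e.coord j (D (S k) p v)
  have hDS : ∀ k, D (S k) p v = ∑ j, Γ k j • S j p := fun k => by
    simp_rw [← he]
    exact (e.sum_repr _).symm
  have hGs : ∀ k l, SmoothFun V (fun q => G q k l) := fun k l => SmoothSec.inner (hS k) (hS l)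
  have hdG : (Matrix.of fun i j => mvfderiv 𝓘(ℝ, V) (fun y => G y i j) p v) =
      Γ * G p + G p * Γ.transpose := by
    ext k l
    have := hD.inner _ _ (hS k) (hS l) p v
    rw [hDS, hDS] at this
    simp only [sum_inner, inner_sum, real_inner_smul_left, real_inner_smul_right] at this
    simp only [Matrix.of_apply, Matrix.add_apply, Matrix.mul_apply, Matrix.transpose_apply, G]
    rw [this]
    congr 1
    exact Finset.sum_congr rfl fun _ _ => mul_comm _ _
  have h1 := mvfderiv_det hGs p v
  have h2 := congrArg (fun f => f v) (mvfderiv_congr (V := V) hnS)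
  simp only [pow_two] at h2
  rw [mvfderiv_mul_apply hn hn] at h2
  have h3 : ((G p).adjugate * (Γ * G p + G p * Γ.transpose)).trace = 2 * Γ.trace * (G p).det := by
    rw [mul_add, Matrix.trace_add, ← mul_assoc, ← mul_assoc, Matrix.trace_mul_comm,
      ← mul_assoc, Matrix.mul_adjugate, Matrix.adjugate_mul]
    simp
    ring
  have h4 : (G p).det = n p ^ 2 := hnS.self_of_nhds.symm
  rw [hdG, h3, h4] at h1
  have h5 := h2.trans h1
  have h6 : Γ.trace = ∑ k, e.coord k (D (S k) p v) := rfl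
  rw [← h6]
  have : 2 * n p * (mvfderiv 𝓘(ℝ, V) n p v - Γ.trace * n p) = 0 := by linear_combination h5
  have := (mul_eq_zero.1 this).resolve_left (by simpa using hn0)
  linarith

/-- The derivative of the density along S_k is the trace of S_j ↦ D_{S_k} S_j, while the divergence
contains the trace of S_j ↦ D_{S_j} S_k. They agree because the frame fields commute at `p` and the
connection has no torsion. -/
theorem sum_mvfderiv_coord_mul_density (hD : IsKahlerConnection D) {m : ℕ}
    {S : Fin m → Π q : X, TangentSpace 𝓘(ℝ, V) q} (hS : ∀ k, SmoothSec V V (S k)) {p : X}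
    (e : Module.Basis (Fin m) ℝ (TangentSpace 𝓘(ℝ, V) p)) (he : ∀ k, e k = S k p)
    (hbr : ∀ k l, VectorField.mlieBracket 𝓘(ℝ, V) (S k) (S l) p = 0)
    {n : X → ℝ} (hn : SmoothFun V n) (hn0 : n p ≠ 0)
    (hnS : ∀ᶠ q in 𝓝 p, n q ^ 2 = (Matrix.of fun k l => (inner ℝ (S k q) (S l q) : ℝ)).det)
    {c : Fin m → X → ℝ} (hc : ∀ k, SmoothFun V (c k)) {Y : Π q : X, TangentSpace 𝓘(ℝ, V) q}
    (hY : ∀ᶠ q in 𝓝 p, Y q = ∑ k, c k q • S k q) :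
    ∑ k, mvfderiv 𝓘(ℝ, V) (fun q => c k q * n q) p (S k p) = divergence D Y p * n p := by
  have hsym : ∀ k l, D (S k) p (S l p) = D (S l) p (S k p) := fun k l => by
    have := hD.torsion _ _ (hS k) (hS l) p
    rw [hbr] at this
    exact (sub_eq_zero.1 this.symm).symm
  have h1 : ∀ v, D Y p v = ∑ k, (c k p • D (S k) p v + mvfderiv 𝓘(ℝ, V) (c k) p v • S k p) := by
    intro v
    have hs : ∀ k, SmoothSec V V (fun q => c k q • S k q) := fun k => SmoothSec.smul (hc k) (hS k)
    rw [cov_congr D (SmoothSec.sum _ fun k _ => hs k) hY, cov_sum D _ fun k _ => hs k]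
    exact Finset.sum_congr rfl fun k _ => cov_smul D (hc k) (hS k) p v
  have h2 : divergence D Y p = ∑ j, e.coord j (D Y p (S j p)) := by
    rw [divergence, LinearMap.trace_eq_matrix_trace ℝ e]
    simp only [Matrix.trace, Matrix.diag, LinearMap.toMatrix_apply, he]
    rfl
  have hcoord : ∀ j k, e.coord j (S k p) = if k = j then 1 else 0 := fun j k => by
    rw [← he, Module.Basis.coord_apply, Module.Basis.repr_self, Finsupp.single_apply]
  rw [h2]
  simp_rw [h1, map_sum, map_add, map_smul, hcoord, mvfderiv_mul_apply (hc _) hn,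
    mvfderiv_sqrt_det_gram hD hS e he hn hn0 hnS, smul_eq_mul, Finset.sum_add_distrib, add_mul]
  simp only [mul_ite, mul_one, mul_zero, Finset.sum_ite_eq', Finset.mem_univ, if_true]
  congr 1
  · rw [Finset.sum_comm, Finset.sum_mul]
    refine Finset.sum_congr rfl fun k _ => ?_
    simp_rw [hsym k, ← Finset.mul_sum]
    ring
  · rw [Finset.sum_mul]

end Divergence

/-! ### Chart derivatives and functions read in a chart. -/

section

variable {V : Type*} [NormedAddCommGroup V] [NormedSpace ℂ V] [FiniteDimensional ℂ V]
  {X : Type*} [TopologicalSpace X] [ChartedSpace V X] [IsManifold 𝓘(ℂ, V) ω X]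

theorem mfderiv_chartAt_apply {i x : X} (hx : x ∈ (chartAt V i).source)
    (w : TangentSpace 𝓘(ℝ, V) x) :
    mfderiv 𝓘(ℝ, V) 𝓘(ℝ, V) (chartAt V i) x w =
      (trivializationAt V (TangentSpace 𝓘(ℝ, V) : X → Type _) i ⟨x, w⟩).2 := by
  have h := congrArg (fun f => f w)
    (TangentBundle.continuousLinearMapAt_trivializationAt (I := 𝓘(ℝ, V)) hx)
  rw [Trivialization.continuousLinearMapAt_apply, Trivialization.coe_linearMapAt_of_mem _
    (by simpa using hx)] at h
  exact h.symm

end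

section ChartExtension

variable {V : Type*} [NormedAddCommGroup V] [NormedSpace ℂ V] [FiniteDimensional ℂ V]
  {X : Type*} [TopologicalSpace X] [T2Space X] [CompactSpace X] [ChartedSpace V X]

/-- The coordinate expression of a function in the chart at `i`, extended by zero. -/
noncomputable def chartExt (i : X) (g : X → ℝ) : V → ℝ :=
  (chartAt V i).target.indicator (fun y => g ((chartAt V i).symm y))

theorem chartExt_of_mem {i : X} {g : X → ℝ} {y : V} (hy : y ∈ (chartAt V i).target) :
    chartExt i g y = g ((chartAt V i).symm y) :=
  indicator_of_mem hy _

theorem chartExt_of_notMem {i : X} {g : X → ℝ} {y : V} (hy : y ∉ (chartAt V i).target) :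
    chartExt i g y = 0 :=
  indicator_of_notMem hy _

theorem chartExt_eventuallyEq {i : X} {g : X → ℝ} {y : V} (hy : y ∈ (chartAt V i).target) :
    chartExt i g =ᶠ[𝓝 y] fun z => g ((chartAt V i).symm z) := by
  filter_upwards [(chartAt V i).open_target.mem_nhds hy] with z hz
  exact chartExt_of_mem hz

/-- Since `X` is compact, a closed set inside a chart domain has compact image, which is closed in
the whole model space and not only in the chart target. A function supported there therefore
vanishes near every point outside the target, so its extension by zero stays regular. -/
theorem isCompact_chart_image {i : X} {K : Set X} (hK : IsClosed K)
    (hKi : K ⊆ (chartAt V i).source) : IsCompact (chartAt V i '' K) :=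
  hK.isCompact.image_of_continuousOn ((chartAt V i).continuousOn.mono hKi)

theorem chartExt_eq_zero_of_notMem_image {i : X} {g : X → ℝ} {K : Set X}
    (hg : ∀ x ∉ K, g x = 0) {y : V} (hy : y ∉ chartAt V i '' K) : chartExt i g y = 0 := by
  by_cases h : y ∈ (chartAt V i).target
  · rw [chartExt_of_mem h]
    exact hg _ fun hK => hy ⟨_, hK, (chartAt V i).right_inv h⟩
  · exact chartExt_of_notMem h

theorem hasCompactSupport_chartExt {i : X} {g : X → ℝ} {K : Set X} (hK : IsClosed K)
    (hKi : K ⊆ (chartAt V i).source) (hg : ∀ x ∉ K, g x = 0) :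
    HasCompactSupport (chartExt (V := V) i g) :=
  HasCompactSupport.intro (isCompact_chart_image hK hKi)
    fun _ hy => chartExt_eq_zero_of_notMem_image hg hy

theorem continuous_chartExt {i : X} {g : X → ℝ} {K : Set X} (hK : IsClosed K)
    (hKi : K ⊆ (chartAt V i).source) (hg : ∀ x ∉ K, g x = 0)
    (hc : ContinuousOn g (chartAt V i).source) : Continuous (chartExt (V := V) i g) := by
  rw [continuous_iff_continuousAt]
  intro y
  by_cases h : y ∈ (chartAt V i).target
  · refine ContinuousAt.congr ?_ (chartExt_eventuallyEq h).symm
    have h1 := (chartAt V i).map_target h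
    exact ContinuousAt.comp (g := g) (hc.continuousAt ((chartAt V i).open_source.mem_nhds h1))
      ((chartAt V i).continuousAt_symm h)
  · have hy : y ∉ chartAt V i '' K := by
      rintro ⟨x, hx, rfl⟩
      exact h ((chartAt V i).map_source (hKi hx))
    refine (continuousAt_const (y := (0 : ℝ))).congr ?_
    filter_upwards [(isCompact_chart_image hK hKi).isClosed.isOpen_compl.mem_nhds hy] with z hz
    exact (chartExt_eq_zero_of_notMem_image hg hz).symm

variable [IsManifold 𝓘(ℂ, V) ω X]

theorem contDiff_chartExt {i : X} {g : X → ℝ} {K : Set X} (hK : IsClosed K)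
    (hKi : K ⊆ (chartAt V i).source) (hg : ∀ x ∉ K, g x = 0)
    (hc : ∀ x ∈ (chartAt V i).source, ContMDiffAt 𝓘(ℝ, V) 𝓘(ℝ, ℝ) ∞ g x) :
    ContDiff ℝ ∞ (chartExt (V := V) i g) := by
  rw [contDiff_iff_contDiffAt]
  intro y
  by_cases h : y ∈ (chartAt V i).target
  · refine ContDiffAt.congr_of_eventuallyEq ?_ (chartExt_eventuallyEq h)
    have h1 := (chartAt V i).map_target h
    have h2 : ContMDiffAt 𝓘(ℝ, V) 𝓘(ℝ, V) ∞ (chartAt V i).symm y :=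
      (contMDiffOn_chart_symm (x := i)).contMDiffAt ((chartAt V i).open_target.mem_nhds h)
    exact contMDiffAt_iff_contDiffAt.1 (ContMDiffAt.comp y (hc _ h1) h2)
  · have hy : y ∉ chartAt V i '' K := by
      rintro ⟨x, hx, rfl⟩
      exact h ((chartAt V i).map_source (hKi hx))
    refine (contDiffAt_const (c := (0 : ℝ))).congr_of_eventuallyEq ?_
    filter_upwards [(isCompact_chart_image hK hKi).isClosed.isOpen_compl.mem_nhds hy] with z hz
    exact chartExt_eq_zero_of_notMem_image hg hz

theorem fderiv_chartExt {i : X} {g : X → ℝ} {p : X} (hp : p ∈ (chartAt V i).source)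
    (hc : ContMDiffAt 𝓘(ℝ, V) 𝓘(ℝ, ℝ) ∞ g p) (v : V) :
    fderiv ℝ (chartExt i g) (chartAt V i p) v = mvfderiv 𝓘(ℝ, V) g p (coordField i v p) := by
  have h := (chartAt V i).map_source hp
  have h1 : MDifferentiableAt 𝓘(ℝ, V) 𝓘(ℝ, V) (chartAt V i).symm (chartAt V i p) :=
    (mdifferentiable_chart (I := 𝓘(ℝ, V)) i).mdifferentiableAt_symm h
  rw [(chartExt_eventuallyEq h).fderiv_eq, ← mfderiv_eq_fderiv]
  have h2 := mfderiv_comp_apply_of_eq (I := 𝓘(ℝ, V)) (I' := 𝓘(ℝ, V)) (I'' := 𝓘(ℝ, ℝ)) (g := g) _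
    (hc.mdifferentiableAt (by simp)) h1 ((chartAt V i).left_inv hp) v
  refine h2.trans ?_
  rw [coordField_eq_mfderiv_symm hp]
  rfl

end ChartExtension

/-! ### Integration in a single chart. -/

section Integration

variable {V : Type*} [NormedAddCommGroup V] [NormedSpace ℂ V] [FiniteDimensional ℂ V]
  [MeasurableSpace V] [BorelSpace V]
  {X : Type*} [TopologicalSpace X] [T2Space X] [CompactSpace X] [ChartedSpace V X]
  [IsManifold 𝓘(ℂ, V) ω X]
  [RiemannianBundle (fun x : X => TangentSpace 𝓘(ℝ, V) x)]
  [IsContMDiffRiemannianBundle 𝓘(ℝ, V) ∞ V (fun x : X => TangentSpace 𝓘(ℝ, V) x)]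
  {D : CovariantDerivative 𝓘(ℝ, V) V (fun x : X => TangentSpace 𝓘(ℝ, V) x)}

variable (V) in
/-- The integral over a chart domain against the Riemannian volume. -/
noncomputable def chartIntegral (i : X) (g : X → ℝ) : ℝ :=
  ∫ y, chartExt i (fun x => g x * coordDensity (Module.finBasis ℝ V) i x) y
    ∂(Module.finBasis ℝ V).addHaar

theorem contMDiffAt_mul_coordDensity {i : X} {g : X → ℝ} {p : X} (hp : p ∈ (chartAt V i).source)
    (hg : ContMDiffAt 𝓘(ℝ, V) 𝓘(ℝ, ℝ) ∞ g p) :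
    ContMDiffAt 𝓘(ℝ, V) 𝓘(ℝ, ℝ) ∞ (fun x => g x * coordDensity (Module.finBasis ℝ V) i x) p :=
  hg.mul (contMDiffAt_coordDensity _ hp)

theorem continuous_chartExt_mul {i : X} {g : X → ℝ} {K : Set X} (hK : IsClosed K)
    (hKi : K ⊆ (chartAt V i).source) (hg : ∀ x ∉ K, g x = 0) (hc : Continuous g) :
    Continuous (chartExt (V := V) i (fun x => g x * coordDensity (Module.finBasis ℝ V) i x)) := by
  refine continuous_chartExt hK hKi (fun x hx => by rw [hg x hx, zero_mul])
    (hc.continuousOn.mul fun x hx => ?_)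
  exact (contMDiffAt_coordDensity _ hx).continuousAt.continuousWithinAt

theorem hasCompactSupport_chartExt_mul {i : X} {g : X → ℝ} {K : Set X} (hK : IsClosed K)
    (hKi : K ⊆ (chartAt V i).source) (hg : ∀ x ∉ K, g x = 0) :
    HasCompactSupport
      (chartExt (V := V) i (fun x => g x * coordDensity (Module.finBasis ℝ V) i x)) :=
  hasCompactSupport_chartExt hK hKi fun x hx => by rw [hg x hx, zero_mul]

theorem integrable_chartExt_mul {i : X} {g : X → ℝ} {K : Set X} (hK : IsClosed K)
    (hKi : K ⊆ (chartAt V i).source) (hg : ∀ x ∉ K, g x = 0) (hc : Continuous g) :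
    Integrable (chartExt (V := V) i (fun x => g x * coordDensity (Module.finBasis ℝ V) i x))
      (Module.finBasis ℝ V).addHaar :=
  (continuous_chartExt_mul hK hKi hg hc).integrable_of_hasCompactSupport
    (hasCompactSupport_chartExt_mul hK hKi hg)

theorem chartIntegral_sum {ι : Type*} (s : Finset ι) {i : X} {g : ι → X → ℝ} {K : Set X}
    (hK : IsClosed K) (hKi : K ⊆ (chartAt V i).source) (hg : ∀ j ∈ s, ∀ x ∉ K, g j x = 0)
    (hc : ∀ j ∈ s, Continuous (g j)) :
    chartIntegral V i (fun x => ∑ j ∈ s, g j x) = ∑ j ∈ s, chartIntegral V i (g j) := by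
  simp only [chartIntegral]
  rw [← integral_finsetSum s fun j hj => integrable_chartExt_mul hK hKi (hg j hj) (hc j hj)]
  congr 1
  ext y
  by_cases h : y ∈ (chartAt V i).target
  · simp only [chartExt_of_mem h, Finset.sum_mul]
  · simp only [chartExt_of_notMem h, Finset.sum_const_zero]

theorem chartIntegral_add {i : X} {f g : X → ℝ} {K : Set X}
    (hK : IsClosed K) (hKi : K ⊆ (chartAt V i).source) (hf : ∀ x ∉ K, f x = 0)
    (hg : ∀ x ∉ K, g x = 0) (hfc : Continuous f) (hgc : Continuous g) :
    chartIntegral V i (fun x => f x + g x) = chartIntegral V i f + chartIntegral V i g := by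
  have h := chartIntegral_sum (V := V) Finset.univ (i := i) (g := ![f, g]) hK hKi
    (by intro j _; fin_cases j <;> simpa) (by intro j _; fin_cases j <;> simpa)
  simpa using h

theorem chartIntegral_const_mul {i : X} (c : ℝ) (f : X → ℝ) :
    chartIntegral V i (fun x => c * f x) = c * chartIntegral V i f := by
  simp only [chartIntegral]
  rw [← integral_const_mul]
  congr 1
  ext y
  by_cases h : y ∈ (chartAt V i).target
  · simp only [chartExt_of_mem h, mul_assoc]
  · simp only [chartExt_of_notMem h, mul_zero]

theorem chartIntegral_eq_setIntegral (i : X) (g : X → ℝ) :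
    chartIntegral V i g = ∫ y in (chartAt V i).target, g ((chartAt V i).symm y) *
      coordDensity (Module.finBasis ℝ V) i ((chartAt V i).symm y) ∂(Module.finBasis ℝ V).addHaar := by
  rw [chartIntegral, ← integral_indicator (chartAt V i).open_target.measurableSet]
  rfl

/-- The integral does not depend on the chart. -/
theorem chartIntegral_change {i j : X} {g : X → ℝ}
    (hg : ∀ x, x ∉ (chartAt V i).source ∩ (chartAt V j).source → g x = 0) :
    chartIntegral V i g = chartIntegral V j g := by
  -- Only the overlap contributes, so both sides become integrals over the source of a transition
  -- map.
  have key : ∀ i j : X, (∀ x, x ∉ (chartAt V i).source ∩ (chartAt V j).source → g x = 0) →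
      chartIntegral V i g = ∫ y in ((chartAt V i).symm ≫ₕ chartAt V j).source,
        g ((chartAt V i).symm y) * coordDensity (Module.finBasis ℝ V) i ((chartAt V i).symm y)
          ∂(Module.finBasis ℝ V).addHaar := by
    intro i j hg
    rw [chartIntegral_eq_setIntegral]
    refine setIntegral_eq_of_subset_of_forall_sdiff_eq_zero
      (chartAt V i).open_target.measurableSet (by simp) fun y hy => ?_
    rw [hg _ fun h => hy.2 (by simpa [hy.1] using h.2), zero_mul]
  rw [key i j hg, key j i fun x hx => hg x (by rwa [inter_comm])]
  set T := (chartAt V i).symm ≫ₕ chartAt V j with hT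
  have himg : ((chartAt V j).symm ≫ₕ chartAt V i).source = T '' T.source := by
    rw [T.image_source_eq_target]
    simp [hT]
  have hd : ∀ y ∈ T.source, HasFDerivWithinAt T (fderiv ℝ T y) T.source y := by
    intro y hy
    have hc := (contDiffGroupoid ∞ 𝓘(ℝ, V)).compatible (chart_mem_atlas V i) (chart_mem_atlas V j)
    rw [contDiffGroupoid, mem_groupoid_of_pregroupoid] at hc
    have hc1 := hc.1
    simp only [contDiffPregroupoid, modelWithCornersSelf_coe, modelWithCornersSelf_coe_symm,
      Function.comp_id, Function.id_comp, preimage_id_eq, id, range_id, inter_univ] at hc1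
    exact ((hc1.contDiffAt (T.open_source.mem_nhds hy)).differentiableAt
      (by simp)).hasFDerivAt.hasFDerivWithinAt
  -- The Jacobian determinant that appears here is exactly the ratio of the two densities.
  rw [himg, integral_image_eq_integral_abs_det_fderiv_smul _ T.open_source.measurableSet hd
    T.injOn]
  refine setIntegral_congr_fun T.open_source.measurableSet fun y hy => ?_
  have hy1 : y ∈ (chartAt V i).target := by
    have := hy; simp [hT] at this; exact this.1
  have hy2 : (chartAt V i).symm y ∈ (chartAt V j).source := by
    have := hy; simp [hT] at this; exact this.2
  have h1 : (chartAt V j).symm (T y) = (chartAt V i).symm y := (chartAt V j).left_inv hy2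
  simp only [smul_eq_mul, h1]
  rw [coordDensity_change _ ((chartAt V i).map_target hy1) hy2, (chartAt V i).right_inv hy1]
  have : fderiv ℝ T y = fderiv ℝ (chartAt V j ∘ (chartAt V i).symm) y := rfl
  rw [this]
  ring

theorem chartIntegral_nonneg {i : X} {g : X → ℝ} (hg : ∀ x, 0 ≤ g x) :
    0 ≤ chartIntegral V i g := by
  refine integral_nonneg fun y => ?_
  by_cases h : y ∈ (chartAt V i).target
  · rw [chartExt_of_mem h]
    exact mul_nonneg (hg _) (Real.sqrt_nonneg _)
  · rw [chartExt_of_notMem h]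
    rfl

/-- A nonnegative integrable function with zero integral vanishes almost everywhere, hence
everywhere by continuity, since Haar measure charges nonempty open sets. The density is positive and
can be divided out. -/
theorem eq_zero_of_chartIntegral_eq_zero {i : X} {g : X → ℝ} {K : Set X} (hK : IsClosed K)
    (hKi : K ⊆ (chartAt V i).source) (hg : ∀ x ∉ K, g x = 0) (hc : Continuous g)
    (h0 : ∀ x, 0 ≤ g x) (h : chartIntegral V i g = 0) (x : X) : g x = 0 := by
  by_cases hx : x ∈ (chartAt V i).source
  · have h1 : 0 ≤ chartExt (V := V) i
        (fun x => g x * coordDensity (Module.finBasis ℝ V) i x) := by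
      intro y
      by_cases h : y ∈ (chartAt V i).target
      · rw [chartExt_of_mem h]
        exact mul_nonneg (h0 _) (Real.sqrt_nonneg _)
      · rw [chartExt_of_notMem h]
        rfl
    have h2 := (integral_eq_zero_iff_of_nonneg h1 (integrable_chartExt_mul hK hKi hg hc)).1 h
    have h3 := (Continuous.ae_eq_iff_eq _ (continuous_chartExt_mul hK hKi hg hc)
      continuous_const).1 h2
    have h4 := congrFun h3 (chartAt V i x)
    rw [chartExt_of_mem ((chartAt V i).map_source hx), (chartAt V i).left_inv hx] at h4
    exact (mul_eq_zero.1 h4).resolve_right (coordDensity_pos _ hx).ne'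
  · exact hg x fun h => hx (hKi h)

/-- In coordinates, divergence times density is a sum of partial derivatives of compactly supported
smooth functions on the model space, and each of these has integral zero. -/
theorem chartIntegral_divergence (hD : IsKahlerConnection D) {i : X} {K : Set X}
    (hK : IsClosed K) (hKi : K ⊆ (chartAt V i).source) {Y : Π x : X, TangentSpace 𝓘(ℝ, V) x}
    (hY : SmoothSec V V Y) (hYK : ∀ x ∉ K, Y x = 0) :
    chartIntegral V i (divergence D Y) = 0 := by
  let b := Module.finBasis ℝ V
  let c : Fin (Module.finrank ℝ V) → X → ℝ := fun k x =>
    b.coord k (mfderiv 𝓘(ℝ, V) 𝓘(ℝ, V) (chartAt V i) x (Y x))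
  have hcs : ∀ k, ∀ x ∈ (chartAt V i).source, ContMDiffAt 𝓘(ℝ, V) 𝓘(ℝ, ℝ) ∞ (c k) x := by
    intro k x hx
    have h1 := ((trivializationAt V (TangentSpace 𝓘(ℝ, V) : X → Type _) i).contMDiffAt_section_iff
      (IB := 𝓘(ℝ, V)) (s := Y) (by simpa using hx)).1 (hY x)
    have h2 : ContMDiffAt 𝓘(ℝ, V) 𝓘(ℝ, ℝ) ∞ (fun x => (LinearMap.toContinuousLinearMap (b.coord k))
        (trivializationAt V (TangentSpace 𝓘(ℝ, V) : X → Type _) i ⟨x, Y x⟩).2) x :=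
      ContDiffAt.comp_contMDiffAt (ContinuousLinearMap.contDiff _).contDiffAt h1
    refine h2.congr_of_eventuallyEq ?_
    filter_upwards [(chartAt V i).open_source.mem_nhds hx] with y hy
    simp only [c]
    rw [mfderiv_chartAt_apply hy]
    rfl
  have hYc : ∀ x ∈ (chartAt V i).source, Y x = ∑ k, c k x • coordField i (b k) x := by
    intro x hx
    refine ((mdifferentiable_chart (I := 𝓘(ℝ, V)) i).mfderiv hx).injective ?_
    simp only [map_sum, map_smul]
    refine Eq.trans ?_ (Finset.sum_congr rfl fun r _ => congrArg (c r x • ·)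
      (mfderiv_chartAt_coordField hx (b r)).symm)
    exact (b.sum_repr _).symm
  let q : Fin (Module.finrank ℝ V) → X → ℝ := fun k x => c k x * coordDensity b i x
  have hqs : ∀ k, ∀ x ∈ (chartAt V i).source, ContMDiffAt 𝓘(ℝ, V) 𝓘(ℝ, ℝ) ∞ (q k) x :=
    fun k x hx => contMDiffAt_mul_coordDensity hx (hcs k x hx)
  have hqK : ∀ k, ∀ x ∉ K, q k x = 0 := fun k x hx => by
    simp only [q, c, hYK x hx, map_zero]
    exact (congrArg (· * _) (map_zero _)).trans (zero_mul _)
  have hqd : ∀ k, ContDiff ℝ ∞ (chartExt (V := V) i (q k)) := fun k =>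
    contDiff_chartExt hK hKi (hqK k) (hqs k)
  have hqc : ∀ k, HasCompactSupport (chartExt (V := V) i (q k)) := fun k =>
    hasCompactSupport_chartExt hK hKi (hqK k)
  have hpt : ∀ y, chartExt i (fun x => divergence D Y x * coordDensity b i x) y =
      ∑ k, fderiv ℝ (chartExt i (q k)) y (b k) := by
    intro y
    by_cases hy : y ∈ (chartAt V i).target
    · obtain ⟨p, hp, rfl⟩ : ∃ p ∈ (chartAt V i).source, chartAt V i p = y :=
        ⟨_, (chartAt V i).map_target hy, (chartAt V i).right_inv hy⟩
      rw [chartExt_of_mem hy, (chartAt V i).left_inv hp]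
      simp_rw [fderiv_chartExt hp (hqs _ p hp)]
      have hn := (chartAt V i).open_source.mem_nhds hp
      -- Coordinate fields, density and coefficients are smooth only on the chart domain; they are
      -- replaced by global smooth objects with the same germs at `p`.
      obtain ⟨S, hS, heS⟩ := exists_smoothSec_coordField b hp
      obtain ⟨n, hns, hen⟩ := exists_smoothFun_eventuallyEq hn fun x hx =>
        (contMDiffAt_coordDensity b hx).contMDiffWithinAt
      choose c' hc' hec using fun k => exists_smoothFun_eventuallyEq hn fun x hx =>
        (hcs k x hx).contMDiffWithinAt
      have hli := linearIndependent_coordField b hp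
      let e := Module.Basis.mk hli (hli.span_eq_top_of_card_eq_finrank' (by simp; rfl)).ge
      have h := sum_mvfderiv_coord_mul_density hD hS (p := p) e
        (fun k => by simp [e, heS.self_of_nhds]) (fun k l => ?_) hns
        (by rw [hen.self_of_nhds]; exact (coordDensity_pos b hp).ne') ?_ hc' (Y := Y) ?_
      · rw [hen.self_of_nhds] at h
        rw [← h]
        refine Finset.sum_congr rfl fun k _ => ?_
        rw [← heS.self_of_nhds]
        refine congrArg (fun f => f (S k p)) (mvfderiv_congr (V := V) ?_)
        filter_upwards [hec k, hen] with x h1 h2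
        rw [h1, h2]
      · have h1 : (fun x => S k x) =ᶠ[𝓝 p] coordField i (b k) := heS.mono fun x hx => hx k
        have h2 : (fun x => S l x) =ᶠ[𝓝 p] coordField i (b l) := heS.mono fun x hx => hx l
        rw [← mlieBracket_coordField hp (b k) (b l)]
        exact Filter.EventuallyEq.mlieBracket_vectorField_eq h1 h2
      · filter_upwards [heS, hen, hn] with x h1 h2 h3
        simp only [h1, h2]
        exact Real.sq_sqrt (det_coordGram_pos b h3).le
      · filter_upwards [heS, Filter.eventually_all.2 hec, hn] with x h1 h2 h3
        simp only [h1, h2]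
        exact hYc x h3
    · have hy' : y ∉ chartAt V i '' K := by
        rintro ⟨x, hx, rfl⟩
        exact hy ((chartAt V i).map_source (hKi hx))
      rw [chartExt_of_notMem hy]
      symm
      refine Finset.sum_eq_zero fun k _ => ?_
      have : chartExt (V := V) i (q k) =ᶠ[𝓝 y] fun _ => 0 := by
        filter_upwards [(isCompact_chart_image hK hKi).isClosed.isOpen_compl.mem_nhds hy'] with z hz
        exact chartExt_eq_zero_of_notMem_image (hqK k) hz
      rw [this.fderiv_eq]
      simp
  have hint : ∀ k, Integrable (fun y => fderiv ℝ (chartExt (V := V) i (q k)) y (b k))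
      b.addHaar := fun k => by
    refine Continuous.integrable_of_hasCompactSupport ?_ ?_
    · exact ((hqd k).continuous_fderiv (by simp)).clm_apply continuous_const
    · exact (hqc k).fderiv_apply ℝ (b k)
  simp only [chartIntegral]
  change ∫ y, chartExt i (fun x => divergence D Y x * coordDensity b i x) y ∂b.addHaar = 0
  simp_rw [hpt]
  rw [integral_finsetSum _ fun k _ => hint k]
  refine Finset.sum_eq_zero fun k _ => ?_
  -- Integration by parts against the constant function 1.
  have := integral_mul_fderiv_eq_neg_fderiv_mul_of_integrable (μ := b.addHaar) (𝕜 := ℝ)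
    (f := fun _ => 1) (g := chartExt (V := V) i (q k)) (v := b k) (by simp)
    (by simpa using hint k)
    (by simpa using (hqd k).continuous.integrable_of_hasCompactSupport (hqc k))
    (fun x _ => differentiableAt_const _) (fun x _ => ((hqd k).differentiable (by simp)) x)
  simpa using this

end Integration

/-! ### Lie brackets and iterated derivatives of functions. -/

section LieBracket

variable {V : Type*} [NormedAddCommGroup V] [NormedSpace ℂ V] [FiniteDimensional ℂ V]
  {X : Type*} [TopologicalSpace X] [T2Space X] [ChartedSpace V X]
  [IsManifold 𝓘(ℂ, V) ω X]
  {U W Y : Π x : X, TangentSpace 𝓘(ℝ, V) x} {f : X → ℝ}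

/-- The Lie bracket of vector fields. -/
noncomputable abbrev lie (U W : Π x : X, TangentSpace 𝓘(ℝ, V) x) :
    Π x : X, TangentSpace 𝓘(ℝ, V) x :=
  VectorField.mlieBracket 𝓘(ℝ, V) U W

theorem SmoothSec.lie (hU : SmoothSec V V U) (hW : SmoothSec V V W) :
    SmoothSec V V (lie U W) := fun x =>
  ContMDiffAt.mlieBracket_vectorField (m := ⊤) (n := ⊤) (hU x) (hW x) (by simp)

theorem lie_swap (U W : Π x : X, TangentSpace 𝓘(ℝ, V) x) (x : X) : lie U W x = - lie W U x :=
  VectorField.mlieBracket_swap_apply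

theorem lie_add_left (hU : SmoothSec V V U) (hW : SmoothSec V V W) (x : X) :
    lie (fun y => U y + W y) Y x = lie U Y x + lie W Y x :=
  VectorField.mlieBracket_add_left (hU.mdifferentiableAt x) (hW.mdifferentiableAt x)

theorem lie_add_right (hU : SmoothSec V V U) (hW : SmoothSec V V W) (x : X) :
    lie Y (fun y => U y + W y) x = lie Y U x + lie Y W x :=
  VectorField.mlieBracket_add_right (hU.mdifferentiableAt x) (hW.mdifferentiableAt x)

theorem lie_smul_left (hf : SmoothFun V f) (hU : SmoothSec V V U) (x : X) :
    lie (fun y => f y • U y) W x = - mvfderiv 𝓘(ℝ, V) f x (W x) • U x + f x • lie U W x :=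
  VectorField.mlieBracket_smul_left (hf.mdifferentiableAt x) (hU.mdifferentiableAt x)

theorem lie_smul_right (hf : SmoothFun V f) (hU : SmoothSec V V U) (x : X) :
    lie W (fun y => f y • U y) x = mvfderiv 𝓘(ℝ, V) f x (W x) • U x + f x • lie W U x :=
  VectorField.mlieBracket_smul_right (hf.mdifferentiableAt x) (hU.mdifferentiableAt x)

theorem lie_jacobi (hU : SmoothSec V V U) (hW : SmoothSec V V W) (hY : SmoothSec V V Y) (x : X) :
    lie U (lie W Y) x = lie (lie U W) Y x + lie W (lie U Y) x := by
  have h : ∀ {Z : Π x : X, TangentSpace 𝓘(ℝ, V) x}, SmoothSec V V Z →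
      ContMDiff 𝓘(ℝ, V) (𝓘(ℝ, V).prod 𝓘(ℝ, V)) (minSmoothness ℝ 2)
        (fun x => (TotalSpace.mk' V x (Z x) : TotalSpace V (TangentSpace 𝓘(ℝ, V)))) :=
    fun hZ => ContMDiff.of_le hZ (by simp; exact WithTop.coe_le_coe.2 le_top)
  have : IsManifold 𝓘(ℝ, V) (minSmoothness ℝ 3) X := IsManifold.of_le (n := ω) le_top
  exact congrFun (VectorField.leibniz_identity_mlieBracket (h hU) (h hW) (h hY)) x

/-- The Leibniz rule gives [Y, f s] - f [Y, s] = df(Y) s, whose left side is already known to be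
smooth. Pairing with the dual of a frame field s isolates df(Y). -/
theorem SmoothFun.mvfderiv (hf : SmoothFun V f) (hY : SmoothSec V V Y) :
    SmoothFun V (fun x => mvfderiv 𝓘(ℝ, V) f x (Y x)) := by
  refine smoothFun_of_local fun x => ?_
  obtain ⟨s, c, hs, hc, hb⟩ := exists_smooth_frame (V := V) V (Z := fun y : X => TangentSpace 𝓘(ℝ, V) y) x
  -- In dimension zero there is no frame field to pair with, but then `Y` vanishes.
  rcases isEmpty_or_nonempty (Fin (Module.finrank ℝ V)) with h | ⟨⟨i⟩⟩
  · refine ⟨fun _ => 0, contMDiff_const, ?_⟩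
    filter_upwards [hb] with y ⟨b, _, _⟩
    have h0 : Y y = 0 := by rw [← b.sum_repr (Y y)]; simp
    rw [h0, map_zero]
  · refine ⟨_, hc i _ (SmoothSec.sub (SmoothSec.lie hY (SmoothSec.smul hf (hs i)))
      (SmoothSec.smul hf (SmoothSec.lie hY (hs i)))), ?_⟩
    filter_upwards [hb] with y ⟨b, h1, h2⟩
    rw [lie_smul_right hf (hs i), add_sub_cancel_right, map_smul, ← h2, ← h1,
      Module.Basis.coord_apply, b.repr_self]
    simp

/-- Apply the Jacobi identity to U, W and f Z with Z nonzero at `x`: all terms other than multiples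
of Z cancel, and the coefficient of Z is the required relation. -/
theorem mvfderiv_lie (hf : SmoothFun V f) (hU : SmoothSec V V U)
    (hW : SmoothSec V V W) (x : X) :
    mvfderiv 𝓘(ℝ, V) f x (lie U W x) =
      mvfderiv 𝓘(ℝ, V) (fun y => mvfderiv 𝓘(ℝ, V) f y (W y)) x (U x) -
        mvfderiv 𝓘(ℝ, V) (fun y => mvfderiv 𝓘(ℝ, V) f y (U y)) x (W x) := by
  by_cases hz : ∀ z : TangentSpace 𝓘(ℝ, V) x, z = 0
  · rw [hz (lie U W x), hz (U x), hz (W x), map_zero, map_zero, map_zero, sub_zero]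
  push Not at hz
  obtain ⟨z, hz0⟩ := hz
  obtain ⟨Z, hZ, rfl⟩ := exists_smoothSec_apply_eq V V z
  have hfU := SmoothFun.mvfderiv hf hU
  have hfW := SmoothFun.mvfderiv hf hW
  have hj := lie_jacobi hU hW (SmoothSec.smul hf hZ) x
  have h1 : ∀ {T : Π x : X, TangentSpace 𝓘(ℝ, V) x}, SmoothSec V V T →
      lie T (fun y => f y • Z y) = fun y => mvfderiv 𝓘(ℝ, V) f y (T y) • Z y + f y • lie T Z y :=
    fun hT => funext fun y => lie_smul_right hf hZ y
  rw [h1 hU, h1 hW, h1 (hU.lie hW),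
    lie_add_right (SmoothSec.smul hfW hZ) (SmoothSec.smul hf (hW.lie hZ)),
    lie_add_right (SmoothSec.smul hfU hZ) (SmoothSec.smul hf (hU.lie hZ)),
    lie_smul_right hfW hZ, lie_smul_right hfU hZ, lie_smul_right hf (hW.lie hZ),
    lie_smul_right hf (hU.lie hZ), lie_jacobi hU hW hZ] at hj
  have h2 : (mvfderiv 𝓘(ℝ, V) (fun y => mvfderiv 𝓘(ℝ, V) f y (W y)) x (U x) -
      mvfderiv 𝓘(ℝ, V) (fun y => mvfderiv 𝓘(ℝ, V) f y (U y)) x (W x) -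
      mvfderiv 𝓘(ℝ, V) f x (lie U W x)) • Z x = 0 := by
    rw [sub_smul, sub_smul, ← sub_eq_zero.2 hj]
    module
  have h3 := (smul_eq_zero.1 h2).resolve_right hz0
  linarith

end LieBracket

/-! ### Product rule and smoothness for the divergence. -/

section Divergence

variable {V : Type*} [NormedAddCommGroup V] [NormedSpace ℂ V] [FiniteDimensional ℂ V]
  {X : Type*} [TopologicalSpace X] [T2Space X] [ChartedSpace V X]
  [IsManifold 𝓘(ℂ, V) ω X]
  [RiemannianBundle (fun x : X => TangentSpace 𝓘(ℝ, V) x)]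
  [IsContMDiffRiemannianBundle 𝓘(ℝ, V) ∞ V (fun x : X => TangentSpace 𝓘(ℝ, V) x)]
  {D : CovariantDerivative 𝓘(ℝ, V) V (fun x : X => TangentSpace 𝓘(ℝ, V) x)}

theorem divergence_smul {f : X → ℝ} {Y : Π x : X, TangentSpace 𝓘(ℝ, V) x} (hf : SmoothFun V f)
    (hY : SmoothSec V V Y) (x : X) : divergence D (fun y => f y • Y y) x =
      f x * divergence D Y x + mvfderiv 𝓘(ℝ, V) f x (Y x) := by
  have h : (D (fun y => f y • Y y) x).toLinearMap = f x • (D Y x).toLinearMap +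
      (mvfderiv 𝓘(ℝ, V) f x).toLinearMap.smulRight (Y x) := by
    ext v
    exact cov_smul D hf hY x v
  rw [divergence, h, map_add, map_smul, LinearMap.trace_smulRight]
  rfl

theorem SmoothFun.divergence (hD : IsKahlerConnection D) {Y : Π x : X, TangentSpace 𝓘(ℝ, V) x}
    (hY : SmoothSec V V Y) : SmoothFun V (divergence D Y) := by
  have h : VortexFlow.divergence D Y = fun x => ∑ k,
      ((innerₗ (TangentSpace 𝓘(ℝ, V) x)).comp (D Y x).toLinearMap) (frame x k) (frame x k) := by
    ext x
    rw [VortexFlow.divergence, LinearMap.trace_eq_sum_inner _ (frame x)]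
    refine Finset.sum_congr rfl fun k _ => ?_
    rw [real_inner_comm]
    rfl
  rw [h]
  exact SmoothFun.contraction hD fun U W hU hW => SmoothSec.inner (SmoothSec.cov hD.smooth hY hU) hW

end Divergence

/-! ### The global integral and the divergence theorem. -/

section Integration

variable {V : Type*} [NormedAddCommGroup V] [NormedSpace ℂ V] [FiniteDimensional ℂ V]
  [MeasurableSpace V] [BorelSpace V]
  {X : Type*} [TopologicalSpace X] [T2Space X] [CompactSpace X] [ChartedSpace V X]
  [IsManifold 𝓘(ℂ, V) ω X]
  [RiemannianBundle (fun x : X => TangentSpace 𝓘(ℝ, V) x)]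
  [IsContMDiffRiemannianBundle 𝓘(ℝ, V) ∞ V (fun x : X => TangentSpace 𝓘(ℝ, V) x)]
  {D : CovariantDerivative 𝓘(ℝ, V) V (fun x : X => TangentSpace 𝓘(ℝ, V) x)}

variable (V X) in
/-- The partition of unity used to define the integral. -/
noncomputable def chartPartition : SmoothPartitionOfUnity X 𝓘(ℝ, V) X univ :=
  Classical.choose
    (SmoothPartitionOfUnity.exists_isSubordinate_chartAt_source (I := 𝓘(ℝ, V)) X)

theorem tsupport_chartPartition_subset (i : X) :
    tsupport (chartPartition V X i) ⊆ (chartAt V i).source :=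
  Classical.choose_spec
    (SmoothPartitionOfUnity.exists_isSubordinate_chartAt_source (I := 𝓘(ℝ, V)) X) i

theorem smoothFun_chartPartition (i : X) : SmoothFun V (chartPartition V X i) :=
  (chartPartition V X i).contMDiff

theorem chartPartition_eq_zero (i : X) {x : X} (hx : x ∉ tsupport (chartPartition V X i)) :
    chartPartition V X i x = 0 :=
  image_eq_zero_of_notMem_tsupport hx

variable (V X) in
/-- The finite set of indices of nonzero functions of the partition of unity. -/
noncomputable def partitionIndices : Finset X :=
  (chartPartition V X).locallyFinite.finite_nonempty_of_compact.toFinset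

theorem chartPartition_eq_zero_of_notMem {i : X} (hi : i ∉ partitionIndices V X) (x : X) :
    chartPartition V X i x = 0 := by
  by_contra h
  exact hi ((Finite.mem_toFinset _).2 ⟨x, h⟩)

theorem sum_chartPartition (x : X) : ∑ i ∈ partitionIndices V X, chartPartition V X i x = 1 := by
  rw [← (chartPartition V X).sum_eq_one (mem_univ x)]
  symm
  refine finsum_eq_sum_of_support_subset _ fun i hi => ?_
  by_contra h
  exact hi (chartPartition_eq_zero_of_notMem h x)

theorem integral_eq_sum (f : X → ℝ) : integral V f =
    ∑ i ∈ partitionIndices V X, chartIntegral V i (fun x => chartPartition V X i x * f x) := by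
  have h1 : integral V f = ∑ᶠ i, chartIntegral V i (fun x => chartPartition V X i x * f x) := by
    rw [integral]
    refine finsum_congr fun i => ?_
    rw [chartIntegral_eq_setIntegral]
    refine setIntegral_congr_fun (chartAt V i).open_target.measurableSet fun y hy => ?_
    simp only [volumeDensity_eq _ hy]
    rfl
  rw [h1]
  refine finsum_eq_sum_of_support_subset _ fun i hi => ?_
  by_contra h
  refine hi ?_
  simp only [chartPartition_eq_zero_of_notMem h, zero_mul]
  simpa using chartIntegral_const_mul (V := V) (i := i) 0 (fun _ => (0 : ℝ))

theorem chartPartition_mul_eq_zero (i : X) (f : X → ℝ) (x : X)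
    (hx : x ∉ tsupport (chartPartition V X i)) : chartPartition V X i x * f x = 0 := by
  rw [chartPartition_eq_zero i hx, zero_mul]

theorem integral_finset_sum {ι : Type*} (s : Finset ι) {f : ι → X → ℝ}
    (hf : ∀ j ∈ s, Continuous (f j)) :
    integral V (fun x => ∑ j ∈ s, f j x) = ∑ j ∈ s, integral V (f j) := by
  simp only [integral_eq_sum]
  rw [Finset.sum_comm]
  refine Finset.sum_congr rfl fun i _ => ?_
  simp only [Finset.mul_sum]
  exact chartIntegral_sum s (isClosed_tsupport _) (tsupport_chartPartition_subset i)
    (fun j _ => chartPartition_mul_eq_zero i (f j))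
    fun j hj => (smoothFun_chartPartition i).continuous.mul (hf j hj)

theorem integral_add {f g : X → ℝ} (hf : Continuous f) (hg : Continuous g) :
    integral V (fun x => f x + g x) = integral V f + integral V g := by
  have h := integral_finset_sum (V := V) Finset.univ (f := ![f, g])
    (by intro j _; fin_cases j <;> simpa)
  simpa using h

theorem integral_const_mul (c : ℝ) (f : X → ℝ) :
    integral V (fun x => c * f x) = c * integral V f := by
  simp only [integral_eq_sum]
  rw [Finset.mul_sum]
  refine Finset.sum_congr rfl fun i _ => ?_
  rw [← chartIntegral_const_mul]
  congr 1
  ext x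
  ring

theorem integral_sub {f g : X → ℝ} (hf : Continuous f) (hg : Continuous g) :
    integral V (fun x => f x - g x) = integral V f - integral V g := by
  have h := integral_add (V := V) hf (g := fun x => -1 * g x) (hg.const_mul (-1))
  rw [integral_const_mul] at h
  rw [sub_eq_add_neg, ← neg_one_mul (integral V g), ← h]
  congr 1
  ext x
  ring

theorem eq_zero_of_integral_eq_zero {f : X → ℝ} (hf : Continuous f) (h0 : ∀ x, 0 ≤ f x)
    (h : integral V f = 0) (x : X) : f x = 0 := by
  rw [integral_eq_sum] at h
  have hn : ∀ i x, 0 ≤ chartPartition V X i x * f x := fun i x =>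
    mul_nonneg ((chartPartition V X).nonneg i x) (h0 x)
  have h1 := (Finset.sum_eq_zero_iff_of_nonneg fun i _ => chartIntegral_nonneg (hn i)).1 h
  have h2 : ∀ i ∈ partitionIndices V X, chartPartition V X i x * f x = 0 := fun i hi =>
    eq_zero_of_chartIntegral_eq_zero (V := V) (isClosed_tsupport _)
      (tsupport_chartPartition_subset i) (chartPartition_mul_eq_zero i f)
      ((smoothFun_chartPartition i).continuous.mul hf) (hn i) (h1 i hi) x
  rw [← one_mul (f x), ← sum_chartPartition (V := V) x, Finset.sum_mul]
  exact Finset.sum_eq_zero h2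

/-- The divergence theorem. -/
theorem integral_divergence (hD : IsKahlerConnection D) {Y : Π x : X, TangentSpace 𝓘(ℝ, V) x}
    (hY : SmoothSec V V Y) : integral V (divergence D Y) = 0 := by
  let ρ : X → X → ℝ := fun i => chartPartition V X i
  let g : X → X → ℝ := fun i x => mvfderiv 𝓘(ℝ, V) (ρ i) x (Y x)
  have hρ : ∀ i, SmoothFun V (ρ i) := smoothFun_chartPartition
  have hg : ∀ i, SmoothFun V (g i) := fun i => SmoothFun.mvfderiv (hρ i) hY
  have hg0 : ∀ i, ∀ x ∉ tsupport (ρ i), g i x = 0 := fun i x hx => by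
    have : ∀ᶠ y in 𝓝 x, ρ i y = 0 := by
      filter_upwards [(isClosed_tsupport (ρ i)).isOpen_compl.mem_nhds hx] with y hy
      exact image_eq_zero_of_notMem_tsupport hy
    exact (congrArg (fun f => f (Y x)) (mvfderiv_congr (V := V) this)).trans
      (mvfderiv_const_apply 0 x (Y x))
  -- The field ρ_i Y is supported in one chart, where the local theorem applies; the product rule
  -- leaves the term dρ_i(Y).
  have h1 : ∀ i, chartIntegral V i (fun x => ρ i x * divergence D Y x) =
      - chartIntegral V i (g i) := fun i => by
    have h := chartIntegral_divergence hD (isClosed_tsupport (ρ i))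
      (tsupport_chartPartition_subset i) (SmoothSec.smul (hρ i) hY) fun x hx => by
        rw [image_eq_zero_of_notMem_tsupport hx, zero_smul]
    have h' : divergence D (fun x => ρ i x • Y x) = fun x => ρ i x * divergence D Y x + g i x := by
      ext x
      exact divergence_smul (hρ i) hY x
    rw [h', chartIntegral_add (isClosed_tsupport (ρ i)) (tsupport_chartPartition_subset i)
      (chartPartition_mul_eq_zero i _) (hg0 i)
      ((hρ i).continuous.mul (SmoothFun.divergence hD hY).continuous) (hg i).continuous] at h
    linarith
  -- The terms dρ_i(Y) are integrated in different charts. Inserting the partition of unity once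
  -- more and changing charts gathers them, for each j, in the chart at j, where their sum over i is
  -- the derivative of the constant 1.
  have h2 : ∀ i, chartIntegral V i (g i) =
      ∑ j ∈ partitionIndices V X, chartIntegral V j (fun x => ρ j x * g i x) := fun i => by
    have h3 : g i = fun x => ∑ j ∈ partitionIndices V X, ρ j x * g i x := by
      ext x
      rw [← Finset.sum_mul, sum_chartPartition, one_mul]
    conv_lhs => rw [h3]
    rw [chartIntegral_sum (g := fun j x => ρ j x * g i x) _ (isClosed_tsupport (ρ i)) (tsupport_chartPartition_subset i)
      (fun j _ x hx => by rw [hg0 i x hx, mul_zero])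
      fun j _ => (hρ j).continuous.mul (hg i).continuous]
    refine Finset.sum_congr rfl fun j _ => chartIntegral_change fun x hx => ?_
    by_cases hx1 : x ∈ tsupport (ρ i)
    · by_cases hx2 : x ∈ tsupport (ρ j)
      · exact (hx ⟨tsupport_chartPartition_subset i hx1, tsupport_chartPartition_subset j hx2⟩).elim
      · rw [image_eq_zero_of_notMem_tsupport hx2, zero_mul]
    · rw [hg0 i x hx1, mul_zero]
  have h4 : ∀ x, ∑ i ∈ partitionIndices V X, g i x = 0 := fun x => by
    rw [← mvfderiv_sum_apply _ fun i _ => hρ i]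
    have : (fun y => ∑ i ∈ partitionIndices V X, ρ i y) = fun _ => 1 := by
      ext y
      exact sum_chartPartition y
    rw [this, mvfderiv_const_apply]
  rw [integral_eq_sum]
  calc ∑ i ∈ partitionIndices V X, chartIntegral V i (fun x => ρ i x * divergence D Y x)
      = - ∑ j ∈ partitionIndices V X, ∑ i ∈ partitionIndices V X,
          chartIntegral V j (fun x => ρ j x * g i x) := by
        rw [Finset.sum_comm, ← Finset.sum_neg_distrib]
        exact Finset.sum_congr rfl fun i _ => by rw [h1, h2]
    _ = 0 := by
        rw [neg_eq_zero]
        refine Finset.sum_eq_zero fun j _ => ?_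
        rw [← chartIntegral_sum (g := fun i x => ρ j x * g i x) _ (isClosed_tsupport (ρ j)) (tsupport_chartPartition_subset j)
          (fun i _ => chartPartition_mul_eq_zero j (g i))
          fun i _ => (hρ j).continuous.mul (hg i).continuous]
        simp_rw [← Finset.mul_sum, h4, mul_zero]
        simpa using chartIntegral_const_mul (V := V) (i := j) 0 (fun _ => (0 : ℝ))

/-- The codifferential of a smooth one-form is smooth and its integral vanishes. -/
theorem smoothFun_and_integral_codifferential (hD : IsKahlerConnection D)
    {θ : Π x : X, TangentSpace 𝓘(ℝ, V) x →ₗ[ℝ] ℝ}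
    (hθ : ∀ W : Π x : X, TangentSpace 𝓘(ℝ, V) x, SmoothSec V V W →
      SmoothFun V (fun x => θ x (W x))) {δ : X → ℝ}
    (hδ : ∀ x, ∃ W, IsNormalFrame D x W ∧
      δ x = ∑ k, mvfderiv 𝓘(ℝ, V) (fun y => θ y (W k y)) x (frame x k)) :
    SmoothFun V δ ∧ integral V δ = 0 := by
  -- With B(u, w) = θ(u) w, the contraction of B is the vector field dual to θ, so δ is the
  -- divergence of a smooth field.
  let B : Π x : X, TangentSpace 𝓘(ℝ, V) x →ₗ[ℝ] TangentSpace 𝓘(ℝ, V) x →ₗ[ℝ]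
    TangentSpace 𝓘(ℝ, V) x := fun x => (LinearMap.lsmul ℝ (TangentSpace 𝓘(ℝ, V) x)).comp (θ x)
  have hB : ∀ U W : Π x : X, TangentSpace 𝓘(ℝ, V) x, SmoothSec V V U → SmoothSec V V W →
      SmoothSec V V (fun x => B x (U x) (W x)) := fun U W hU hW => SmoothSec.smul (hθ U hU) hW
  have hY := SmoothSec.contraction hD hB
  suffices h : δ = divergence D fun x => ∑ k, B x (frame x k) (frame x k) by
    rw [h]
    exact ⟨SmoothFun.divergence hD hY, integral_divergence hD hY⟩
  ext x
  obtain ⟨W, hW, hδx⟩ := hδ x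
  rw [hδx, divergence, LinearMap.trace_eq_sum_inner _ (frame x)]
  refine Finset.sum_congr rfl fun j _ => ?_
  have h : D (fun y => ∑ k, B y (frame y k) (frame y k)) x (frame x j) =
      ∑ k, mvfderiv 𝓘(ℝ, V) (fun y => θ y (W k y)) x (frame x j) • frame x k := by
    rw [hW.cov_contraction hD hB D]
    refine Finset.sum_congr rfl fun k _ => ?_
    refine (cov_smul D (hθ _ (hW.smooth k)) (hW.smooth k) x _).trans ?_
    rw [hW.cov_eq_zero, hW.apply_self]
    simp
  change _ = inner ℝ (frame x j) (D (fun y => ∑ k, B y (frame y k) (frame y k)) x (frame x j))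
  rw [h, inner_sum]
  simp_rw [inner_smul_right, orthonormal_iff_ite.1 (frame x).orthonormal]
  simp

end Integration

/-! ### Tensoriality of the curvature. -/

section Curvature

variable {V : Type*} [NormedAddCommGroup V] [NormedSpace ℂ V] [FiniteDimensional ℂ V]
  {X : Type*} [TopologicalSpace X] [T2Space X] [ChartedSpace V X] [IsManifold 𝓘(ℂ, V) ω X]
  {F : Type*} [NormedAddCommGroup F] [NormedSpace ℂ F] [FiniteDimensional ℂ F]
  {E : X → Type*} [TopologicalSpace (TotalSpace F E)]
  [∀ x, NormedAddCommGroup (E x)] [∀ x, InnerProductSpace ℂ (E x)]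
  [FiberBundle F E] [VectorBundle ℝ F E] [VectorBundle ℂ F E]
  [ContMDiffVectorBundle ∞ F E 𝓘(ℝ, V)]

theorem SmoothSec.I_smul {σ : Π x, E x} (hσ : SmoothSec F V σ) :
    SmoothSec F V (fun x => Complex.I • σ x) := by
  intro x₀
  rw [contMDiffAt_section]
  have h := (contMDiffAt_section _).1 (hσ x₀)
  have h2 : ContMDiffAt 𝓘(ℝ, V) 𝓘(ℝ, F) ∞ (fun x : X => Complex.I •
      (trivializationAt F E x₀ ⟨x, σ x⟩).2) x₀ :=
    ContDiffAt.comp_contMDiffAt (g := fun v : F => Complex.I • v)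
      (contDiff_const_smul Complex.I).contDiffAt h
  refine h2.congr_of_eventuallyEq ?_
  filter_upwards [(trivializationAt F E x₀).open_baseSet.mem_nhds
    (FiberBundle.mem_baseSet_trivializationAt' x₀)] with x hx
  exact ((trivializationAt F E x₀).linear ℂ hx).map_smul Complex.I (σ x)

theorem complex_smul_eq {W : Type*} [AddCommGroup W] [Module ℂ W] (c : ℂ) (w : W) :
    c • w = c.re • w + c.im • Complex.I • w := by
  conv_lhs => rw [← Complex.re_add_im c]
  rw [add_smul, mul_smul, Complex.coe_smul, Complex.coe_smul]

theorem SmoothSec.complex_smul (c : ℂ) {σ : Π x, E x} (hσ : SmoothSec F V σ) :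
    SmoothSec F V (fun x => c • σ x) := by
  simp only [complex_smul_eq c]
  exact SmoothSec.add (hσ.const_smul c.re) (hσ.I_smul.const_smul c.im)

namespace Connection

variable (A : Connection V F E)

theorem smoothSec_nabla {σ : Π x, E x} {W : Π x : X, TangentSpace 𝓘(ℝ, V) x}
    (hσ : SmoothSec F V σ) (hW : SmoothSec V V W) :
    SmoothSec F V (fun x => A.nabla σ x (W x)) :=
  SmoothSec.cov A.smooth hσ hW

theorem nabla_I_smul {σ : Π x, E x} (hσ : SmoothSec F V σ) (x : X) (v : TangentSpace 𝓘(ℝ, V) x) :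
    A.nabla (fun y => Complex.I • σ y) x v = Complex.I • A.nabla σ x v :=
  A.map_I_smul σ x v (hσ.mdifferentiableAt x)

theorem nabla_complex_smul (c : ℂ) {σ : Π x, E x} (hσ : SmoothSec F V σ) (x : X)
    (v : TangentSpace 𝓘(ℝ, V) x) :
    A.nabla (fun y => c • σ y) x v = c • A.nabla σ x v := by
  simp only [complex_smul_eq c]
  rw [cov_add A.nabla (hσ.const_smul c.re) (hσ.I_smul.const_smul c.im),
    cov_const_smul A.nabla _ hσ, cov_const_smul A.nabla _ hσ.I_smul, A.nabla_I_smul hσ]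

/-- The commutator `[∇_U, ∇_W] σ - ∇_[U, W] σ` for vector fields `U`, `W`. -/
noncomputable def curvOp (U W : Π x : X, TangentSpace 𝓘(ℝ, V) x) (σ : Π x, E x) (x : X) : E x :=
  A.nabla (fun y => A.nabla σ y (W y)) x (U x) - A.nabla (fun y => A.nabla σ y (U y)) x (W x)
    - A.nabla σ x (lie U W x)

variable {U U' W W' : Π x : X, TangentSpace 𝓘(ℝ, V) x} {σ σ' : Π x, E x}

theorem curvOp_swap (U W : Π x : X, TangentSpace 𝓘(ℝ, V) x) (σ : Π x, E x) (x : X) :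
    A.curvOp U W σ x = - A.curvOp W U σ x := by
  rw [curvOp, curvOp, lie_swap, map_neg]
  abel

theorem smoothSec_curvOp (hU : SmoothSec V V U) (hW : SmoothSec V V W) (hσ : SmoothSec F V σ) :
    SmoothSec F V (A.curvOp U W σ) :=
  SmoothSec.sub (SmoothSec.sub (A.smoothSec_nabla (A.smoothSec_nabla hσ hW) hU)
    (A.smoothSec_nabla (A.smoothSec_nabla hσ hU) hW)) (A.smoothSec_nabla hσ (hU.lie hW))

theorem curvOp_add_left (hU : SmoothSec V V U) (hU' : SmoothSec V V U')
    (hσ : SmoothSec F V σ) (x : X) :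
    A.curvOp (fun y => U y + U' y) W σ x = A.curvOp U W σ x + A.curvOp U' W σ x := by
  simp only [curvOp, map_add, lie_add_left hU hU',
    cov_add A.nabla (A.smoothSec_nabla hσ hU) (A.smoothSec_nabla hσ hU')]
  abel

theorem curvOp_smul_left {f : X → ℝ} (hf : SmoothFun V f) (hU : SmoothSec V V U)
    (hσ : SmoothSec F V σ) (x : X) :
    A.curvOp (fun y => f y • U y) W σ x = f x • A.curvOp U W σ x := by
  simp only [curvOp, map_smul, lie_smul_left hf hU, map_add, neg_smul, map_neg,
    cov_smul A.nabla hf (A.smoothSec_nabla hσ hU)]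
  module

theorem curvOp_add_sec (hU : SmoothSec V V U) (hW : SmoothSec V V W) (hσ : SmoothSec F V σ)
    (hσ' : SmoothSec F V σ') (x : X) :
    A.curvOp U W (fun y => σ y + σ' y) x = A.curvOp U W σ x + A.curvOp U W σ' x := by
  simp only [curvOp, cov_add A.nabla hσ hσ',
    cov_add A.nabla (A.smoothSec_nabla hσ hU) (A.smoothSec_nabla hσ' hU),
    cov_add A.nabla (A.smoothSec_nabla hσ hW) (A.smoothSec_nabla hσ' hW)]
  abel

/-- The first-order terms in f are symmetric in U and W and cancel; the second-order terms form the
derivative of f along [U, W], which the bracket term removes. -/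
theorem curvOp_smul_sec {f : X → ℝ} (hf : SmoothFun V f) (hU : SmoothSec V V U)
    (hW : SmoothSec V V W) (hσ : SmoothSec F V σ) (x : X) :
    A.curvOp U W (fun y => f y • σ y) x = f x • A.curvOp U W σ x := by
  have h : ∀ {Z : Π x : X, TangentSpace 𝓘(ℝ, V) x}, SmoothSec V V Z → ∀ v,
      A.nabla (fun y => f y • A.nabla σ y (Z y) + mvfderiv 𝓘(ℝ, V) f y (Z y) • σ y) x v =
      f x • A.nabla (fun y => A.nabla σ y (Z y)) x v +
        mvfderiv 𝓘(ℝ, V) f x v • A.nabla σ x (Z x) +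
        (mvfderiv 𝓘(ℝ, V) f x (Z x) • A.nabla σ x v +
          mvfderiv 𝓘(ℝ, V) (fun y => mvfderiv 𝓘(ℝ, V) f y (Z y)) x v • σ x) := fun hZ v => by
    rw [cov_add A.nabla (SmoothSec.smul hf (A.smoothSec_nabla hσ hZ))
      (SmoothSec.smul (SmoothFun.mvfderiv hf hZ) hσ), cov_smul A.nabla hf (A.smoothSec_nabla hσ hZ),
      cov_smul A.nabla (SmoothFun.mvfderiv hf hZ) hσ]
  simp only [curvOp, cov_smul A.nabla hf hσ]
  rw [h hW, h hU, mvfderiv_lie hf hU hW]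
  module

theorem curvOp_congr (hU : SmoothSec V V U) (hU' : SmoothSec V V U') (hW : SmoothSec V V W)
    (hW' : SmoothSec V V W') (hσ : SmoothSec F V σ) (hσ' : SmoothSec F V σ') {x : X}
    (h1 : U x = U' x) (h2 : W x = W' x) (h3 : σ x = σ' x) :
    A.curvOp U W σ x = A.curvOp U' W' σ' x := by
  have hl : ∀ {U U' W : Π x : X, TangentSpace 𝓘(ℝ, V) x}, SmoothSec V V U → SmoothSec V V U' →
      U x = U' x → A.curvOp U W σ x = A.curvOp U' W σ x := fun {U U' W} hU hU' h =>
    eq_of_tensorial (V := V) (F := V) (fun U => A.curvOp U W σ x)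
      (fun U U' hU hU' => A.curvOp_add_left hU hU' hσ x)
      (fun f U hf hU => A.curvOp_smul_left hf hU hσ x) hU hU' h
  rw [hl hU hU' h1, curvOp_swap, hl hW hW' h2, ← curvOp_swap]
  exact eq_of_tensorial (V := V) (F := F) (fun σ => A.curvOp U' W' σ x)
      (fun σ σ' hσ hσ' => A.curvOp_add_sec hU' hW' hσ hσ' x)
      (fun f σ hf hσ => A.curvOp_smul_sec hf hU' hW' hσ x) hσ hσ' h3

/-- The definition uses one particular extension of each argument. Locality replaces these by global
fields with the same germs, and tensoriality then by any fields with the same values at `x`. -/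
theorem curv_apply (hU : SmoothSec V V U) (hW : SmoothSec V V W) (hσ : SmoothSec F V σ) (x : X) :
    A.curv x (U x) (W x) (σ x) = A.curvOp U W σ x := by
  obtain ⟨U', hU', heU⟩ := exists_smoothSec_eq_extend V V (U x)
  obtain ⟨W', hW', heW⟩ := exists_smoothSec_eq_extend V V (W x)
  obtain ⟨σ', hσ', heσ⟩ := exists_smoothSec_eq_extend V F (σ x)
  have h1 : U' x = U x := by simp [heU.self_of_nhds]
  have h2 : W' x = W x := by simp [heW.self_of_nhds]
  have h3 : σ' x = σ x := by simp [heσ.self_of_nhds]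
  rw [← A.curvOp_congr hU' hU hW' hW hσ' hσ h1 h2 h3]
  have hn : ∀ {Z Z' : Π x : X, TangentSpace 𝓘(ℝ, V) x}, SmoothSec V V Z →
      (∀ᶠ y in 𝓝 x, Z y = Z' y) →
      A.nabla (fun y => A.nabla (FiberBundle.extend F (σ x)) y (Z' y)) x =
        A.nabla (fun y => A.nabla σ' y (Z y)) x := fun hZ h => by
    refine cov_congr A.nabla (A.smoothSec_nabla hσ' hZ) ?_
    filter_upwards [h, eventually_eventually_nhds.2 heσ] with y h1 h2
    rw [← h1, cov_congr A.nabla hσ' (h2.mono fun z hz => hz.symm)]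
  have hl : lie (FiberBundle.extend V (U x)) (FiberBundle.extend V (W x)) x = lie U' W' x :=
    Filter.EventuallyEq.mlieBracket_vectorField_eq (heU.mono fun y hy => hy.symm)
      (heW.mono fun y hy => hy.symm)
  simp only [curv, curvOp]
  rw [hn hU' heU, hn hW' heW, h1, h2, ← hl, cov_congr A.nabla hσ' (heσ.mono fun z hz => hz.symm)]

/-- The curvature as a bilinear form with values in the endomorphisms of the fibre. -/
noncomputable def curvature (x : X) :
    TangentSpace 𝓘(ℝ, V) x →ₗ[ℝ] TangentSpace 𝓘(ℝ, V) x →ₗ[ℝ] E x →ₗ[ℂ] E x :=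
  LinearMap.mk₂ ℝ (fun v w =>
    { toFun := A.curv x v w
      map_add' := fun e e' => by
        obtain ⟨U, hU, rfl⟩ := exists_smoothSec_apply_eq V V v
        obtain ⟨W, hW, rfl⟩ := exists_smoothSec_apply_eq V V w
        obtain ⟨σ, hσ, rfl⟩ := exists_smoothSec_apply_eq V F e
        obtain ⟨σ', hσ', rfl⟩ := exists_smoothSec_apply_eq V F e'
        have h := A.curv_apply hU hW (SmoothSec.add hσ hσ') x
        rw [A.curvOp_add_sec hU hW hσ hσ'] at h
        rw [A.curv_apply hU hW hσ, A.curv_apply hU hW hσ', ← h]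
      map_smul' := fun c e => by
        obtain ⟨U, hU, rfl⟩ := exists_smoothSec_apply_eq V V v
        obtain ⟨W, hW, rfl⟩ := exists_smoothSec_apply_eq V V w
        obtain ⟨σ, hσ, rfl⟩ := exists_smoothSec_apply_eq V F e
        have h := A.curv_apply hU hW (hσ.complex_smul c) x
        rw [RingHom.id_apply, h, A.curv_apply hU hW hσ]
        simp only [curvOp, A.nabla_complex_smul c hσ,
          A.nabla_complex_smul c (A.smoothSec_nabla hσ hU),
          A.nabla_complex_smul c (A.smoothSec_nabla hσ hW), smul_sub] })
    (fun v v' w => by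
      ext e
      obtain ⟨U, hU, rfl⟩ := exists_smoothSec_apply_eq V V v
      obtain ⟨U', hU', rfl⟩ := exists_smoothSec_apply_eq V V v'
      obtain ⟨W, hW, rfl⟩ := exists_smoothSec_apply_eq V V w
      obtain ⟨σ, hσ, rfl⟩ := exists_smoothSec_apply_eq V F e
      have h := A.curv_apply (SmoothSec.add hU hU') hW hσ x
      rw [A.curvOp_add_left hU hU' hσ, ← A.curv_apply hU hW hσ, ← A.curv_apply hU' hW hσ] at h
      exact h)
    (fun c v w => by
      ext e
      obtain ⟨U, hU, rfl⟩ := exists_smoothSec_apply_eq V V v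
      obtain ⟨W, hW, rfl⟩ := exists_smoothSec_apply_eq V V w
      obtain ⟨σ, hσ, rfl⟩ := exists_smoothSec_apply_eq V F e
      have h := A.curv_apply (hU.const_smul c) hW hσ x
      rw [A.curvOp_smul_left (f := fun _ => c) contMDiff_const hU hσ, ← A.curv_apply hU hW hσ] at h
      exact h)
    (fun v w w' => by
      ext e
      obtain ⟨U, hU, rfl⟩ := exists_smoothSec_apply_eq V V v
      obtain ⟨W, hW, rfl⟩ := exists_smoothSec_apply_eq V V w
      obtain ⟨W', hW', rfl⟩ := exists_smoothSec_apply_eq V V w'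
      obtain ⟨σ, hσ, rfl⟩ := exists_smoothSec_apply_eq V F e
      have h := A.curv_apply hU (SmoothSec.add hW hW') hσ x
      rw [curvOp_swap, A.curvOp_add_left hW hW' hσ, neg_add, ← curvOp_swap, ← curvOp_swap,
        ← A.curv_apply hU hW hσ, ← A.curv_apply hU hW' hσ] at h
      exact h)
    (fun c v w => by
      ext e
      obtain ⟨U, hU, rfl⟩ := exists_smoothSec_apply_eq V V v
      obtain ⟨W, hW, rfl⟩ := exists_smoothSec_apply_eq V V w
      obtain ⟨σ, hσ, rfl⟩ := exists_smoothSec_apply_eq V F e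
      have h := A.curv_apply hU (hW.const_smul c) hσ x
      rw [curvOp_swap, A.curvOp_smul_left (f := fun _ => c) contMDiff_const hW hσ, ← smul_neg,
        ← curvOp_swap, ← A.curv_apply hU hW hσ] at h
      exact h)

theorem curvature_apply (x : X) (v w : TangentSpace 𝓘(ℝ, V) x) (e : E x) :
    A.curvature x v w e = A.curv x v w e := rfl

theorem curvature_apply_field (hU : SmoothSec V V U) (hW : SmoothSec V V W) (hσ : SmoothSec F V σ)
    (x : X) : A.curvature x (U x) (W x) (σ x) = A.curvOp U W σ x :=
  A.curv_apply hU hW hσ x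

theorem smoothSec_curvature (hU : SmoothSec V V U) (hW : SmoothSec V V W) (hσ : SmoothSec F V σ) :
    SmoothSec F V (fun x => A.curvature x (U x) (W x) (σ x)) := by
  have h : (fun x => A.curvature x (U x) (W x) (σ x)) = A.curvOp U W σ :=
    funext fun x => A.curvature_apply_field hU hW hσ x
  rw [h]
  exact A.smoothSec_curvOp hU hW hσ

theorem curvature_swap (x : X) (v w : TangentSpace 𝓘(ℝ, V) x) :
    A.curvature x v w = - A.curvature x w v := by
  ext e
  obtain ⟨U, hU, rfl⟩ := exists_smoothSec_apply_eq V V v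
  obtain ⟨W, hW, rfl⟩ := exists_smoothSec_apply_eq V V w
  obtain ⟨σ, hσ, rfl⟩ := exists_smoothSec_apply_eq V F e
  rw [LinearMap.neg_apply, A.curvature_apply_field hU hW hσ, A.curvature_apply_field hW hU hσ,
    curvOp_swap]

end Connection

end Curvature

/-! ### The real part of the complex trace. -/

section RealTrace

variable {W : Type*} [AddCommGroup W] [Module ℂ W]

/-- The real part of the complex trace. -/
noncomputable def retr : (W →ₗ[ℂ] W) →ₗ[ℝ] ℝ :=
  Complex.reLm ∘ₗ (LinearMap.trace ℂ W).restrictScalars ℝ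

theorem retr_apply (a : W →ₗ[ℂ] W) : retr a = (LinearMap.trace ℂ W a).re := rfl

theorem retr_mul_comm (a b : W →ₗ[ℂ] W) : retr (a * b) = retr (b * a) := by
  rw [retr_apply, LinearMap.trace_mul_comm, retr_apply]

/-- In a real basis made of b and i b, each complex diagonal entry contributes its real part twice.
The formula makes the differentiation rule for real traces available for complex ones. -/
theorem retr_eq_real_trace [FiniteDimensional ℂ W] (a : W →ₗ[ℂ] W) :
    retr a = 2⁻¹ * LinearMap.trace ℝ W (a.restrictScalars ℝ) := by
  have b := Module.finBasis ℂ W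
  rw [retr_apply, LinearMap.trace_eq_matrix_trace ℂ b,
    LinearMap.trace_eq_matrix_trace ℝ (Complex.basisOneI.smulTower b), Matrix.trace, Matrix.trace,
    Fintype.sum_prod_type, Complex.re_sum, Finset.sum_comm, Finset.mul_sum]
  refine Finset.sum_congr rfl fun i _ => ?_
  simp [LinearMap.toMatrix_apply, Module.Basis.smulTower_repr, Fin.sum_univ_two,
    Module.Basis.smulTower_apply]
  ring

end RealTrace

/-! ### Smooth sections of End E and their derivatives. -/

section EndSections

variable {V : Type*} [NormedAddCommGroup V] [NormedSpace ℂ V] [FiniteDimensional ℂ V]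
  {X : Type*} [TopologicalSpace X] [T2Space X] [ChartedSpace V X] [IsManifold 𝓘(ℂ, V) ω X]
  {F : Type*} [NormedAddCommGroup F] [NormedSpace ℂ F] [FiniteDimensional ℂ F]
  {E : X → Type*} [TopologicalSpace (TotalSpace F E)]
  [∀ x, NormedAddCommGroup (E x)] [∀ x, InnerProductSpace ℂ (E x)]
  [FiberBundle F E] [VectorBundle ℝ F E] [VectorBundle ℂ F E]
  [ContMDiffVectorBundle ∞ F E 𝓘(ℝ, V)]

variable (V F) in
/-- Smoothness of a section of `End E`. -/
def SmoothEnd (Ψ : Π x, E x →ₗ[ℂ] E x) : Prop :=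
  ∀ σ : Π x, E x, SmoothSec F V σ → SmoothSec F V (fun x => Ψ x (σ x))

namespace SmoothEnd

variable {Ψ Φ : Π x, E x →ₗ[ℂ] E x}

theorem add (hΨ : SmoothEnd V F Ψ) (hΦ : SmoothEnd V F Φ) :
    SmoothEnd V F (fun x => Ψ x + Φ x) :=
  fun σ hσ => SmoothSec.add (hΨ σ hσ) (hΦ σ hσ)

theorem sub (hΨ : SmoothEnd V F Ψ) (hΦ : SmoothEnd V F Φ) :
    SmoothEnd V F (fun x => Ψ x - Φ x) :=
  fun σ hσ => SmoothSec.sub (hΨ σ hσ) (hΦ σ hσ)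

theorem smul {f : X → ℝ} (hf : SmoothFun V f) (hΨ : SmoothEnd V F Ψ) :
    SmoothEnd V F (fun x => f x • Ψ x) :=
  fun σ hσ => SmoothSec.smul hf (hΨ σ hσ)

theorem const_smul (c : ℝ) (hΨ : SmoothEnd V F Ψ) : SmoothEnd V F (fun x => c • Ψ x) :=
  fun σ hσ => (hΨ σ hσ).const_smul c

theorem complex_smul (c : ℂ) (hΨ : SmoothEnd V F Ψ) : SmoothEnd V F (fun x => c • Ψ x) :=
  fun σ hσ => (hΨ σ hσ).complex_smul c

theorem mul (hΨ : SmoothEnd V F Ψ) (hΦ : SmoothEnd V F Φ) :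
    SmoothEnd V F (fun x => Ψ x * Φ x) :=
  fun σ hσ => hΨ _ (hΦ σ hσ)

theorem one : SmoothEnd V F (fun x => (1 : E x →ₗ[ℂ] E x)) :=
  fun _ hσ => hσ

theorem retr (hΨ : SmoothEnd V F Ψ) : SmoothFun V (fun x => retr (Ψ x)) := by
  have h : (fun x => VortexFlow.retr (Ψ x)) =
      fun x => 2⁻¹ * LinearMap.trace ℝ (E x) ((Ψ x).restrictScalars ℝ) := by
    ext x
    have := VectorBundle.finiteDimensional ℂ F E x
    exact retr_eq_real_trace _
  rw [h]
  exact SmoothFun.mul contMDiff_const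
    (SmoothFun.trace (Ψ := fun x => (Ψ x).restrictScalars ℝ) hΨ)

end SmoothEnd

namespace Connection

variable (A : Connection V F E) {Ψ Φ : Π x, E x →ₗ[ℂ] E x}

theorem dEnd_apply (hΨ : SmoothEnd V F Ψ) {σ : Π x, E x} (hσ : SmoothSec F V σ) (x : X)
    (v : TangentSpace 𝓘(ℝ, V) x) :
    A.dEnd (fun y e => Ψ y e) x v (σ x) =
      A.nabla (fun y => Ψ y (σ y)) x v - Ψ x (A.nabla σ x v) := by
  obtain ⟨σ', hσ', h⟩ := exists_smoothSec_eq_extend V F (σ x)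
  have h3 : σ' x = σ x := by simp [h.self_of_nhds]
  have h4 := endCov_welldefined (Ψ := fun y => (Ψ y).restrictScalars ℝ) A.nabla hΨ v hσ' hσ h3
  simp only [LinearMap.coe_restrictScalars] at h4
  rw [← h4, dEnd, cov_congr A.nabla hσ' (h.mono fun z hz => hz.symm),
    cov_congr A.nabla (hΨ σ' hσ') (h.mono fun z hz => by rw [hz])]

open Classical in
/-- The covariant derivative of a smooth section of `End E`. -/
noncomputable def covEnd (Ψ : Π x, E x →ₗ[ℂ] E x) (x : X) :
    TangentSpace 𝓘(ℝ, V) x →ₗ[ℝ] E x →ₗ[ℂ] E x :=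
  if h : SmoothEnd V F Ψ then
    { toFun := fun v =>
        { toFun := A.dEnd (fun y e => Ψ y e) x v
          map_add' := fun e e' => by
            obtain ⟨σ, hσ, rfl⟩ := exists_smoothSec_apply_eq V F e
            obtain ⟨σ', hσ', rfl⟩ := exists_smoothSec_apply_eq V F e'
            have h1 := A.dEnd_apply h (SmoothSec.add hσ hσ') x v
            simp only [map_add, cov_add A.nabla hσ hσ', cov_add A.nabla (h σ hσ) (h σ' hσ')] at h1
            rw [h1, A.dEnd_apply h hσ, A.dEnd_apply h hσ']
            abel
          map_smul' := fun c e => by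
            obtain ⟨σ, hσ, rfl⟩ := exists_smoothSec_apply_eq V F e
            have h1 := A.dEnd_apply h (hσ.complex_smul c) x v
            simp only [map_smul, A.nabla_complex_smul c hσ, A.nabla_complex_smul c (h σ hσ)] at h1
            rw [h1, A.dEnd_apply h hσ, RingHom.id_apply, smul_sub] }
      map_add' := fun v v' => by
        ext e
        obtain ⟨σ, hσ, rfl⟩ := exists_smoothSec_apply_eq V F e
        simp only [LinearMap.coe_mk, AddHom.coe_mk, LinearMap.add_apply, A.dEnd_apply h hσ, map_add]
        abel
      map_smul' := fun c v => by
        ext e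
        obtain ⟨σ, hσ, rfl⟩ := exists_smoothSec_apply_eq V F e
        simp only [LinearMap.coe_mk, AddHom.coe_mk, LinearMap.smul_apply, A.dEnd_apply h hσ,
          map_smul, RingHom.id_apply, LinearMap.map_smul_of_tower, smul_sub] }
  -- Without smoothness the commutator need not be linear on the fibre, so the value is set to zero
  -- to obtain a total function with values in linear maps.
  else 0

theorem covEnd_eq_dEnd (hΨ : SmoothEnd V F Ψ) (x : X) (v : TangentSpace 𝓘(ℝ, V) x) (e : E x) :
    A.covEnd Ψ x v e = A.dEnd (fun y e => Ψ y e) x v e := by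
  rw [covEnd, dif_pos hΨ]
  rfl

theorem covEnd_apply (hΨ : SmoothEnd V F Ψ) {σ : Π x, E x} (hσ : SmoothSec F V σ) (x : X)
    (v : TangentSpace 𝓘(ℝ, V) x) :
    A.covEnd Ψ x v (σ x) = A.nabla (fun y => Ψ y (σ y)) x v - Ψ x (A.nabla σ x v) := by
  rw [A.covEnd_eq_dEnd hΨ, A.dEnd_apply hΨ hσ]

theorem covEnd_add (hΨ : SmoothEnd V F Ψ) (hΦ : SmoothEnd V F Φ) (x : X)
    (v : TangentSpace 𝓘(ℝ, V) x) :
    A.covEnd (fun y => Ψ y + Φ y) x v = A.covEnd Ψ x v + A.covEnd Φ x v := by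
  ext e
  obtain ⟨σ, hσ, rfl⟩ := exists_smoothSec_apply_eq V F e
  rw [A.covEnd_apply (hΨ.add hΦ) hσ]
  simp only [LinearMap.add_apply]
  rw [A.covEnd_apply hΨ hσ, A.covEnd_apply hΦ hσ, cov_add A.nabla (hΨ σ hσ) (hΦ σ hσ)]
  abel

theorem covEnd_smul {f : X → ℝ} (hf : SmoothFun V f) (hΨ : SmoothEnd V F Ψ) (x : X)
    (v : TangentSpace 𝓘(ℝ, V) x) :
    A.covEnd (fun y => f y • Ψ y) x v =
      f x • A.covEnd Ψ x v + mvfderiv 𝓘(ℝ, V) f x v • Ψ x := by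
  ext e
  obtain ⟨σ, hσ, rfl⟩ := exists_smoothSec_apply_eq V F e
  rw [A.covEnd_apply (SmoothEnd.smul hf hΨ) hσ]
  simp only [LinearMap.smul_apply, LinearMap.add_apply]
  rw [A.covEnd_apply hΨ hσ, cov_smul A.nabla hf (hΨ σ hσ)]
  module

theorem covEnd_const_smul (c : ℝ) (hΨ : SmoothEnd V F Ψ) (x : X) (v : TangentSpace 𝓘(ℝ, V) x) :
    A.covEnd (fun y => c • Ψ y) x v = c • A.covEnd Ψ x v := by
  rw [A.covEnd_smul (f := fun _ => c) contMDiff_const hΨ, mvfderiv_const_apply, zero_smul, add_zero]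

theorem covEnd_complex_smul_one (c : ℂ) (x : X) (v : TangentSpace 𝓘(ℝ, V) x) :
    A.covEnd (fun y => c • (1 : E y →ₗ[ℂ] E y)) x v = 0 := by
  ext e
  obtain ⟨σ, hσ, rfl⟩ := exists_smoothSec_apply_eq V F e
  rw [A.covEnd_apply (SmoothEnd.one.complex_smul c) hσ]
  simp only [LinearMap.smul_apply, Module.End.one_apply, LinearMap.zero_apply]
  rw [A.nabla_complex_smul c hσ, sub_self]

theorem covEnd_sub (hΨ : SmoothEnd V F Ψ) (hΦ : SmoothEnd V F Φ) (x : X)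
    (v : TangentSpace 𝓘(ℝ, V) x) :
    A.covEnd (fun y => Ψ y - Φ y) x v = A.covEnd Ψ x v - A.covEnd Φ x v := by
  have h := A.covEnd_add hΨ (hΦ.const_smul (-1)) x v
  rw [A.covEnd_const_smul _ hΦ] at h
  simpa [sub_eq_add_neg] using h

theorem covEnd_mul (hΨ : SmoothEnd V F Ψ) (hΦ : SmoothEnd V F Φ) (x : X)
    (v : TangentSpace 𝓘(ℝ, V) x) :
    A.covEnd (fun y => Ψ y * Φ y) x v = A.covEnd Ψ x v * Φ x + Ψ x * A.covEnd Φ x v := by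
  ext e
  obtain ⟨σ, hσ, rfl⟩ := exists_smoothSec_apply_eq V F e
  have h1 := A.covEnd_apply hΨ (hΦ σ hσ) x v
  rw [A.covEnd_apply (hΨ.mul hΦ) hσ]
  simp only [Module.End.mul_apply, LinearMap.add_apply]
  rw [h1, A.covEnd_apply hΦ hσ, map_sub]
  abel

theorem mvfderiv_retr (hΨ : SmoothEnd V F Ψ) (x : X) (v : TangentSpace 𝓘(ℝ, V) x) :
    mvfderiv 𝓘(ℝ, V) (fun y => retr (Ψ y)) x v = retr (A.covEnd Ψ x v) := by
  have h : (fun x => VortexFlow.retr (Ψ x)) =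
      fun x => 2⁻¹ * LinearMap.trace ℝ (E x) ((Ψ x).restrictScalars ℝ) := by
    ext x
    have := VectorBundle.finiteDimensional ℂ F E x
    exact retr_eq_real_trace _
  have := VectorBundle.finiteDimensional ℂ F E x
  rw [h, mvfderiv_const_mul_apply _ (SmoothFun.trace (Ψ := fun x => (Ψ x).restrictScalars ℝ) hΨ),
    retr_eq_real_trace]
  congr 1
  exact mvfderiv_trace (Ψ := fun x => (Ψ x).restrictScalars ℝ) A.nabla hΨ v
    ((A.covEnd Ψ x v).restrictScalars ℝ) fun σ hσ => A.covEnd_apply hΨ hσ x v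

end Connection

end EndSections

/-! ### Contractions under the complex structure. -/

section ComplexFrame

variable {T : Type*} [NormedAddCommGroup T] [InnerProductSpace ℝ T] {ι : Type*} [Fintype ι]
  {M : Type*} [AddCommGroup M] [Module ℝ M]

/-- An isometry carries an orthonormal basis to another one, and the contraction of a bilinear form
does not depend on the orthonormal basis. -/
theorem sum_apply_isometry (e : OrthonormalBasis ι ℝ T) {j : T →ₗ[ℝ] T}
    (hj : ∀ v w, inner ℝ (j v) (j w) = inner ℝ v w) (B : T →ₗ[ℝ] T →ₗ[ℝ] M) :
    ∑ k, B (j (e k)) (j (e k)) = ∑ k, B (e k) (e k) := by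
  classical
  have horth : Orthonormal ℝ (fun k => j (e k)) := by
    rw [orthonormal_iff_ite]
    intro k l
    rw [hj]
    exact orthonormal_iff_ite.1 e.orthonormal k l
  have : FiniteDimensional ℝ T := e.toBasis.finiteDimensional_of_finite
  let e' := OrthonormalBasis.mk horth (horth.linearIndependent.span_eq_top_of_card_eq_finrank'
    (Module.finrank_eq_card_basis e.toBasis).symm).ge
  have he' : ∀ k, e' k = j (e k) := fun k => by simp [e']
  have h := sum_orthonormal_eq_sum_gram e' e (fun k l => if k = l then 1 else 0)
    (fun v => by simp [e.sum_repr' v]) B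
  simpa [he'] using h

/-- Rotate the basis by j in the form B(·, j·) and use j² = -1. This is how J is moved between the
two slots of a contraction in the identities below. -/
theorem sum_apply_complexStructure (e : OrthonormalBasis ι ℝ T) {j : T →ₗ[ℝ] T}
    (hj : ∀ v w, inner ℝ (j v) (j w) = inner ℝ v w) (hjj : ∀ v, j (j v) = - v)
    (B : T →ₗ[ℝ] T →ₗ[ℝ] M) :
    ∑ k, B (j (e k)) (e k) = - ∑ k, B (e k) (j (e k)) := by
  have h := sum_apply_isometry e hj (B.compl₂ j)
  simp only [LinearMap.compl₂_apply, hjj, map_neg, Finset.sum_neg_distrib] at h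
  rw [← h, neg_neg]

end ComplexFrame

/-! ### Extensions that are parallel at a point and commute with J. -/

section NormalExtension

variable {V : Type*} [NormedAddCommGroup V] [NormedSpace ℂ V] [FiniteDimensional ℂ V]
  {X : Type*} [TopologicalSpace X] [T2Space X] [ChartedSpace V X] [IsManifold 𝓘(ℂ, V) ω X]
  [RiemannianBundle (fun x : X => TangentSpace 𝓘(ℝ, V) x)]
  [IsContMDiffRiemannianBundle 𝓘(ℝ, V) ∞ V (fun x : X => TangentSpace 𝓘(ℝ, V) x)]
  {D : CovariantDerivative 𝓘(ℝ, V) V (fun x : X => TangentSpace 𝓘(ℝ, V) x)}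

/-- The complex structure as a linear map. -/
noncomputable def jMap (x : X) : TangentSpace 𝓘(ℝ, V) x →ₗ[ℝ] TangentSpace 𝓘(ℝ, V) x :=
  (J (V := V) x).toLinearMap

theorem jMap_apply (x : X) (v : TangentSpace 𝓘(ℝ, V) x) : jMap x v = J x v := rfl

/-- A linear extension of the tangent vectors at `x` to smooth fields that are parallel at `x`. -/
structure IsNormalExtension
    (D : CovariantDerivative 𝓘(ℝ, V) V (fun x : X => TangentSpace 𝓘(ℝ, V) x)) (x : X)
    (N : TangentSpace 𝓘(ℝ, V) x →ₗ[ℝ] Π y : X, TangentSpace 𝓘(ℝ, V) y) : Prop where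
  smooth : ∀ v, SmoothSec V V (N v)
  apply_self : ∀ v, N v x = v
  cov_eq_zero : ∀ v, D (N v) x = 0
  map_J : ∀ v y, N (J x v) y = J y (N v y)

theorem exists_isNormalExtension (hD : IsKahlerConnection D) (x : X) :
    ∃ N, IsNormalExtension D x N := by
  obtain ⟨W, hW⟩ := exists_isNormalFrame D x
  let N₀ : TangentSpace 𝓘(ℝ, V) x →ₗ[ℝ] Π y : X, TangentSpace 𝓘(ℝ, V) y :=
    ∑ k, (innerₗ (TangentSpace 𝓘(ℝ, V) x) (frame x k)).smulRight (W k)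
  have h0 : ∀ v y, N₀ v y = ∑ k, inner ℝ (frame x k) v • W k y := fun v y => by
    simp [N₀, LinearMap.sum_apply, Finset.sum_apply]
  have hs : ∀ v, SmoothSec V V (N₀ v) := fun v => by
    rw [show N₀ v = fun y => ∑ k, inner ℝ (frame x k) v • W k y from funext (h0 v)]
    exact SmoothSec.sum _ fun k _ => (hW.smooth k).const_smul _
  have ha : ∀ v, N₀ v x = v := fun v => by
    rw [h0]
    simp only [hW.apply_self]
    exact (frame x).sum_repr' v
  have hc : ∀ v u, D (N₀ v) x u = 0 := fun v u => by
    rw [show N₀ v = fun y => ∑ k, inner ℝ (frame x k) v • W k y from funext (h0 v),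
      cov_sum D _ fun k _ => (hW.smooth k).const_smul _]
    refine Finset.sum_eq_zero fun k _ => ?_
    rw [cov_const_smul D _ (hW.smooth k), hW.cov_eq_zero]
    simp
  -- Averaging N₀ with -J N₀ J enforces commutation with J everywhere. The average is still parallel
  -- at `x` because J is parallel; this is where the Kähler condition enters.
  let N₁ : TangentSpace 𝓘(ℝ, V) x →ₗ[ℝ] Π y : X, TangentSpace 𝓘(ℝ, V) y :=
    LinearMap.pi fun y => (2⁻¹ : ℝ) • ((LinearMap.proj y).comp N₀ -
      (jMap y).comp ((LinearMap.proj y).comp (N₀.comp (jMap x))))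
  have h1 : ∀ v y, N₁ v y = (2⁻¹ : ℝ) • (N₀ v y - J y (N₀ (J x v) y)) := fun v y => rfl
  refine ⟨N₁, fun v => ?_, fun v => ?_, fun v => ?_, fun v y => ?_⟩
  · exact SmoothSec.const_smul _ (SmoothSec.sub (hs v) (hs _).J)
  · rw [h1, ha, ha, J_J, sub_neg_eq_add, ← two_smul ℝ v, smul_smul]
    norm_num
  · ext u
    rw [show N₁ v = fun y => (2⁻¹ : ℝ) • (N₀ v y - J y (N₀ (J x v) y)) from funext (h1 v),
      cov_const_smul D _ (SmoothSec.sub (hs v) (hs _).J), cov_sub D (hs v) (hs _).J,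
      hD.parallel _ (hs _), hc, hc]
    simp
  · rw [h1, h1, J_J, map_neg, map_smul, map_sub, J_J]
    simp only [Pi.neg_apply, map_neg]
    congr 1
    abel

theorem IsNormalExtension.isNormalFrame {x : X}
    {N : TangentSpace 𝓘(ℝ, V) x →ₗ[ℝ] Π y : X, TangentSpace 𝓘(ℝ, V) y}
    (hN : IsNormalExtension D x N) : IsNormalFrame D x (fun k => N (frame x k)) :=
  ⟨fun _ => hN.smooth _, fun _ => hN.apply_self _, fun _ => hN.cov_eq_zero _⟩

theorem IsNormalExtension.lie_eq_zero (hD : IsKahlerConnection D) {x : X}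
    {N : TangentSpace 𝓘(ℝ, V) x →ₗ[ℝ] Π y : X, TangentSpace 𝓘(ℝ, V) y}
    (hN : IsNormalExtension D x N) (v w : TangentSpace 𝓘(ℝ, V) x) : lie (N v) (N w) x = 0 := by
  rw [lie, hD.torsion _ _ (hN.smooth v) (hN.smooth w), hN.cov_eq_zero, hN.cov_eq_zero]
  simp

theorem IsNormalFrame.mvfderiv_contraction (hD : IsKahlerConnection D)
    {B : Π x : X, TangentSpace 𝓘(ℝ, V) x →ₗ[ℝ] TangentSpace 𝓘(ℝ, V) x →ₗ[ℝ] ℝ}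
    (hB : ∀ U W : Π x : X, TangentSpace 𝓘(ℝ, V) x, SmoothSec V V U → SmoothSec V V W →
      SmoothFun V (fun x => B x (U x) (W x))) {x : X}
    {W : Fin (Module.finrank ℝ (TangentSpace 𝓘(ℝ, V) x)) → Π y : X, TangentSpace 𝓘(ℝ, V) y}
    (hW : IsNormalFrame D x W) (v : TangentSpace 𝓘(ℝ, V) x) :
    mvfderiv 𝓘(ℝ, V) (fun y => ∑ k, B y (frame y k) (frame y k)) x v =
      ∑ k, mvfderiv 𝓘(ℝ, V) (fun y => B y (W k y) (W k y)) x v := by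
  obtain ⟨h, hh, hx, hd, he⟩ := hW.exists_gram_inv hD
  have hs : ∀ k l, SmoothFun V (fun y => h k l y * B y (W k y) (W l y)) := fun k l =>
    SmoothFun.mul (hh k l) (hB _ _ (hW.smooth k) (hW.smooth l))
  have h1 : ∀ᶠ y in 𝓝 x, ∑ k, B y (frame y k) (frame y k) =
      ∑ k, ∑ l, h k l y * B y (W k y) (W l y) := by
    filter_upwards [he] with y hy
    exact sum_orthonormal_eq_sum_gram (frame y) (fun k => W k y) (fun k l => h k l y) hy (B y)
  rw [mvfderiv_congr (V := V) h1,
    mvfderiv_sum_apply _ fun k _ => SmoothFun.sum _ fun l _ => hs k l]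
  refine Finset.sum_congr rfl fun k _ => ?_
  rw [mvfderiv_sum_apply _ fun l _ => hs k l]
  simp_rw [mvfderiv_mul_apply (hh k _) (hB _ _ (hW.smooth k) (hW.smooth _)), hx, hd]
  simp

end NormalExtension

/-! ### Contractions with values in End E. -/

section EndContraction

variable {V : Type*} [NormedAddCommGroup V] [NormedSpace ℂ V] [FiniteDimensional ℂ V]
  {X : Type*} [TopologicalSpace X] [T2Space X] [ChartedSpace V X] [IsManifold 𝓘(ℂ, V) ω X]
  [RiemannianBundle (fun x : X => TangentSpace 𝓘(ℝ, V) x)]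
  [IsContMDiffRiemannianBundle 𝓘(ℝ, V) ∞ V (fun x : X => TangentSpace 𝓘(ℝ, V) x)]
  {D : CovariantDerivative 𝓘(ℝ, V) V (fun x : X => TangentSpace 𝓘(ℝ, V) x)}
  {F : Type*} [NormedAddCommGroup F] [NormedSpace ℂ F] [FiniteDimensional ℂ F]
  {E : X → Type*} [TopologicalSpace (TotalSpace F E)]
  [∀ x, NormedAddCommGroup (E x)] [∀ x, InnerProductSpace ℂ (E x)]
  [FiberBundle F E] [VectorBundle ℝ F E] [VectorBundle ℂ F E]
  [ContMDiffVectorBundle ∞ F E 𝓘(ℝ, V)]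
  {B : Π x : X, TangentSpace 𝓘(ℝ, V) x →ₗ[ℝ] TangentSpace 𝓘(ℝ, V) x →ₗ[ℝ] E x →ₗ[ℂ] E x}

/-- Evaluation of endomorphisms at a vector. -/
noncomputable def evalEnd {W : Type*} [AddCommGroup W] [Module ℂ W] (e : W) :
    (W →ₗ[ℂ] W) →ₗ[ℝ] W where
  toFun a := a e
  map_add' _ _ := rfl
  map_smul' _ _ := rfl

theorem SmoothEnd.contraction (hD : IsKahlerConnection D)
    (hB : ∀ U W : Π x : X, TangentSpace 𝓘(ℝ, V) x, SmoothSec V V U → SmoothSec V V W →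
      SmoothEnd V F (fun x => B x (U x) (W x))) :
    SmoothEnd V F (fun x => ∑ k, B x (frame x k) (frame x k)) := by
  intro σ hσ
  have h := SmoothSec.contraction (B := fun x => (B x).compr₂ (evalEnd (σ x))) hD
    fun U W hU hW => hB U W hU hW σ hσ
  simp only [LinearMap.sum_apply]
  exact h

theorem IsNormalFrame.covEnd_contraction (hD : IsKahlerConnection D)
    (hB : ∀ U W : Π x : X, TangentSpace 𝓘(ℝ, V) x, SmoothSec V V U → SmoothSec V V W →
      SmoothEnd V F (fun x => B x (U x) (W x))) (A : Connection V F E) {x : X}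
    {W : Fin (Module.finrank ℝ (TangentSpace 𝓘(ℝ, V) x)) → Π y : X, TangentSpace 𝓘(ℝ, V) y}
    (hW : IsNormalFrame D x W) (v : TangentSpace 𝓘(ℝ, V) x) :
    A.covEnd (fun y => ∑ k, B y (frame y k) (frame y k)) x v =
      ∑ k, A.covEnd (fun y => B y (W k y) (W k y)) x v := by
  ext e
  obtain ⟨σ, hσ, rfl⟩ := exists_smoothSec_apply_eq V F e
  have h := IsNormalFrame.cov_contraction (B := fun x => (B x).compr₂ (evalEnd (σ x))) hD
    (fun U W hU hW => hB U W hU hW σ hσ) A.nabla hW v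
  rw [A.covEnd_apply (SmoothEnd.contraction hD hB) hσ]
  simp only [LinearMap.sum_apply]
  refine (congrArg₂ (· - ·) h rfl).trans ?_
  rw [← Finset.sum_sub_distrib]
  refine Finset.sum_congr rfl fun k _ => ?_
  rw [A.covEnd_apply (hB _ _ (hW.smooth k) (hW.smooth k)) hσ]
  simp only [hW.apply_self]
  rfl

end EndContraction

/-! ### One-forms, the Bianchi identity and the contraction ΛF. -/

section Bianchi

variable {V : Type*} [NormedAddCommGroup V] [NormedSpace ℂ V] [FiniteDimensional ℂ V]
  {X : Type*} [TopologicalSpace X] [T2Space X] [ChartedSpace V X] [IsManifold 𝓘(ℂ, V) ω X]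
  {F : Type*} [NormedAddCommGroup F] [NormedSpace ℂ F] [FiniteDimensional ℂ F]
  {E : X → Type*} [TopologicalSpace (TotalSpace F E)]
  [∀ x, NormedAddCommGroup (E x)] [∀ x, InnerProductSpace ℂ (E x)]
  [FiberBundle F E] [VectorBundle ℝ F E]

variable (V F E) in
/-- A smooth one-form with values in `End E`. -/
structure EndOneForm where
  toFun : Π x : X, TangentSpace 𝓘(ℝ, V) x →ₗ[ℝ] E x →ₗ[ℂ] E x
  smooth : ∀ W : Π x : X, TangentSpace 𝓘(ℝ, V) x, SmoothSec V V W →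
    SmoothEnd V F (fun x => toFun x (W x))

/-- The underlying one-form with values in `End E`. -/
noncomputable def SkewOneForm.toEndOneForm (a : SkewOneForm V F E) : EndOneForm V F E where
  toFun x :=
    { toFun := fun v => (a.toFun x v).toLinearMap
      map_add' := fun v w => by rw [map_add]; rfl
      map_smul' := fun c v => by rw [map_smul]; rfl }
  smooth W hW σ hσ := a.smooth W σ hW hσ

variable [VectorBundle ℂ F E] [ContMDiffVectorBundle ∞ F E 𝓘(ℝ, V)]

namespace Connection

variable (A : Connection V F E)

theorem smoothEnd_curvature {U W : Π x : X, TangentSpace 𝓘(ℝ, V) x} (hU : SmoothSec V V U)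
    (hW : SmoothSec V V W) : SmoothEnd V F (fun x => A.curvature x (U x) (W x)) :=
  fun _ hσ => A.smoothSec_curvature hU hW hσ

/-- The exterior derivative of an `End E`-valued one-form, evaluated on vector fields. -/
noncomputable def extOp (b : EndOneForm V F E) (U W : Π x : X, TangentSpace 𝓘(ℝ, V) x) (x : X) :
    E x →ₗ[ℂ] E x :=
  A.covEnd (fun y => b.toFun y (W y)) x (U x) - A.covEnd (fun y => b.toFun y (U y)) x (W x)
    - b.toFun x (lie U W x)

theorem extOp_swap (b : EndOneForm V F E) (U W : Π x : X, TangentSpace 𝓘(ℝ, V) x) (x : X) :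
    A.extOp b U W x = - A.extOp b W U x := by
  rw [extOp, extOp, lie_swap, map_neg]
  abel

theorem extOp_congr_left (b : EndOneForm V F E) {U U' W : Π x : X, TangentSpace 𝓘(ℝ, V) x}
    (hU : SmoothSec V V U) (hU' : SmoothSec V V U') {x : X} (h : U x = U' x) :
    A.extOp b U W x = A.extOp b U' W x := by
  refine eq_of_tensorial (V := V) (F := V) (fun U => A.extOp b U W x)
    (fun U U' hU hU' => ?_) (fun f U hf hU => ?_) hU hU' h
  · simp only [extOp, map_add, lie_add_left hU hU', A.covEnd_add (b.smooth U hU) (b.smooth U' hU')]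
    abel
  · simp only [extOp, map_smul, lie_smul_left hf hU, map_add, neg_smul, map_neg,
      A.covEnd_smul hf (b.smooth U hU)]
    module

theorem extOp_congr (b : EndOneForm V F E) {U U' W W' : Π x : X, TangentSpace 𝓘(ℝ, V) x}
    (hU : SmoothSec V V U) (hU' : SmoothSec V V U') (hW : SmoothSec V V W)
    (hW' : SmoothSec V V W') {x : X} (h1 : U x = U' x) (h2 : W x = W' x) :
    A.extOp b U W x = A.extOp b U' W' x := by
  rw [A.extOp_congr_left b hU hU' h1, extOp_swap, A.extOp_congr_left b hW hW' h2, ← extOp_swap]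

/-- The operator on the left is defined for arbitrary families of maps, such as those built from
pointwise extensions; only the germ at `x` matters, so the calculus of smooth sections applies to
it. -/
theorem dEnd_eq_covEnd {Ψ : Π x, E x →ₗ[ℂ] E x} (hΨ : SmoothEnd V F Ψ) {x : X}
    {Φ : Π x, E x → E x} (h : ∀ᶠ y in 𝓝 x, Φ y = fun e => Ψ y e) (v : TangentSpace 𝓘(ℝ, V) x)
    (e : E x) : A.dEnd Φ x v e = A.covEnd Ψ x v e := by
  rw [A.covEnd_eq_dEnd hΨ, dEnd, dEnd]
  obtain ⟨σ, hσ, hs⟩ := exists_smoothSec_eq_extend V F e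
  have h1 : ∀ {Φ : Π x, E x → E x}, (∀ᶠ y in 𝓝 x, Φ y = fun e => Ψ y e) →
      A.nabla (fun y => Φ y (FiberBundle.extend F e y)) x = A.nabla (fun y => Ψ y (σ y)) x :=
    fun h => cov_congr A.nabla (hΨ σ hσ) (by
      filter_upwards [h, hs] with y h1 h2
      rw [h1, h2])
  rw [h1 h, h.self_of_nhds, ← h1 (Filter.Eventually.of_forall fun y => rfl)]

theorem dOneForm_eq_extOp (a : SkewOneForm V F E) {U W : Π x : X, TangentSpace 𝓘(ℝ, V) x}
    (hU : SmoothSec V V U) (hW : SmoothSec V V W) (x : X) (e : E x) :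
    A.dOneForm a x (U x) (W x) e = A.extOp a.toEndOneForm U W x e := by
  obtain ⟨U', hU', heU⟩ := exists_smoothSec_eq_extend V V (U x)
  obtain ⟨W', hW', heW⟩ := exists_smoothSec_eq_extend V V (W x)
  have h1 : U' x = U x := by simp [heU.self_of_nhds]
  have h2 : W' x = W x := by simp [heW.self_of_nhds]
  rw [← A.extOp_congr a.toEndOneForm hU' hU hW' hW h1 h2]
  have hl : lie (FiberBundle.extend V (U x)) (FiberBundle.extend V (W x)) x = lie U' W' x :=
    Filter.EventuallyEq.mlieBracket_vectorField_eq (heU.mono fun y hy => hy.symm)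
      (heW.mono fun y hy => hy.symm)
  simp only [dOneForm, extOp]
  rw [A.dEnd_eq_covEnd (a.toEndOneForm.smooth W' hW') (heW.mono fun y hy => by rw [hy]; rfl),
    A.dEnd_eq_covEnd (a.toEndOneForm.smooth U' hU') (heU.mono fun y hy => by rw [hy]; rfl),
    ← hl, h1, h2]
  rfl

variable [RiemannianBundle (fun x : X => TangentSpace 𝓘(ℝ, V) x)]
  [IsContMDiffRiemannianBundle 𝓘(ℝ, V) ∞ V (fun x : X => TangentSpace 𝓘(ℝ, V) x)]
  {D : CovariantDerivative 𝓘(ℝ, V) V (fun x : X => TangentSpace 𝓘(ℝ, V) x)} {x : X}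
  {N : TangentSpace 𝓘(ℝ, V) x →ₗ[ℝ] Π y : X, TangentSpace 𝓘(ℝ, V) y}

/-- The covariant derivative of an `End E`-valued one-form: `A.covOne b hN u v = (∇_u b)(v)`. -/
noncomputable def covOne (b : EndOneForm V F E) (hN : IsNormalExtension D x N) :
    TangentSpace 𝓘(ℝ, V) x →ₗ[ℝ] TangentSpace 𝓘(ℝ, V) x →ₗ[ℝ] E x →ₗ[ℂ] E x :=
  LinearMap.mk₂ ℝ (fun u v => A.covEnd (fun y => b.toFun y (N v y)) x u)
    (fun u u' v => map_add _ _ _) (fun c u v => map_smul _ _ _)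
    (fun u v v' => by
      simp only [map_add, Pi.add_apply]
      exact A.covEnd_add (b.smooth _ (hN.smooth v)) (b.smooth _ (hN.smooth v')) x u)
    (fun c u v => by
      simp only [map_smul, Pi.smul_apply]
      exact A.covEnd_const_smul c (b.smooth _ (hN.smooth v)) x u)

theorem covOne_apply (b : EndOneForm V F E) (hN : IsNormalExtension D x N)
    (u v : TangentSpace 𝓘(ℝ, V) x) :
    A.covOne b hN u v = A.covEnd (fun y => b.toFun y (N v y)) x u := rfl

theorem extOp_eq_covOne (hD : IsKahlerConnection D) (b : EndOneForm V F E)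
    (hN : IsNormalExtension D x N) (u v : TangentSpace 𝓘(ℝ, V) x) :
    A.extOp b (N u) (N v) x = A.covOne b hN u v - A.covOne b hN v u := by
  rw [extOp, hN.lie_eq_zero hD, map_zero, sub_zero, hN.apply_self, hN.apply_self]
  rfl

theorem dOneForm_eq_covOne (hD : IsKahlerConnection D) (a : SkewOneForm V F E)
    (hN : IsNormalExtension D x N) (u v : TangentSpace 𝓘(ℝ, V) x) (e : E x) :
    A.dOneForm a x u v e =
      (A.covOne a.toEndOneForm hN u v - A.covOne a.toEndOneForm hN v u) e := by
  rw [← A.extOp_eq_covOne hD, ← A.dOneForm_eq_extOp a (hN.smooth u) (hN.smooth v),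
    hN.apply_self, hN.apply_self]

/-- The covariant derivative of the curvature: `A.covCurv hN v w u = (∇_u F)(v, w)`. -/
noncomputable def covCurv (hN : IsNormalExtension D x N) :
    TangentSpace 𝓘(ℝ, V) x →ₗ[ℝ] TangentSpace 𝓘(ℝ, V) x →ₗ[ℝ] TangentSpace 𝓘(ℝ, V) x →ₗ[ℝ]
      E x →ₗ[ℂ] E x :=
  LinearMap.mk₂ ℝ (fun v w => A.covEnd (fun y => A.curvature y (N v y) (N w y)) x)
    (fun v v' w => by
      ext1 u
      simp only [map_add, Pi.add_apply, LinearMap.add_apply]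
      exact A.covEnd_add (A.smoothEnd_curvature (hN.smooth v) (hN.smooth w))
        (A.smoothEnd_curvature (hN.smooth v') (hN.smooth w)) x u)
    (fun c v w => by
      ext1 u
      simp only [map_smul, Pi.smul_apply, LinearMap.smul_apply]
      exact A.covEnd_const_smul c (A.smoothEnd_curvature (hN.smooth v) (hN.smooth w)) x u)
    (fun v w w' => by
      ext1 u
      simp only [map_add, Pi.add_apply, LinearMap.add_apply]
      exact A.covEnd_add (A.smoothEnd_curvature (hN.smooth v) (hN.smooth w))
        (A.smoothEnd_curvature (hN.smooth v) (hN.smooth w')) x u)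
    (fun c v w => by
      ext1 u
      simp only [map_smul, Pi.smul_apply, LinearMap.smul_apply]
      exact A.covEnd_const_smul c (A.smoothEnd_curvature (hN.smooth v) (hN.smooth w)) x u)

theorem covCurv_apply (hN : IsNormalExtension D x N) (u v w : TangentSpace 𝓘(ℝ, V) x) :
    A.covCurv hN v w u = A.covEnd (fun y => A.curvature y (N v y) (N w y)) x u := rfl

theorem covCurv_swap (hN : IsNormalExtension D x N) (u v w : TangentSpace 𝓘(ℝ, V) x) :
    A.covCurv hN v w u = - A.covCurv hN w v u := by
  have h : (fun y => A.curvature y (N v y) (N w y)) =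
      fun y => (-1 : ℝ) • A.curvature y (N w y) (N v y) := by
    ext1 y
    rw [A.curvature_swap, neg_one_smul]
  rw [covCurv_apply, covCurv_apply, h,
    A.covEnd_const_smul _ (A.smoothEnd_curvature (hN.smooth w) (hN.smooth v)), neg_one_smul]

/-- By tensoriality the curvature vanishes when one field vanishes at the point, and of its three
terms only two survive. It serves in the Bianchi identity, with Y the bracket of two normal
extensions. -/
theorem nabla_nabla_of_eq_zero {U Y : Π x : X, TangentSpace 𝓘(ℝ, V) x} {σ : Π x, E x}
    (hU : SmoothSec V V U) (hY : SmoothSec V V Y) (hσ : SmoothSec F V σ) (hY0 : Y x = 0) :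
    A.nabla (fun y => A.nabla σ y (Y y)) x (U x) = A.nabla σ x (lie U Y x) := by
  have h := A.curvature_apply_field hU hY hσ x
  rw [hY0, map_zero, curvOp, hY0, map_zero, sub_zero] at h
  exact (sub_eq_zero.1 h.symm)

theorem lie_cyclic {U W Y : Π x : X, TangentSpace 𝓘(ℝ, V) x}
    (hU : SmoothSec V V U) (hW : SmoothSec V V W) (hY : SmoothSec V V Y) (x : X) :
    lie U (lie W Y) x + lie W (lie Y U) x + lie Y (lie U W) x = 0 := by
  have h : lie U Y = fun y => (-1 : ℝ) • lie Y U y := by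
    ext1 y
    rw [lie_swap, neg_one_smul]
  rw [lie_jacobi hU hW hY, lie_swap (lie U W) Y, h,
    lie_smul_right (f := fun _ => (-1 : ℝ)) contMDiff_const (hY.lie hU), mvfderiv_const_apply]
  module

/-- The second Bianchi identity. -/
theorem bianchi (hD : IsKahlerConnection D) (hN : IsNormalExtension D x N)
    (u v w : TangentSpace 𝓘(ℝ, V) x) :
    A.covCurv hN v w u + A.covCurv hN w u v + A.covCurv hN u v w = 0 := by
  ext e
  obtain ⟨σ, hσ, rfl⟩ := exists_smoothSec_apply_eq V F e
  -- Each derivative of the curvature is written through third derivatives of σ and one double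
  -- bracket. Under the cyclic sum the third derivatives cancel in pairs and the double brackets
  -- vanish by Jacobi.
  have key : ∀ u v w : TangentSpace 𝓘(ℝ, V) x, A.covCurv hN v w u (σ x) =
      A.nabla (fun y => A.nabla (fun z => A.nabla σ z (N w z)) y (N v y)) x u -
      A.nabla (fun y => A.nabla (fun z => A.nabla σ z (N v z)) y (N w y)) x u -
      A.nabla σ x (lie (N u) (lie (N v) (N w)) x) -
      (A.nabla (fun y => A.nabla (fun z => A.nabla σ z (N u z)) y (N w y)) x v -
      A.nabla (fun y => A.nabla (fun z => A.nabla σ z (N u z)) y (N v y)) x w) := by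
    intro u v w
    have hu := hN.smooth u
    have hv := hN.smooth v
    have hw := hN.smooth w
    have h1 : (fun y => A.curvature y (N v y) (N w y) (σ y)) = A.curvOp (N v) (N w) σ :=
      funext fun y => A.curvature_apply_field hv hw hσ y
    have h2 := A.curvature_apply_field hv hw (A.smoothSec_nabla hσ hu) x
    have h3 := A.nabla_nabla_of_eq_zero hu (hv.lie hw) hσ (hN.lie_eq_zero hD v w)
    rw [curvOp, hN.lie_eq_zero hD, map_zero, sub_zero] at h2
    simp only [hN.apply_self] at h2 h3
    rw [covCurv_apply, A.covEnd_apply (A.smoothEnd_curvature hv hw) hσ, h1]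
    simp only [hN.apply_self]
    rw [h2]
    congr 1
    unfold curvOp
    rw [← h3, cov_sub A.nabla (SmoothSec.sub (A.smoothSec_nabla (A.smoothSec_nabla hσ hw) hv)
      (A.smoothSec_nabla (A.smoothSec_nabla hσ hv) hw)) (A.smoothSec_nabla hσ (hv.lie hw)),
      cov_sub A.nabla (A.smoothSec_nabla (A.smoothSec_nabla hσ hw) hv)
      (A.smoothSec_nabla (A.smoothSec_nabla hσ hv) hw)]
  have hl := congrArg (A.nabla σ x) (lie_cyclic (hN.smooth u) (hN.smooth v) (hN.smooth w) x)
  simp only [map_add, map_zero] at hl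
  simp only [LinearMap.add_apply, LinearMap.zero_apply, key]
  rw [← neg_eq_zero, ← hl]
  abel

variable (x) in
/-- The contraction `Λ F_A` as an endomorphism. -/
noncomputable def lamCurv : E x →ₗ[ℂ] E x :=
  (2⁻¹ : ℝ) • ∑ k, A.curvature x (frame x k) (J x (frame x k))

theorem lamCurv_apply (x : X) (e : E x) : A.lamCurv x e = lambdaCurv A x e := by
  rw [lamCurv, lambdaCurv, LinearMap.smul_apply, LinearMap.sum_apply, complex_smul_eq]
  simp [curvature_apply]

theorem smoothEnd_lamCurv (hD : IsKahlerConnection D) : SmoothEnd V F (fun x => A.lamCurv x) :=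
  (SmoothEnd.contraction (B := fun x => (A.curvature x).compl₂ (jMap x)) hD
    fun _ _ hU hW => A.smoothEnd_curvature hU hW.J).const_smul _

theorem covEnd_lamCurv (hD : IsKahlerConnection D) (hN : IsNormalExtension D x N)
    (v : TangentSpace 𝓘(ℝ, V) x) :
    A.covEnd (fun x => A.lamCurv x) x v =
      (2⁻¹ : ℝ) • ∑ k, A.covCurv hN (frame x k) (J x (frame x k)) v := by
  have hB : ∀ U W : Π x : X, TangentSpace 𝓘(ℝ, V) x, SmoothSec V V U → SmoothSec V V W →
      SmoothEnd V F (fun x => (A.curvature x).compl₂ (jMap x) (U x) (W x)) :=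
    fun _ _ hU hW => A.smoothEnd_curvature hU hW.J
  have h := IsNormalFrame.covEnd_contraction hD hB A hN.isNormalFrame v
  refine (A.covEnd_const_smul (2⁻¹) (SmoothEnd.contraction hD hB) x v).trans ?_
  rw [h]
  congr 1
  refine Finset.sum_congr rfl fun k _ => ?_
  rw [covCurv_apply]
  simp only [hN.map_J]
  rfl

/-- The divergence of the curvature, in complex form, is the derivative of `Λ F_A`. -/
theorem sum_covCurv (hX : IsKahler V X) (hD : IsKahlerConnection D) (hN : IsNormalExtension D x N)
    (w : TangentSpace 𝓘(ℝ, V) x) :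
    ∑ k, A.covCurv hN (J x (frame x k)) w (frame x k) =
      - A.covEnd (fun x => A.lamCurv x) x w := by
  have h1 := Finset.sum_congr rfl fun k (_ : k ∈ Finset.univ) =>
    A.bianchi hD hN (frame x k) (J x (frame x k)) w
  have h2 := sum_apply_complexStructure (frame x) (j := jMap x) (hX.hermitian x) (J_J x)
    (A.covCurv hN w)
  simp only [Finset.sum_add_distrib, Finset.sum_const_zero] at h1
  -- In the Bianchi identity for e_k, J e_k, w summed over k, the first two terms agree by
  -- antisymmetry and J-rotation, and the third is twice the derivative of ΛF.
  have h3 : ∑ k, A.covCurv hN w (frame x k) (J x (frame x k)) =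
      ∑ k, A.covCurv hN (J x (frame x k)) w (frame x k) := by
    have h4 : ∀ k, A.covCurv hN (J x (frame x k)) w (frame x k) =
        - A.covCurv hN w (J x (frame x k)) (frame x k) := fun k => A.covCurv_swap hN _ _ _
    simp only [h4, Finset.sum_neg_distrib]
    simp only [jMap_apply] at h2
    rw [h2, neg_neg]
  rw [h3] at h1
  rw [A.covEnd_lamCurv hD hN, eq_neg_of_add_eq_zero_right h1]
  module

end Connection

end Bianchi

/-! ### Skew-Hermitian endomorphisms and trace forms. -/

section Skew

variable {W : Type*} [NormedAddCommGroup W] [InnerProductSpace ℂ W]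

/-- Skew-Hermitian endomorphisms. -/
def IsSkew (a : W →ₗ[ℂ] W) : Prop := ∀ e e' : W, inner ℂ (a e) e' = - inner ℂ e (a e')

/-- Replacing e' by i e' turns the real identity into the one for imaginary parts. -/
theorem isSkew_of_re {a : W →ₗ[ℂ] W}
    (h : ∀ e e' : W, (inner ℂ (a e) e' : ℂ).re + (inner ℂ e (a e') : ℂ).re = 0) : IsSkew a := by
  intro e e'
  have h1 := h e e'
  have h2 := h e (Complex.I • e')
  rw [map_smul, inner_smul_right, inner_smul_right] at h2
  apply Complex.ext
  · rw [Complex.neg_re]; linarith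
  · simp at h2
    rw [Complex.neg_im]; linarith

theorem IsSkew.sum {ι : Type*} (s : Finset ι) {a : ι → W →ₗ[ℂ] W} (h : ∀ i ∈ s, IsSkew (a i)) :
    IsSkew (∑ i ∈ s, a i) := by
  intro e e'
  rw [LinearMap.sum_apply, LinearMap.sum_apply, sum_inner, inner_sum, ← Finset.sum_neg_distrib]
  exact Finset.sum_congr rfl fun i hi => h i hi e e'

theorem IsSkew.smul {a : W →ₗ[ℂ] W} (h : IsSkew a) (c : ℝ) : IsSkew (c • a) := by
  intro e e'
  rw [LinearMap.smul_apply, LinearMap.smul_apply, ← Complex.coe_smul, ← Complex.coe_smul,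
    inner_smul_left, inner_smul_right, h e e', Complex.conj_ofReal, mul_neg]

theorem re_inner_self (w : W) : (inner ℂ w w : ℂ).re = ‖w‖ ^ 2 :=
  inner_self_eq_norm_sq (𝕜 := ℂ) w

variable [FiniteDimensional ℂ W]

theorem endInner_comm (a b : W → W) : endInner a b = endInner b a := by
  rw [endInner, endInner]
  exact Finset.sum_congr rfl fun k _ => inner_re_symm (𝕜 := ℂ) _ _

theorem endInner_self (a : W → W) : endInner a a = ∑ k, ‖a (stdOrthonormalBasis ℂ W k)‖ ^ 2 := by
  simp only [endInner, re_inner_self]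

theorem endInner_self_nonneg (a : W → W) : 0 ≤ endInner a a := by
  rw [endInner_self]
  positivity

theorem eq_zero_of_endInner_self {a : W →ₗ[ℂ] W} (h : endInner a a = 0) : a = 0 := by
  rw [endInner_self, Finset.sum_eq_zero_iff_of_nonneg fun _ _ => by positivity] at h
  refine (stdOrthonormalBasis ℂ W).toBasis.ext fun l => ?_
  rw [OrthonormalBasis.coe_toBasis]
  exact norm_eq_zero.1 (pow_eq_zero_iff two_ne_zero |>.1 (h l (Finset.mem_univ l)))

/-- For skew b the adjoint is -b. Norms thereby become traces of products, which can be
differentiated and permuted cyclically. -/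
theorem endInner_eq_neg_retr (a b : W →ₗ[ℂ] W) (hb : IsSkew b) :
    endInner a b = - retr (a * b) := by
  rw [retr_mul_comm, retr_apply, LinearMap.trace_eq_sum_inner _ (stdOrthonormalBasis ℂ W),
    Complex.re_sum, ← Finset.sum_neg_distrib, endInner]
  refine Finset.sum_congr rfl fun k _ => ?_
  rw [hb, Complex.neg_re]
  rfl

theorem endInner_eq_neg_retr' (a b : W →ₗ[ℂ] W) (ha : IsSkew a) :
    endInner a b = - retr (a * b) := by
  rw [endInner_comm, endInner_eq_neg_retr b a ha, retr_mul_comm]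

theorem endTrace_eq_trace (a : W →ₗ[ℂ] W) : endTrace a = LinearMap.trace ℂ W a := by
  rw [LinearMap.trace_eq_sum_inner _ (stdOrthonormalBasis ℂ W), endTrace]

end Skew

/-! ### Consequences of unitarity. -/

section Unitary

variable {V : Type*} [NormedAddCommGroup V] [NormedSpace ℂ V] [FiniteDimensional ℂ V]
  {X : Type*} [TopologicalSpace X] [T2Space X] [ChartedSpace V X] [IsManifold 𝓘(ℂ, V) ω X]
  {F : Type*} [NormedAddCommGroup F] [NormedSpace ℂ F] [FiniteDimensional ℂ F]
  {E : X → Type*} [TopologicalSpace (TotalSpace F E)]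
  [∀ x, NormedAddCommGroup (E x)] [∀ x, InnerProductSpace ℂ (E x)]
  [FiberBundle F E] [VectorBundle ℝ F E] [VectorBundle ℂ F E]
  [ContMDiffVectorBundle ∞ F E 𝓘(ℝ, V)] {σ σ' : Π x, E x}

theorem smoothFun_re_inner (hE : IsSmoothHermitian V F E) (hσ : SmoothSec F V σ)
    (hσ' : SmoothSec F V σ') : SmoothFun V (fun x => (inner ℂ (σ x) (σ' x) : ℂ).re) := by
  let _ (x : X) : InnerProductSpace ℝ (E x) := InnerProductSpace.complexToReal
  have : IsContMDiffRiemannianBundle 𝓘(ℝ, V) ∞ F E := hE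
  exact ContMDiff.inner_bundle (F := F) hσ hσ'

theorem contMDiff_inner (hE : IsSmoothHermitian V F E) (hσ : SmoothSec F V σ)
    (hσ' : SmoothSec F V σ') :
    ContMDiff 𝓘(ℝ, V) 𝓘(ℝ, ℂ) ∞ (fun x => (inner ℂ (σ x) (σ' x) : ℂ)) := by
  have h1 := smoothFun_re_inner hE hσ hσ'
  have h2 := smoothFun_re_inner hE hσ.I_smul hσ'
  have h3 : ∀ c : ℂ, ContMDiff 𝓘(ℝ, ℝ) 𝓘(ℝ, ℂ) ∞ (fun r : ℝ => (r : ℂ) * c) := fun c =>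
    (Complex.ofRealCLM.contDiff.mul contDiff_const).contMDiff
  have h4 : (fun x => (inner ℂ (σ x) (σ' x) : ℂ)) = fun x =>
      ((inner ℂ (σ x) (σ' x) : ℂ).re : ℂ) * 1 +
        ((inner ℂ (Complex.I • σ x) (σ' x) : ℂ).re : ℂ) * Complex.I := by
    ext1 x
    rw [inner_smul_left]
    apply Complex.ext <;> simp
  rw [h4]
  exact ((h3 1).comp h1).add ((h3 Complex.I).comp h2)

namespace Connection

theorem nabla_J_of_dbar (A : Connection V F E) {φ : Π x, E x} (h : ∀ x v, A.dbar φ x v = 0) (x : X)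
    (v : TangentSpace 𝓘(ℝ, V) x) : A.nabla φ x (J x v) = Complex.I • A.nabla φ x v := by
  have h1 := h x v
  rw [dbar, smul_eq_zero, or_iff_right (by norm_num)] at h1
  rw [eq_neg_of_add_eq_zero_left h1, smul_neg, smul_smul, Complex.I_mul_I, neg_one_smul, neg_neg]

end Connection

namespace Connection.IsUnitary

variable {A : Connection V F E}

theorem mvfderiv_re_inner (hE : IsSmoothHermitian V F E) (hA : A.IsUnitary)
    (hσ : SmoothSec F V σ) (hσ' : SmoothSec F V σ') (x : X) (v : TangentSpace 𝓘(ℝ, V) x) :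
    mvfderiv 𝓘(ℝ, V) (fun y => (inner ℂ (σ y) (σ' y) : ℂ).re) x v =
      (inner ℂ (A.nabla σ x v) (σ' x) : ℂ).re + (inner ℂ (σ x) (A.nabla σ' x v) : ℂ).re := by
  have h1 := hA σ σ' x v (hσ.mdifferentiableAt x) (hσ'.mdifferentiableAt x)
  have h2 : MDifferentiableAt 𝓘(ℝ, V) 𝓘(ℝ, ℂ) (fun x => (inner ℂ (σ x) (σ' x) : ℂ)) x :=
    (contMDiff_inner hE hσ hσ').mdifferentiableAt (by simp)
  have h3 : HasMFDerivAt 𝓘(ℝ, ℂ) 𝓘(ℝ, ℝ) (Complex.reCLM : ℂ → ℝ) (inner ℂ (σ x) (σ' x) : ℂ)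
      Complex.reCLM := Complex.reCLM.hasFDerivAt.hasMFDerivAt
  have h4 := (h3.comp x h2.hasMFDerivAt).mfderiv
  rw [← Complex.add_re, ← h1]
  exact congrArg (fun f => f v) h4

/-- Apply the commutator formula for derivatives to the function Re⟪σ, σ'⟫: the mixed terms with one
derivative on each factor cancel, and what remains is skewness in real part. -/
theorem isSkew_curvature (hE : IsSmoothHermitian V F E) (hA : A.IsUnitary) (x : X)
    (u w : TangentSpace 𝓘(ℝ, V) x) : IsSkew (A.curvature x u w) := by
  refine isSkew_of_re fun e e' => ?_
  obtain ⟨U, hU, rfl⟩ := exists_smoothSec_apply_eq V V u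
  obtain ⟨W, hW, rfl⟩ := exists_smoothSec_apply_eq V V w
  obtain ⟨σ, hσ, rfl⟩ := exists_smoothSec_apply_eq V F e
  obtain ⟨σ', hσ', rfl⟩ := exists_smoothSec_apply_eq V F e'
  have hf := smoothFun_re_inner hE hσ hσ'
  have h1 := mvfderiv_lie hf hU hW x
  have h2 : ∀ {U W : Π x : X, TangentSpace 𝓘(ℝ, V) x}, SmoothSec V V U → SmoothSec V V W →
      mvfderiv 𝓘(ℝ, V) (fun y => mvfderiv 𝓘(ℝ, V)
        (fun z => (inner ℂ (σ z) (σ' z) : ℂ).re) y (W y)) x (U x) =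
      (inner ℂ (A.nabla (fun y => A.nabla σ y (W y)) x (U x)) (σ' x) : ℂ).re +
      (inner ℂ (A.nabla σ x (W x)) (A.nabla σ' x (U x)) : ℂ).re +
      ((inner ℂ (A.nabla σ x (U x)) (A.nabla σ' x (W x)) : ℂ).re +
      (inner ℂ (σ x) (A.nabla (fun y => A.nabla σ' y (W y)) x (U x)) : ℂ).re) := by
    intro U W hU hW
    simp only [mvfderiv_re_inner hE hA hσ hσ']
    rw [mvfderiv_add_apply (smoothFun_re_inner hE (A.smoothSec_nabla hσ hW) hσ')
      (smoothFun_re_inner hE hσ (A.smoothSec_nabla hσ' hW)),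
      mvfderiv_re_inner hE hA (A.smoothSec_nabla hσ hW) hσ',
      mvfderiv_re_inner hE hA hσ (A.smoothSec_nabla hσ' hW)]
  rw [h2 hU hW, h2 hW hU, mvfderiv_re_inner hE hA hσ hσ'] at h1
  rw [A.curvature_apply_field hU hW hσ, A.curvature_apply_field hU hW hσ', curvOp, curvOp]
  simp only [inner_sub_left, inner_sub_right, Complex.sub_re]
  linarith

/-- Differentiate Re⟪Ψσ, σ'⟫ = -Re⟪σ, Ψσ'⟫; the terms with ∇σ and ∇σ' cancel by skewness of Ψ
itself. -/
theorem isSkew_covEnd (hE : IsSmoothHermitian V F E) (hA : A.IsUnitary)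
    {Ψ : Π x, E x →ₗ[ℂ] E x} (hΨ : SmoothEnd V F Ψ) (hs : ∀ x, IsSkew (Ψ x)) (x : X)
    (v : TangentSpace 𝓘(ℝ, V) x) : IsSkew (A.covEnd Ψ x v) := by
  refine isSkew_of_re fun e e' => ?_
  obtain ⟨σ, hσ, rfl⟩ := exists_smoothSec_apply_eq V F e
  obtain ⟨σ', hσ', rfl⟩ := exists_smoothSec_apply_eq V F e'
  have h1 := mvfderiv_re_inner hE hA (hΨ σ hσ) hσ' x v
  have h2 := mvfderiv_re_inner hE hA hσ (hΨ σ' hσ') x v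
  have h3 : (fun y => (inner ℂ (Ψ y (σ y)) (σ' y) : ℂ).re) =
      fun y => (-1 : ℝ) * (inner ℂ (σ y) (Ψ y (σ' y)) : ℂ).re := by
    ext1 y
    rw [hs, Complex.neg_re, neg_one_mul]
  rw [h3, mvfderiv_const_mul_apply _ (smoothFun_re_inner hE hσ (hΨ σ' hσ')), h2] at h1
  rw [A.covEnd_apply hΨ hσ, A.covEnd_apply hΨ hσ']
  simp only [inner_sub_left, inner_sub_right, Complex.sub_re, hs x (A.nabla σ x v),
    ← neg_eq_iff_eq_neg.2 (hs x (σ x) (A.nabla σ' x v)), Complex.neg_re]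
  linarith

end Connection.IsUnitary

theorem SmoothEnd.covEnd (A : Connection V F E) {Ψ : Π x, E x →ₗ[ℂ] E x} (hΨ : SmoothEnd V F Ψ)
    {W : Π x : X, TangentSpace 𝓘(ℝ, V) x} (hW : SmoothSec V V W) :
    SmoothEnd V F (fun x => A.covEnd Ψ x (W x)) := by
  intro σ hσ
  simp only [A.covEnd_apply hΨ hσ]
  exact SmoothSec.sub (A.smoothSec_nabla (hΨ σ hσ) hW) (hΨ _ (A.smoothSec_nabla hσ hW))

end Unitary

/-! ### Integration by parts for forms and sections. -/

section IntegralIdentities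

variable {V : Type*} [NormedAddCommGroup V] [NormedSpace ℂ V] [FiniteDimensional ℂ V]
  [MeasurableSpace V] [BorelSpace V]
  {X : Type*} [TopologicalSpace X] [T2Space X] [CompactSpace X] [ChartedSpace V X]
  [IsManifold 𝓘(ℂ, V) ω X]
  [RiemannianBundle (fun x : X => TangentSpace 𝓘(ℝ, V) x)]
  [IsContMDiffRiemannianBundle 𝓘(ℝ, V) ∞ V (fun x : X => TangentSpace 𝓘(ℝ, V) x)]
  {F : Type*} [NormedAddCommGroup F] [NormedSpace ℂ F] [FiniteDimensional ℂ F]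
  {E : X → Type*} [TopologicalSpace (TotalSpace F E)]
  [∀ x, NormedAddCommGroup (E x)] [∀ x, InnerProductSpace ℂ (E x)]
  [FiberBundle F E] [VectorBundle ℝ F E] [VectorBundle ℂ F E]
  [ContMDiffVectorBundle ∞ F E 𝓘(ℝ, V)]
  {D : CovariantDerivative 𝓘(ℝ, V) V (fun x : X => TangentSpace 𝓘(ℝ, V) x)}
  {N : Π x : X, TangentSpace 𝓘(ℝ, V) x →ₗ[ℝ] Π y : X, TangentSpace 𝓘(ℝ, V) y}

namespace Connection

variable (A : Connection V F E)

/-- The integrand is the codifferential of w ↦ Re tr(b(Jw) Ψ). It is used with Ψ = ΛF for the second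
Chern number and with Ψ = i for the first. -/
theorem integral_retr_covOne_mul (hD : IsKahlerConnection D)
    (hN : ∀ x, IsNormalExtension D x (N x)) (b : EndOneForm V F E) {Ψ : Π x, E x →ₗ[ℂ] E x}
    (hΨ : SmoothEnd V F Ψ) {δ : X → ℝ}
    (hδ : ∀ x, δ x = ∑ k, (retr (A.covOne b (hN x) (frame x k) (J x (frame x k)) * Ψ x) +
      retr (b.toFun x (J x (frame x k)) * A.covEnd Ψ x (frame x k)))) :
    SmoothFun V δ ∧ integral V δ = 0 := by
  refine smoothFun_and_integral_codifferential hD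
    (θ := fun x => retr ∘ₗ LinearMap.mulRight ℝ (Ψ x : Module.End ℂ (E x)) ∘ₗ b.toFun x ∘ₗ jMap x)
    (fun W hW => ((b.smooth _ hW.J).mul hΨ).retr)
    fun x => ⟨_, (hN x).isNormalFrame, ?_⟩
  rw [hδ]
  refine Finset.sum_congr rfl fun k _ => ?_
  have hb := b.smooth _ ((hN x).smooth (J x (frame x k)))
  have h1 : (fun y => (retr ∘ₗ LinearMap.mulRight ℝ (Ψ y : Module.End ℂ (E y)) ∘ₗ b.toFun y ∘ₗ
      jMap y) (N x (frame x k) y)) =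
      fun y => retr (b.toFun y (N x (J x (frame x k)) y) * Ψ y) := by
    ext1 y
    rw [(hN x).map_J]
    rfl
  rw [h1, A.mvfderiv_retr (hb.mul hΨ), A.covEnd_mul hb hΨ, map_add, (hN x).apply_self]
  rfl

/-- The integrand is the codifferential of w ↦ Σ_l Re tr(b(e_l) F(Jw, J e_l)), with the divergence
of F rewritten as the derivative of ΛF by the Bianchi identity. Placing J in both curvature slots
makes this valid without unitarity or type (1,1), so it serves both for d_A^* F_A and for arbitrary
connections in the Chern number argument. -/
theorem integral_retr_covOne_mul_curvature (hX : IsKahler V X) (hD : IsKahlerConnection D)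
    (hN : ∀ x, IsNormalExtension D x (N x)) (b : EndOneForm V F E) {δ : X → ℝ}
    (hδ : ∀ x, δ x = ∑ k, ∑ l, retr (A.covOne b (hN x) (frame x k) (frame x l) *
        A.curvature x (J x (frame x k)) (J x (frame x l))) -
      ∑ l, retr (b.toFun x (frame x l) * A.covEnd (fun y => A.lamCurv y) x (J x (frame x l)))) :
    SmoothFun V δ ∧ integral V δ = 0 := by
  let B : ∀ x, TangentSpace 𝓘(ℝ, V) x → TangentSpace 𝓘(ℝ, V) x →ₗ[ℝ]
      TangentSpace 𝓘(ℝ, V) x →ₗ[ℝ] ℝ := fun x w =>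
    ((LinearMap.mul ℝ (Module.End ℂ (E x))).compl₁₂ (b.toFun x)
      (A.curvature x (J x w) ∘ₗ jMap x)).compr₂ retr
  have hB : ∀ x w u v, B x w u v = retr (b.toFun x u * A.curvature x (J x w) (J x v)) :=
    fun x w u v => rfl
  let θ : ∀ x, TangentSpace 𝓘(ℝ, V) x →ₗ[ℝ] ℝ := fun x =>
    { toFun := fun w => ∑ l, B x w (frame x l) (frame x l)
      map_add' := fun w w' => by
        simp only [hB, map_add, LinearMap.add_apply, mul_add, Finset.sum_add_distrib]
      map_smul' := fun c w => by
        simp only [hB, map_smul, LinearMap.smul_apply, mul_smul_comm, Finset.smul_sum,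
          RingHom.id_apply] }
  have hBs : ∀ {W : Π x : X, TangentSpace 𝓘(ℝ, V) x}, SmoothSec V V W →
      ∀ U U' : Π x : X, TangentSpace 𝓘(ℝ, V) x, SmoothSec V V U → SmoothSec V V U' →
      SmoothFun V (fun x => B x (W x) (U x) (U' x)) := fun hW U U' hU hU' =>
    ((b.smooth U hU).mul (A.smoothEnd_curvature hW.J hU'.J)).retr
  refine smoothFun_and_integral_codifferential hD (θ := θ)
    (fun W hW => SmoothFun.contraction hD (hBs hW)) fun x => ⟨_, (hN x).isNormalFrame, ?_⟩
  have h1 : ∀ k, mvfderiv 𝓘(ℝ, V) (fun y => θ y (N x (frame x k) y)) x (frame x k) =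
      ∑ l, (retr (A.covOne b (hN x) (frame x k) (frame x l) *
        A.curvature x (J x (frame x k)) (J x (frame x l))) +
      retr (b.toFun x (frame x l) *
        A.covCurv (hN x) (J x (frame x k)) (J x (frame x l)) (frame x k))) := by
    intro k
    refine (IsNormalFrame.mvfderiv_contraction hD (hBs ((hN x).smooth (frame x k)))
      (hN x).isNormalFrame (frame x k)).trans ?_
    refine Finset.sum_congr rfl fun l _ => ?_
    have h2 : (fun y => B y (N x (frame x k) y) (N x (frame x l) y) (N x (frame x l) y)) =
        fun y => retr (b.toFun y (N x (frame x l) y) *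
          A.curvature y (N x (J x (frame x k)) y) (N x (J x (frame x l)) y)) := by
      ext1 y
      rw [hB, (hN x).map_J, (hN x).map_J]
    have h3 := b.smooth _ ((hN x).smooth (frame x l))
    have h4 := A.smoothEnd_curvature ((hN x).smooth (J x (frame x k)))
      ((hN x).smooth (J x (frame x l)))
    rw [h2, A.mvfderiv_retr (h3.mul h4), A.covEnd_mul h3 h4, map_add]
    simp only [(hN x).apply_self]
    rfl
  rw [hδ]
  simp only [h1, Finset.sum_add_distrib]
  rw [sub_eq_add_neg]
  congr 1
  rw [Finset.sum_comm, ← Finset.sum_neg_distrib]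
  refine Finset.sum_congr rfl fun l _ => ?_
  rw [← map_sum, ← Finset.mul_sum, A.sum_covCurv hX hD (hN x), mul_neg, map_neg]

/-- The second covariant derivative of a section: `A.hess hσ hN u v = (∇²σ)(u, v)`. -/
noncomputable def hess {σ : Π x, E x} (hσ : SmoothSec F V σ) {x : X}
    {N : TangentSpace 𝓘(ℝ, V) x →ₗ[ℝ] Π y : X, TangentSpace 𝓘(ℝ, V) y}
    (hN : IsNormalExtension D x N) :
    TangentSpace 𝓘(ℝ, V) x →ₗ[ℝ] TangentSpace 𝓘(ℝ, V) x →ₗ[ℝ] E x :=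
  LinearMap.mk₂ ℝ (fun u v => A.nabla (fun y => A.nabla σ y (N v y)) x u)
    (fun u u' v => map_add _ _ _) (fun c u v => map_smul _ _ _)
    (fun u v v' => by
      simp only [map_add, Pi.add_apply]
      exact cov_add A.nabla (A.smoothSec_nabla hσ (hN.smooth v))
        (A.smoothSec_nabla hσ (hN.smooth v')) x u)
    (fun c u v => by
      simp only [map_smul, Pi.smul_apply]
      exact cov_const_smul A.nabla c (A.smoothSec_nabla hσ (hN.smooth v)) x u)

theorem hess_apply {σ : Π x, E x} (hσ : SmoothSec F V σ) {x : X}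
    {N : TangentSpace 𝓘(ℝ, V) x →ₗ[ℝ] Π y : X, TangentSpace 𝓘(ℝ, V) y}
    (hN : IsNormalExtension D x N) (u v : TangentSpace 𝓘(ℝ, V) x) :
    A.hess hσ hN u v = A.nabla (fun y => A.nabla σ y (N v y)) x u := rfl

/-- Since the (0,1) part of ∇φ vanishes, ∇²φ(u, Jv) = i ∇²φ(u, v). The antisymmetric part of ∇²φ is
the curvature, so ΛF φ = Σ ∇²φ(e_k, J e_k) = i Σ ∇²φ(e_k, e_k). -/
theorem sum_hess (hX : IsKahler V X) (hD : IsKahlerConnection D) {φ : Π x, E x}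
    (hφ : SmoothSec F V φ) (h : ∀ x v, A.dbar φ x v = 0) {x : X}
    {N : TangentSpace 𝓘(ℝ, V) x →ₗ[ℝ] Π y : X, TangentSpace 𝓘(ℝ, V) y}
    (hN : IsNormalExtension D x N) :
    ∑ k, A.hess hφ hN (frame x k) (frame x k) = - Complex.I • A.lamCurv x (φ x) := by
  have h1 : ∀ u v, A.hess hφ hN u (J x v) = Complex.I • A.hess hφ hN u v := fun u v => by
    rw [hess_apply, hess_apply, ← A.nabla_I_smul (A.smoothSec_nabla hφ (hN.smooth v))]
    simp only [hN.map_J, A.nabla_J_of_dbar h]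
  have h2 : ∀ u v, A.curvature x u v (φ x) = A.hess hφ hN u v - A.hess hφ hN v u := fun u v => by
    have h3 := A.curvature_apply_field (hN.smooth u) (hN.smooth v) hφ x
    rw [curvOp, hN.lie_eq_zero hD, map_zero, sub_zero, hN.apply_self, hN.apply_self] at h3
    exact h3
  have h4 := sum_apply_complexStructure (frame x) (j := jMap x) (hX.hermitian x) (J_J x)
    (A.hess hφ hN)
  simp only [jMap_apply] at h4
  rw [lamCurv, LinearMap.smul_apply, LinearMap.sum_apply]
  simp only [h2]
  rw [Finset.sum_sub_distrib, h4, sub_neg_eq_add, ← two_smul ℝ, smul_smul]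
  simp only [h1, ← Finset.smul_sum]
  rw [inv_mul_cancel₀ two_ne_zero, one_smul, smul_smul, neg_mul, Complex.I_mul_I, neg_neg, one_smul]

/-- The integrand is the codifferential of w ↦ Re⟪σ, ∇_w φ⟫; the Laplacian term is evaluated by the
trace of the second derivative. -/
theorem integral_innerOne_nabla (hX : IsKahler V X) (hD : IsKahlerConnection D)
    (hE : IsSmoothHermitian V F E) (hA : A.IsUnitary) {φ σ : Π x, E x}
    (hφ : SmoothSec F V φ) (h : ∀ x v, A.dbar φ x v = 0) (hσ : SmoothSec F V σ) {δ : X → ℝ}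
    (hδ : ∀ x, δ x = innerOne x (fun v => A.nabla φ x v) (fun v => A.nabla σ x v) -
      (inner ℂ (σ x) (Complex.I • A.lamCurv x (φ x)) : ℂ).re) :
    SmoothFun V δ ∧ integral V δ = 0 := by
  choose N hN using fun x => exists_isNormalExtension hD x
  refine smoothFun_and_integral_codifferential hD
    (θ := fun x =>
      { toFun := fun w => (inner ℂ (σ x) (A.nabla φ x w) : ℂ).re
        map_add' := fun w w' => by rw [map_add, inner_add_right, Complex.add_re]
        map_smul' := fun c w => by
          rw [map_smul, ← Complex.coe_smul, inner_smul_right, Complex.re_ofReal_mul]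
          rfl })
    (fun W hW => smoothFun_re_inner hE hσ (A.smoothSec_nabla hφ hW))
    fun x => ⟨_, (hN x).isNormalFrame, ?_⟩
  have h1 : ∀ k, mvfderiv 𝓘(ℝ, V) (fun y => (inner ℂ (σ y) (A.nabla φ y (N x (frame x k) y)) : ℂ).re)
      x (frame x k) = (inner ℂ (A.nabla σ x (frame x k)) (A.nabla φ x (frame x k)) : ℂ).re +
      (inner ℂ (σ x) (A.hess hφ (hN x) (frame x k) (frame x k)) : ℂ).re := fun k => by
    rw [hA.mvfderiv_re_inner hE hσ (A.smoothSec_nabla hφ ((hN x).smooth _)), (hN x).apply_self]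
    rfl
  refine (hδ x).trans ?_
  simp only [LinearMap.coe_mk, AddHom.coe_mk, h1, Finset.sum_add_distrib]
  rw [← Complex.re_sum, ← Complex.re_sum, ← inner_sum,
    A.sum_hess hX hD hφ h (hN x), neg_smul, inner_neg_right, Complex.neg_re, sub_eq_add_neg,
    innerOne, Complex.re_sum]

end Connection

end IntegralIdentities

/-! ### The moment map and its derivative. -/

section MomentMap

variable {V : Type*} [NormedAddCommGroup V] [NormedSpace ℂ V] [FiniteDimensional ℂ V]
  {X : Type*} [TopologicalSpace X] [T2Space X] [ChartedSpace V X] [IsManifold 𝓘(ℂ, V) ω X]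
  {F : Type*} [NormedAddCommGroup F] [NormedSpace ℂ F] [FiniteDimensional ℂ F]
  {E : X → Type*} [TopologicalSpace (TotalSpace F E)]
  [∀ x, NormedAddCommGroup (E x)] [∀ x, InnerProductSpace ℂ (E x)]
  [FiberBundle F E] [VectorBundle ℝ F E] [VectorBundle ℂ F E]
  [ContMDiffVectorBundle ∞ F E 𝓘(ℝ, V)] {φ : Π x, E x}

/-- The endomorphism `e ↦ ⟪w, e⟫ w` of a Hermitian space. -/
noncomputable def rankOne {W : Type*} [NormedAddCommGroup W] [InnerProductSpace ℂ W] (w : W) :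
    W →ₗ[ℂ] W := (innerₛₗ ℂ w).smulRight w

theorem rankOne_apply {W : Type*} [NormedAddCommGroup W] [InnerProductSpace ℂ W] (w e : W) :
    rankOne w e = (inner ℂ w e : ℂ) • w := rfl

/-- Smooth sections are multiplied here by real functions only, so the complex coefficient is split
into two real ones acting on w and i w. -/
theorem rankOne_apply_eq {W : Type*} [NormedAddCommGroup W] [InnerProductSpace ℂ W] (w e : W) :
    rankOne w e = (inner ℂ w e : ℂ).re • w + (inner ℂ (Complex.I • w) e : ℂ).re • Complex.I • w := by
  rw [rankOne_apply, complex_smul_eq, inner_smul_left]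
  simp

theorem smoothEnd_rankOne (hE : IsSmoothHermitian V F E) (hφ : SmoothSec F V φ) :
    SmoothEnd V F (fun x => rankOne (φ x)) := by
  intro σ hσ
  simp only [rankOne_apply_eq]
  exact SmoothSec.add (SmoothSec.smul (smoothFun_re_inner hE hφ hσ) hφ)
    (SmoothSec.smul (smoothFun_re_inner hE hφ.I_smul hσ) hφ.I_smul)

theorem Connection.IsUnitary.covEnd_rankOne {A : Connection V F E}
    (hE : IsSmoothHermitian V F E) (hA : A.IsUnitary) (hφ : SmoothSec F V φ) (x : X)
    (v : TangentSpace 𝓘(ℝ, V) x) (e : E x) :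
    A.covEnd (fun x => rankOne (φ x)) x v e =
      (inner ℂ (A.nabla φ x v) e : ℂ) • φ x + (inner ℂ (φ x) e : ℂ) • A.nabla φ x v := by
  obtain ⟨σ, hσ, rfl⟩ := exists_smoothSec_apply_eq V F e
  have h1 := smoothFun_re_inner hE hφ hσ
  have h2 := smoothFun_re_inner hE hφ.I_smul hσ
  have h3 : ∀ w : E x, (inner ℂ w (σ x) : ℂ) = ((inner ℂ w (σ x) : ℂ).re : ℂ) +
      ((inner ℂ (Complex.I • w) (σ x) : ℂ).re : ℂ) * Complex.I := fun w => by
    rw [inner_smul_left]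
    apply Complex.ext <;> simp
  rw [A.covEnd_apply (smoothEnd_rankOne hE hφ) hσ]
  simp only [rankOne_apply_eq]
  rw [cov_add A.nabla (SmoothSec.smul h1 hφ) (SmoothSec.smul h2 hφ.I_smul),
    cov_smul A.nabla h1 hφ, cov_smul A.nabla h2 hφ.I_smul, A.nabla_I_smul hφ,
    hA.mvfderiv_re_inner hE hφ hσ, hA.mvfderiv_re_inner hE hφ.I_smul hσ, A.nabla_I_smul hφ]
  conv_rhs => rw [h3 (A.nabla φ x v), h3 (φ x)]
  simp only [← Complex.coe_smul]
  push_cast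
  module

/-- The moment map as an endomorphism. -/
noncomputable def momentEnd [RiemannianBundle (fun x : X => TangentSpace 𝓘(ℝ, V) x)] (τ : ℝ)
    (A : Connection V F E) (φ : Π x, E x) (x : X) : E x →ₗ[ℂ] E x :=
  A.lamCurv x - (Complex.I / 2) • (rankOne (φ x) - (τ : ℂ) • 1)

variable [RiemannianBundle (fun x : X => TangentSpace 𝓘(ℝ, V) x)]
  [IsContMDiffRiemannianBundle 𝓘(ℝ, V) ∞ V (fun x : X => TangentSpace 𝓘(ℝ, V) x)]
  {D : CovariantDerivative 𝓘(ℝ, V) V (fun x : X => TangentSpace 𝓘(ℝ, V) x)}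

theorem momentMap_eq (τ : ℝ) (A : Connection V F E) (φ : Π x, E x) (x : X) :
    momentMap τ A φ x = momentEnd τ A φ x := by
  ext e
  simp only [momentMap, momentEnd, phiPhiStarSub, LinearMap.sub_apply, LinearMap.smul_apply,
    A.lamCurv_apply, rankOne_apply, Module.End.one_apply]

theorem smoothEnd_momentEnd (hD : IsKahlerConnection D) (hE : IsSmoothHermitian V F E) (τ : ℝ)
    (A : Connection V F E) (hφ : SmoothSec F V φ) : SmoothEnd V F (momentEnd τ A φ) :=
  (A.smoothEnd_lamCurv hD).sub
    (((smoothEnd_rankOne hE hφ).sub (SmoothEnd.one.complex_smul _)).complex_smul _)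

namespace Connection

variable {A : Connection V F E}

theorem covEnd_complex_smul (A : Connection V F E) (c : ℂ) {Ψ : Π x, E x →ₗ[ℂ] E x}
    (hΨ : SmoothEnd V F Ψ) (x : X) (v : TangentSpace 𝓘(ℝ, V) x) :
    A.covEnd (fun y => c • Ψ y) x v = c • A.covEnd Ψ x v := by
  have h := A.covEnd_mul (SmoothEnd.one.complex_smul c) hΨ x v
  rw [A.covEnd_complex_smul_one, zero_mul, zero_add] at h
  simpa only [smul_mul_assoc, one_mul] using h

/-- The constant τ is parallel, and ∇_{Jv} φ = i ∇_v φ. The i is conjugated in one of the two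
Leibniz terms of φ ⊗ φ*, which produces the minus sign in the current. -/
theorem IsUnitary.dEnd_momentMap (hD : IsKahlerConnection D) (hE : IsSmoothHermitian V F E)
    (hA : A.IsUnitary) (hφ : SmoothSec F V φ) (h : ∀ x v, A.dbar φ x v = 0) (τ : ℝ)
    (x : X) (v : TangentSpace 𝓘(ℝ, V) x) (e : E x) :
    A.dEnd (momentMap τ A φ) x (J x v) e =
      A.covEnd (fun y => A.lamCurv y) x (J x v) e + current A φ x v e := by
  have hr := smoothEnd_rankOne hE hφ
  have ho : SmoothEnd V F (fun x => (τ : ℂ) • (1 : E x →ₗ[ℂ] E x)) := SmoothEnd.one.complex_smul _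
  rw [A.dEnd_eq_covEnd (smoothEnd_momentEnd hD hE τ A hφ)
    (Filter.Eventually.of_forall fun y => momentMap_eq τ A φ y)]
  have h1 : A.covEnd (momentEnd τ A φ) x (J x v) = A.covEnd (fun y => A.lamCurv y) x (J x v) -
      (Complex.I / 2) • A.covEnd (fun y => rankOne (φ y)) x (J x v) := by
    refine (A.covEnd_sub (A.smoothEnd_lamCurv hD) ((hr.sub ho).complex_smul _) x _).trans ?_
    rw [A.covEnd_complex_smul _ (hr.sub ho), A.covEnd_sub hr ho, A.covEnd_complex_smul_one, sub_zero]
  rw [h1, LinearMap.sub_apply, LinearMap.smul_apply, hA.covEnd_rankOne hE hφ,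
    A.nabla_J_of_dbar h, current, inner_smul_left, sub_eq_add_neg]
  congr 1
  have hI : Complex.I * Complex.I = -1 := Complex.I_mul_I
  rw [smul_add, smul_smul, smul_smul, smul_smul, smul_sub, smul_smul, smul_smul, neg_add,
    ← neg_smul, ← neg_smul, add_comm, sub_eq_add_neg, ← neg_smul, Complex.conj_I]
  congr 2
  · linear_combination (-(inner ℂ (φ x) e : ℂ) / 2) * hI
  · linear_combination ((inner ℂ (A.nabla φ x v) e : ℂ) / 2) * hI

theorem momentMap_apply_self (τ : ℝ) (x : X) :
    - (Complex.I • momentMap τ A φ x (φ x)) =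
      - (Complex.I • A.lamCurv x (φ x)) + (2⁻¹ * (τ - ‖φ x‖ ^ 2) : ℝ) • φ x := by
  have hI : Complex.I * Complex.I = -1 := Complex.I_mul_I
  rw [momentMap, ← A.lamCurv_apply, phiPhiStarSub, inner_self_eq_norm_sq_to_K, ← sub_smul, smul_sub,
    neg_sub, smul_smul, smul_smul, neg_add_eq_sub, ← Complex.coe_smul]
  congr 2
  push_cast
  linear_combination ((‖φ x‖ : ℂ) ^ 2 - τ) / 2 * hI

/-- The sum of the (0,2) and (2,0) parts is half of F(v, w) - F(Jv, Jw). -/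
theorem curvature_J_J (h02 : ∀ x v w e, A.curv02 x v w e = 0) (h20 : ∀ x v w e, A.curv20 x v w e = 0)
    (x : X) (v w : TangentSpace 𝓘(ℝ, V) x) :
    A.curvature x (J x v) (J x w) = A.curvature x v w := by
  ext e
  have h1 := h02 x v w e
  have h2 := h20 x v w e
  rw [curv02, smul_eq_zero, or_iff_right (by norm_num)] at h1
  rw [curv20, smul_eq_zero, or_iff_right (by norm_num)] at h2
  have h3 : (2 : ℂ) • (A.curv x v w e - A.curv x (J x v) (J x w) e) = 0 := by
    rw [two_smul]
    nth_rewrite 1 [eq_neg_of_add_eq_zero_left h1]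
    rw [sub_eq_zero.1 h2, neg_add_cancel]
  rw [smul_eq_zero, or_iff_right (by norm_num)] at h3
  exact (sub_eq_zero.1 h3).symm

theorem IsUnitary.isSkew_lamCurv (hE : IsSmoothHermitian V F E) (hA : A.IsUnitary) (x : X) :
    IsSkew (A.lamCurv x) :=
  (IsSkew.sum _ fun _ _ => hA.isSkew_curvature hE x _ _).smul _

/-- The one-form `* d_A Λ F_A`. -/
noncomputable def lamGradient (hD : IsKahlerConnection D) (hE : IsSmoothHermitian V F E)
    (hA : A.IsUnitary) : SkewOneForm V F E where
  toFun x :=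
    have : FiniteDimensional ℂ (E x) := VectorBundle.finiteDimensional ℂ F E x
    LinearMap.toContinuousLinearMap
      (((LinearMap.toContinuousLinearMap (𝕜 := ℂ) (E := E x) (F' := E x)).toLinearMap.restrictScalars
        ℝ) ∘ₗ A.covEnd (fun y => A.lamCurv y) x ∘ₗ jMap x)
  skew x v e e' := hA.isSkew_covEnd hE (A.smoothEnd_lamCurv hD) (hA.isSkew_lamCurv hE) x (J x v) e e'
  smooth _ σ hW hσ := SmoothEnd.covEnd A (A.smoothEnd_lamCurv hD) (SmoothSec.J hW) σ hσ

theorem lamGradient_apply (hD : IsKahlerConnection D) (hE : IsSmoothHermitian V F E)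
    (hA : A.IsUnitary) (x : X) (v : TangentSpace 𝓘(ℝ, V) x) (e : E x) :
    (lamGradient hD hE hA).toFun x v e = A.covEnd (fun y => A.lamCurv y) x (J x v) e := rfl

end Connection

theorem SkewOneForm.isSkew (a : SkewOneForm V F E) (x : X) (v : TangentSpace 𝓘(ℝ, V) x) :
    IsSkew (a.toEndOneForm.toFun x v) := a.skew x v

/-- The difference of two one-forms. -/
noncomputable def SkewOneForm.diff (a b : SkewOneForm V F E) : SkewOneForm V F E where
  toFun x := a.toFun x - b.toFun x
  skew x v e e' := by
    have h1 := a.skew x v e e'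
    have h2 := b.skew x v e e'
    simp only [sub_apply, inner_sub_left, inner_sub_right, h1, h2]
    ring
  smooth W σ hW hσ := SmoothSec.sub (a.smooth W σ hW hσ) (b.smooth W σ hW hσ)

theorem SkewOneForm.innerOneEnd_eq (a b : SkewOneForm V F E) (x : X) :
    innerOneEnd F x (fun v => a.toFun x v) (fun v => b.toFun x v) =
      - ∑ k, retr (a.toEndOneForm.toFun x (frame x k) * b.toEndOneForm.toFun x (frame x k)) := by
  have : FiniteDimensional ℂ (E x) := VectorBundle.finiteDimensional ℂ F E x
  rw [innerOneEnd, ← Finset.sum_neg_distrib]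
  exact Finset.sum_congr rfl fun k _ => endInner_eq_neg_retr _ _ (b.isSkew x (frame x k))

/-- Multiplication of endomorphisms followed by the real part of the trace. -/
noncomputable def retrMul {W : Type*} [AddCommGroup W] [Module ℂ W] :
    (W →ₗ[ℂ] W) →ₗ[ℝ] (W →ₗ[ℂ] W) →ₗ[ℝ] ℝ :=
  (LinearMap.mul ℝ (Module.End ℂ W)).compr₂ retr

theorem smoothFun_sum_retr (hD : IsKahlerConnection D) (a b : EndOneForm V F E) :
    SmoothFun V (fun x => ∑ k, retr (a.toFun x (frame x k) * b.toFun x (frame x k))) :=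
  SmoothFun.contraction (B := fun x => retrMul.compl₁₂ (a.toFun x) (b.toFun x)) hD
    fun U W hU hW => ((a.smooth U hU).mul (b.smooth W hW)).retr

theorem SkewOneForm.continuous_innerOneEnd (hD : IsKahlerConnection D) (a b : SkewOneForm V F E) :
    Continuous fun x => innerOneEnd F x (fun v => a.toFun x v) (fun v => b.toFun x v) := by
  simp only [SkewOneForm.innerOneEnd_eq]
  exact (smoothFun_sum_retr hD a.toEndOneForm b.toEndOneForm).continuous.neg

end MomentMap

/-! ### Formal adjoints and the equivalence of the flows. -/

section Adjoint

variable {V : Type*} [NormedAddCommGroup V] [NormedSpace ℂ V] [FiniteDimensional ℂ V]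
  [MeasurableSpace V] [BorelSpace V]
  {X : Type*} [TopologicalSpace X] [T2Space X] [CompactSpace X] [ChartedSpace V X]
  [IsManifold 𝓘(ℂ, V) ω X]
  [RiemannianBundle (fun x : X => TangentSpace 𝓘(ℝ, V) x)]
  [IsContMDiffRiemannianBundle 𝓘(ℝ, V) ∞ V (fun x : X => TangentSpace 𝓘(ℝ, V) x)]
  {F : Type*} [NormedAddCommGroup F] [NormedSpace ℂ F] [FiniteDimensional ℂ F]
  {E : X → Type*} [TopologicalSpace (TotalSpace F E)]
  [∀ x, NormedAddCommGroup (E x)] [∀ x, InnerProductSpace ℂ (E x)]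
  [FiberBundle F E] [VectorBundle ℝ F E] [VectorBundle ℂ F E]
  [ContMDiffVectorBundle ∞ F E 𝓘(ℝ, V)]
  {D : CovariantDerivative 𝓘(ℝ, V) V (fun x : X => TangentSpace 𝓘(ℝ, V) x)}
  {A : Connection V F E} {φ ψ ψ' : Π x, E x} {β β' : SkewOneForm V F E}

/-- Test both adjoint relations with the difference of the two forms: its L² norm vanishes, and
continuity makes it vanish at every point. -/
theorem IsAdjointCurv.unique (hD : IsKahlerConnection D) (h : IsAdjointCurv A β)
    (h' : IsAdjointCurv A β') (x : X) (v : TangentSpace 𝓘(ℝ, V) x) (e : E x) :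
    β.toFun x v e = β'.toFun x v e := by
  let a := β.diff β'
  have h1 := sub_eq_zero.2 ((h a).trans (h' a).symm)
  rw [← integral_sub (β.continuous_innerOneEnd hD a) (β'.continuous_innerOneEnd hD a)] at h1
  have h2 : ∀ x, innerOneEnd F x (fun v => β.toFun x v) (fun v => a.toFun x v) -
      innerOneEnd F x (fun v => β'.toFun x v) (fun v => a.toFun x v) =
      innerOneEnd F x (fun v => a.toFun x v) (fun v => a.toFun x v) := fun x => by
    simp only [innerOneEnd, fiberInner, endInner, ← Finset.sum_sub_distrib, ← Complex.sub_re,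
      ← inner_sub_right]
    rfl
  simp only [h2] at h1
  have hn : ∀ (x : X) (k), 0 ≤ fiberInner F x (fun e => a.toFun x (frame x k) e)
      (fun e => a.toFun x (frame x k) e) := fun x k =>
    have : FiniteDimensional ℂ (E x) := VectorBundle.finiteDimensional ℂ F E x
    endInner_self_nonneg _
  have h3 := eq_zero_of_integral_eq_zero (a.continuous_innerOneEnd hD a)
    (fun x => Finset.sum_nonneg fun k _ => hn x k) h1 x
  have h4 := fun k => (Finset.sum_eq_zero_iff_of_nonneg fun k _ => hn x k).1 h3 k (Finset.mem_univ k)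
  have hfin : FiniteDimensional ℂ (E x) := VectorBundle.finiteDimensional ℂ F E x
  have h5 : ∀ k, a.toFun x (frame x k) = 0 := fun k => by
    have h7 : (a.toFun x (frame x k)).toLinearMap = 0 := eq_zero_of_endInner_self (h4 k)
    ext e
    exact congrArg (fun f => f e) h7
  have h8 : (a.toFun x).toLinearMap = 0 := (frame x).toBasis.ext fun k => by
    rw [OrthonormalBasis.coe_toBasis]
    exact h5 k
  have h9 := congrArg (fun f => f e) (congrArg (fun f => f v) h8)
  exact sub_eq_zero.1 h9

theorem IsAdjointCov.unique (hE : IsSmoothHermitian V F E) (h : IsAdjointCov A φ ψ)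
    (h' : IsAdjointCov A φ ψ') (x : X) : ψ x = ψ' x := by
  have hs : SmoothSec F V (fun x => ψ x - ψ' x) := SmoothSec.sub h.1 h'.1
  have h1 := sub_eq_zero.2 ((h.2 _ hs).trans (h'.2 _ hs).symm)
  rw [← integral_sub (smoothFun_re_inner hE hs h.1).continuous
    (smoothFun_re_inner hE hs h'.1).continuous] at h1
  simp only [← Complex.sub_re, ← inner_sub_right] at h1
  have h2 := eq_zero_of_integral_eq_zero (smoothFun_re_inner hE hs hs).continuous
    (fun x => inner_self_nonneg (𝕜 := ℂ)) h1 x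
  rw [re_inner_self] at h2
  exact sub_eq_zero.1 (norm_eq_zero.1 (pow_eq_zero_iff two_ne_zero |>.1 h2))

namespace Connection.IsGaugedHolomorphic

theorem isAdjointCov (hX : IsKahler V X) (hE : IsSmoothHermitian V F E)
    (h : A.IsGaugedHolomorphic φ) : IsAdjointCov A φ (fun x => Complex.I • A.lamCurv x (φ x)) := by
  obtain ⟨D, hD⟩ := hX.exists_connection
  have hs : SmoothSec F V (fun x => Complex.I • A.lamCurv x (φ x)) :=
    (A.smoothEnd_lamCurv hD φ h.smooth).I_smul
  refine ⟨hs, fun σ hσ => ?_⟩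
  obtain ⟨h1, h2⟩ := A.integral_innerOne_nabla hX hD hE h.unitary h.smooth h.dbar_eq_zero hσ
    fun x => rfl
  have h3 := integral_add (V := V) (smoothFun_re_inner hE hσ hs).continuous h1.continuous
  rw [h2, add_zero] at h3
  rw [← h3]
  congr 1
  ext x
  ring

/-- The pairing of F with d_A a is -Σ Re tr(∇_k a(e_l) F(e_k, e_l)). Type (1,1) allows J in both
curvature slots, which is the integrand already integrated by parts. -/
theorem isAdjointCurv (hX : IsKahler V X) (hD : IsKahlerConnection D)
    (hE : IsSmoothHermitian V F E) (h : A.IsGaugedHolomorphic φ) :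
    IsAdjointCurv A (lamGradient hD hE h.unitary) := by
  intro a
  choose N hN using fun x => exists_isNormalExtension hD x
  obtain ⟨h1, h2⟩ := A.integral_retr_covOne_mul_curvature hX hD hN a.toEndOneForm fun x => rfl
  set β := lamGradient hD hE h.unitary
  have h3 := integral_sub (V := V) (β.continuous_innerOneEnd hD a) h1.continuous
  rw [h2, sub_zero] at h3
  rw [← h3]
  congr 1
  ext x
  have hfin : FiniteDimensional ℂ (E x) := VectorBundle.finiteDimensional ℂ F E x
  have h4 : innerTwoEnd F x (A.curv x) (A.dOneForm a x) =
      - ∑ k, ∑ l, retr (A.covOne a.toEndOneForm (hN x) (frame x k) (frame x l) *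
        A.curvature x (J x (frame x k)) (J x (frame x l))) := by
    have h5 : ∀ u v, fiberInner F x (A.curv x u v) (A.dOneForm a x u v) =
        - retr (A.covOne a.toEndOneForm (hN x) u v * A.curvature x u v) +
        - retr (A.covOne a.toEndOneForm (hN x) v u * A.curvature x v u) := fun u v => by
      have h6 : A.dOneForm a x u v =
          ⇑(A.covOne a.toEndOneForm (hN x) u v - A.covOne a.toEndOneForm (hN x) v u) :=
        funext fun e => A.dOneForm_eq_covOne hD a (hN x) u v e
      rw [h6]
      refine (endInner_eq_neg_retr' (A.curvature x u v) _ (h.unitary.isSkew_curvature hE x u v)).trans ?_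
      rw [retr_mul_comm, A.curvature_swap x v u, sub_mul, mul_neg, map_sub, map_neg]
      ring
    simp only [innerTwoEnd, h5, Finset.sum_add_distrib, Finset.sum_neg_distrib,
      curvature_J_J h.curv02_eq_zero h.curv20_eq_zero]
    -- Exchanging the indices identifies the two halves of d_A a, and the factor ½ of the two-form
    -- inner product disappears.
    rw [Finset.sum_comm (f := fun k l => retr (A.covOne a.toEndOneForm (hN x) (frame x l)
      (frame x k) * A.curvature x (frame x l) (frame x k)))]
    ring
  rw [h4, SkewOneForm.innerOneEnd_eq]
  have h7 : ∀ k, retr (β.toEndOneForm.toFun x (frame x k) * a.toEndOneForm.toFun x (frame x k)) =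
      retr (a.toEndOneForm.toFun x (frame x k) *
        A.covEnd (fun y => A.lamCurv y) x (J x (frame x k))) := fun k => retr_mul_comm _ _
  simp only [h7]
  ring

end Connection.IsGaugedHolomorphic

/-- On gauged holomorphic pairs, the vortex flow and the Yang–Mills–Higgs flow coincide. -/
theorem isVortexFlow_iff (hX : IsKahler V X) (hE : IsSmoothHermitian V F E) (τ : ℝ) (S : Set ℝ)
    (A : ℝ → Connection V F E) (φ : ℝ → Π x, E x)
    (h : ∀ t ∈ S, (A t).IsGaugedHolomorphic (φ t)) :
    IsVortexFlow τ S A φ ↔ IsYangMillsHiggsFlow τ S A φ := by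
  obtain ⟨D, hD⟩ := hX.exists_connection
  have h1 : ∀ t (ht : t ∈ S), (fun x v e => - (A t).dEnd (momentMap τ (A t) (φ t)) x (J x v) e) =
      fun x v e => - (Connection.lamGradient hD hE (h t ht).unitary).toFun x v e -
        current (A t) (φ t) x v e := fun t ht => by
    ext x v e
    rw [(h t ht).unitary.dEnd_momentMap hD hE (h t ht).smooth (h t ht).dbar_eq_zero,
      Connection.lamGradient_apply, neg_add, sub_eq_add_neg]
  refine forall₂_congr fun t ht => and_congr ?_ ?_
  · rw [h1 t ht]
    -- One direction exhibits * d_A ΛF_A as the adjoint; the other receives an unspecified β and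
    -- identifies it by uniqueness.
    refine ⟨fun H => ⟨_, (h t ht).isAdjointCurv hX hD hE, H⟩, fun ⟨β, hβ, H⟩ => ?_⟩
    convert H using 6
    exact IsAdjointCurv.unique hD ((h t ht).isAdjointCurv hX hD hE) hβ _ _ _
  · simp only [Connection.momentMap_apply_self]
    refine ⟨fun H => ⟨_, (h t ht).isAdjointCov hX hE, H⟩, fun ⟨ψ, hψ, H⟩ x => ?_⟩
    rw [IsAdjointCov.unique hE hψ ((h t ht).isAdjointCov hX hE) x |>.symm]
    exact H x

end Adjoint

/-! ### The second Chern density as a symmetric bilinear form. -/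

section ChernForm

variable {T : Type*} [NormedAddCommGroup T] [InnerProductSpace ℝ T] {ι : Type*} [Fintype ι]
  {W : Type*} [AddCommGroup W] [Module ℂ W]

theorem retrMul_apply (a b : W →ₗ[ℂ] W) : retrMul a b = retr (a * b) := rfl

/-- The polarization of `(P, P) ↦ ½ Λ² Re tr (P ∧ P)` for two-forms with values in endomorphisms,
up to a factor, written in an orthonormal basis. -/
noncomputable def chernForm (e : OrthonormalBasis ι ℝ T) (j : T →ₗ[ℝ] T) :
    (T →ₗ[ℝ] T →ₗ[ℝ] W →ₗ[ℂ] W) →ₗ[ℝ] (T →ₗ[ℝ] T →ₗ[ℝ] W →ₗ[ℂ] W) →ₗ[ℝ] ℝ :=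
  LinearMap.mk₂ ℝ (fun P Q => ∑ k, ∑ l, (retrMul (P (e k) (j (e k))) (Q (e l) (j (e l))) -
      2 * retrMul (P (e k) (e l)) (Q (j (e k)) (j (e l)))))
    (fun P P' Q => by
      simp only [LinearMap.add_apply, map_add, ← Finset.sum_add_distrib]
      exact Finset.sum_congr rfl fun k _ => Finset.sum_congr rfl fun l _ => by ring)
    (fun c P Q => by
      simp only [LinearMap.smul_apply, map_smul, smul_eq_mul, Finset.mul_sum]
      exact Finset.sum_congr rfl fun k _ => Finset.sum_congr rfl fun l _ => by ring)
    (fun P Q Q' => by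
      simp only [LinearMap.add_apply, map_add, ← Finset.sum_add_distrib]
      exact Finset.sum_congr rfl fun k _ => Finset.sum_congr rfl fun l _ => by ring)
    (fun c P Q => by
      simp only [LinearMap.smul_apply, map_smul, smul_eq_mul, Finset.mul_sum]
      exact Finset.sum_congr rfl fun k _ => Finset.sum_congr rfl fun l _ => by ring)

variable {e : OrthonormalBasis ι ℝ T} {j : T →ₗ[ℝ] T}
  (P Q : T →ₗ[ℝ] T →ₗ[ℝ] W →ₗ[ℂ] W)

theorem chernForm_apply : chernForm e j P Q =
    retr ((∑ k, P (e k) (j (e k))) * ∑ l, Q (e l) (j (e l))) -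
      2 * ∑ k, ∑ l, retr (P (e k) (e l) * Q (j (e k)) (j (e l))) := by
  simp only [chernForm, LinearMap.mk₂_apply, retrMul_apply, Finset.sum_sub_distrib, Finset.mul_sum,
    Finset.sum_mul, map_sum]
  rw [Finset.sum_comm (f := fun k l => retr (P (e k) (j (e k)) * Q (e l) (j (e l))))]

/-- The first term is symmetric by cyclicity of the trace. In the second, rotating both basis
indices by j exchanges the places of the rotated and unrotated arguments, the signs cancelling in
pairs. -/
theorem chernForm_comm (hj : ∀ v w, inner ℝ (j v) (j w) = inner ℝ v w)
    (hjj : ∀ v, j (j v) = - v) : chernForm e j P Q = chernForm e j Q P := by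
  rw [chernForm_apply, chernForm_apply, retr_mul_comm]
  congr 2
  have h1 : ∀ u, ∑ l, retr (P u (e l) * Q (j u) (j (e l))) =
      ∑ l, retr (P u (j (e l)) * Q (j u) (- e l)) := fun u => by
    have h := sum_apply_isometry e hj (retrMul.compl₁₂ (P u) (Q (j u) ∘ₗ j))
    simp only [LinearMap.compl₁₂_apply, LinearMap.comp_apply, hjj, retrMul_apply] at h
    exact h.symm
  have h2 : ∀ v, ∑ k, retr (P (e k) (j v) * Q (j (e k)) (- v)) =
      ∑ k, retr (P (j (e k)) (j v) * Q (- e k) (- v)) := fun v => by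
    have h := sum_apply_isometry e hj (retrMul.compl₁₂ (P.flip (j v)) (Q.flip (- v) ∘ₗ j))
    simp only [LinearMap.compl₁₂_apply, LinearMap.comp_apply, hjj, retrMul_apply,
      LinearMap.flip_apply] at h
    exact h.symm
  simp only [h1]
  rw [Finset.sum_comm]
  simp only [h2]
  rw [Finset.sum_comm]
  refine Finset.sum_congr rfl fun k _ => Finset.sum_congr rfl fun l _ => ?_
  rw [map_neg, map_neg, LinearMap.neg_apply, neg_neg, retr_mul_comm]

/-- Of the three pairings in tr(P ∧ Q) on (e_k, j e_k, e_l, j e_l), the last two contribute equally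
after rotating l by j. This is the origin of the factor 2. -/
theorem sum_chern_eq_chernForm (hj : ∀ v w, inner ℝ (j v) (j w) = inner ℝ v w)
    (hjj : ∀ v, j (j v) = - v) :
    ∑ k, ∑ l, (retr (P (e k) (j (e k)) * Q (e l) (j (e l))) -
      retr (P (e k) (e l) * Q (j (e k)) (j (e l))) +
      retr (P (e k) (j (e l)) * Q (j (e k)) (e l))) = chernForm e j P Q := by
  have h1 : ∀ u, ∑ l, retr (P u (j (e l)) * Q (j u) (e l)) =
      - ∑ l, retr (P u (e l) * Q (j u) (j (e l))) := fun u =>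
    sum_apply_complexStructure e hj hjj (retrMul.compl₁₂ (P u) (Q (j u)))
  simp only [chernForm, LinearMap.mk₂_apply, retrMul_apply, Finset.sum_sub_distrib,
    Finset.sum_add_distrib, h1, Finset.sum_neg_distrib, ← Finset.mul_sum]
  ring

/-- Simpson's rule for the path of curvatures `P + t Q + t² R`. -/
theorem chernForm_simpson (hj : ∀ v w, inner ℝ (j v) (j w) = inner ℝ v w)
    (hjj : ∀ v, j (j v) = - v) (P Q R : T →ₗ[ℝ] T →ₗ[ℝ] W →ₗ[ℂ] W) :
    chernForm e j (P + Q + R) (P + Q + R) - chernForm e j P P =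
      3⁻¹ * (chernForm e j Q P
        + 4 * chernForm e j (Q + R) (P + (2⁻¹ : ℝ) • Q + (4⁻¹ : ℝ) • R)
        + chernForm e j (Q + (2 : ℝ) • R) (P + Q + R)) := by
  -- The t-derivative of the quadratic form at P + tQ + t²R pairs 2(Q + 2tR) with P + tQ + t²R, a
  -- cubic in t. Simpson's rule at 0, 1/2, 1 is exact on cubics, and its weight 1/6 times 2 gives
  -- 1/3.
  simp only [map_add, map_smul, LinearMap.add_apply, LinearMap.smul_apply, smul_eq_mul]
  rw [chernForm_comm P Q hj hjj, chernForm_comm P R hj hjj, chernForm_comm R Q hj hjj]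
  ring

end ChernForm

/-! ### Translating a connection by a one-form. -/

section Translate

variable {V : Type*} [NormedAddCommGroup V] [NormedSpace ℂ V] [FiniteDimensional ℂ V]
  {X : Type*} [TopologicalSpace X] [T2Space X] [ChartedSpace V X] [IsManifold 𝓘(ℂ, V) ω X]
  {F : Type*} [NormedAddCommGroup F] [NormedSpace ℂ F] [FiniteDimensional ℂ F]
  {E : X → Type*} [TopologicalSpace (TotalSpace F E)]
  [∀ x, NormedAddCommGroup (E x)] [∀ x, InnerProductSpace ℂ (E x)]
  [FiberBundle F E] [VectorBundle ℝ F E] [VectorBundle ℂ F E]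
  [ContMDiffVectorBundle ∞ F E 𝓘(ℝ, V)]

namespace Connection

theorem nabla_sub_nabla_congr (A B : Connection V F E) {σ σ' : Π x, E x} (hσ : SmoothSec F V σ)
    (hσ' : SmoothSec F V σ') {x : X} (h : σ x = σ' x) (v : TangentSpace 𝓘(ℝ, V) x) :
    B.nabla σ x v - A.nabla σ x v = B.nabla σ' x v - A.nabla σ' x v := by
  refine eq_of_tensorial (V := V) (F := F) (fun σ => B.nabla σ x v - A.nabla σ x v)
    (fun σ σ' hσ hσ' => ?_) (fun f σ hf hσ => ?_) hσ hσ' h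
  · simp only [cov_add B.nabla hσ hσ', cov_add A.nabla hσ hσ']
    abel
  · simp only [cov_smul B.nabla hf hσ, cov_smul A.nabla hf hσ]
    module

theorem exists_diffForm (A B : Connection V F E) : ∃ b : EndOneForm V F E,
    ∀ σ : Π x, E x, SmoothSec F V σ → ∀ (x : X) (v : TangentSpace 𝓘(ℝ, V) x),
      b.toFun x v (σ x) = B.nabla σ x v - A.nabla σ x v := by
  -- One extension is fixed for each fibre vector; the difference of the connections is linear over
  -- functions, so it does not depend on that choice.
  choose s hs hx using fun (x : X) (e : E x) => exists_smoothSec_apply_eq V F e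
  have key : ∀ {x : X} (e : E x) {σ : Π x, E x}, SmoothSec F V σ → σ x = e → ∀ v,
      B.nabla (s x e) x v - A.nabla (s x e) x v = B.nabla σ x v - A.nabla σ x v :=
    fun e σ hσ h v => A.nabla_sub_nabla_congr B (hs _ e) hσ ((hx _ e).trans h.symm) v
  have h1 : ∀ (σ : Π x, E x), SmoothSec F V σ → ∀ (x : X) v, B.nabla (s x (σ x)) x v -
      A.nabla (s x (σ x)) x v = B.nabla σ x v - A.nabla σ x v := fun σ hσ x v => key _ hσ rfl v
  refine ⟨⟨fun x =>
    { toFun := fun v =>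
        { toFun := fun e => B.nabla (s x e) x v - A.nabla (s x e) x v
          map_add' := fun e e' => by
            rw [key (e + e') (SmoothSec.add (hs x e) (hs x e')) (by rw [hx, hx]),
              cov_add B.nabla (hs x e) (hs x e'), cov_add A.nabla (hs x e) (hs x e')]
            abel
          map_smul' := fun c e => by
            rw [key (c • e) ((hs x e).complex_smul c) (by rw [hx]),
              B.nabla_complex_smul c (hs x e), A.nabla_complex_smul c (hs x e), smul_sub]
            rfl }
      map_add' := fun v w => by
        ext e
        simp only [LinearMap.coe_mk, AddHom.coe_mk, LinearMap.add_apply, map_add]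
        abel
      map_smul' := fun c v => by
        ext e
        simp only [LinearMap.coe_mk, AddHom.coe_mk, LinearMap.smul_apply, map_smul,
          RingHom.id_apply, smul_sub] }, fun W hW σ hσ => ?_⟩, h1⟩
  simp only [LinearMap.coe_mk, AddHom.coe_mk, h1 σ hσ]
  exact SmoothSec.sub (B.smoothSec_nabla hσ hW) (A.smoothSec_nabla hσ hW)

/-- `A' = A + s b`. -/
def IsTranslate (A A' : Connection V F E) (s : ℝ) (b : EndOneForm V F E) : Prop :=
  ∀ σ : Π x, E x, SmoothSec F V σ → ∀ (x : X) (v : TangentSpace 𝓘(ℝ, V) x),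
    A'.nabla σ x v = A.nabla σ x v + s • b.toFun x v (σ x)

/-- The midpoint is an affine combination of the two connections. It is the only intermediate node
that Simpson's rule requires. -/
theorem exists_isTranslate_half {A B : Connection V F E} {b : EndOneForm V F E}
    (h : A.IsTranslate B 1 b) : ∃ C : Connection V F E, A.IsTranslate C 2⁻¹ b := by
  have hC : ∀ (σ : Π x, E x) (x : X) (v : TangentSpace 𝓘(ℝ, V) x),
      CovariantDerivative.affineCombination A.nabla B.nabla (fun _ => 2⁻¹) σ x v =
        (2⁻¹ : ℝ) • A.nabla σ x v + (1 - 2⁻¹ : ℝ) • B.nabla σ x v := fun σ x v => rfl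
  refine ⟨⟨CovariantDerivative.affineCombination A.nabla B.nabla (fun _ => 2⁻¹),
    CovariantDerivative.ContMDiffCovariantDerivative.affineCombination _ _ contMDiff_const A.smooth
      B.smooth, fun σ x v hσ => ?_⟩, fun σ hσ x v => ?_⟩
  · rw [hC, hC, A.map_I_smul σ x v hσ, B.map_I_smul σ x v hσ, smul_add, smul_comm, smul_comm (_ : ℝ)]
  · refine (hC σ x v).trans ?_
    rw [h σ hσ]
    module

variable {A A' : Connection V F E} {s : ℝ} {b : EndOneForm V F E}

theorem IsTranslate.covEnd (h : A.IsTranslate A' s b) {Ψ : Π x, E x →ₗ[ℂ] E x}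
    (hΨ : SmoothEnd V F Ψ) (x : X) (v : TangentSpace 𝓘(ℝ, V) x) :
    A'.covEnd Ψ x v = A.covEnd Ψ x v + s • (b.toFun x v * Ψ x - Ψ x * b.toFun x v) := by
  ext e
  obtain ⟨σ, hσ, rfl⟩ := exists_smoothSec_apply_eq V F e
  simp only [LinearMap.add_apply, LinearMap.smul_apply, LinearMap.sub_apply, Module.End.mul_apply]
  rw [A'.covEnd_apply hΨ hσ, A.covEnd_apply hΨ hσ, h σ hσ, h _ (hΨ σ hσ), map_add,
    LinearMap.map_smul_of_tower]
  module

/-- The pointwise bracket `(u, v) ↦ [b(u), b(v)]`. -/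
noncomputable def _root_.VortexFlow.EndOneForm.bracket (b : EndOneForm V F E) (x : X) :
    TangentSpace 𝓘(ℝ, V) x →ₗ[ℝ] TangentSpace 𝓘(ℝ, V) x →ₗ[ℝ] E x →ₗ[ℂ] E x :=
  (LinearMap.mul ℝ (Module.End ℂ (E x))).compl₁₂ (b.toFun x) (b.toFun x) -
    ((LinearMap.mul ℝ (Module.End ℂ (E x))).compl₁₂ (b.toFun x) (b.toFun x)).flip

theorem _root_.VortexFlow.EndOneForm.bracket_apply (b : EndOneForm V F E) (x : X)
    (u v : TangentSpace 𝓘(ℝ, V) x) :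
    b.bracket x u v = b.toFun x u * b.toFun x v - b.toFun x v * b.toFun x u := rfl

variable [RiemannianBundle (fun x : X => TangentSpace 𝓘(ℝ, V) x)]
  [IsContMDiffRiemannianBundle 𝓘(ℝ, V) ∞ V (fun x : X => TangentSpace 𝓘(ℝ, V) x)]
  {D : CovariantDerivative 𝓘(ℝ, V) V (fun x : X => TangentSpace 𝓘(ℝ, V) x)} {x : X}
  {N : TangentSpace 𝓘(ℝ, V) x →ₗ[ℝ] Π y : X, TangentSpace 𝓘(ℝ, V) y}

/-- The exterior covariant derivative of an `End E`-valued one-form. -/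
noncomputable def extOne (A : Connection V F E) (b : EndOneForm V F E)
    (hN : IsNormalExtension D x N) :
    TangentSpace 𝓘(ℝ, V) x →ₗ[ℝ] TangentSpace 𝓘(ℝ, V) x →ₗ[ℝ] E x →ₗ[ℂ] E x :=
  A.covOne b hN - (A.covOne b hN).flip

theorem extOne_apply (A : Connection V F E) (b : EndOneForm V F E) (hN : IsNormalExtension D x N)
    (u v : TangentSpace 𝓘(ℝ, V) x) :
    A.extOne b hN u v = A.covOne b hN u v - A.covOne b hN v u := rfl

theorem IsTranslate.covOne (h : A.IsTranslate A' s b) (hN : IsNormalExtension D x N)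
    (u v : TangentSpace 𝓘(ℝ, V) x) :
    A'.covOne b hN u v = A.covOne b hN u v + s • b.bracket x u v := by
  rw [covOne_apply, covOne_apply, h.covEnd (b.smooth _ (hN.smooth v)), hN.apply_self]
  rfl

theorem IsTranslate.extOne (h : A.IsTranslate A' s b) (hN : IsNormalExtension D x N) :
    A'.extOne b hN = A.extOne b hN + (2 * s) • b.bracket x := by
  ext1 u
  ext1 v
  simp only [extOne_apply, LinearMap.add_apply, LinearMap.smul_apply, h.covOne hN,
    EndOneForm.bracket_apply]
  module

/-- Expanding the second derivative along u and v, the terms b(v) ∇_u σ and b(u) ∇_v σ form a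
symmetric expression, so antisymmetrising leaves only d_A b and the bracket. -/
theorem IsTranslate.curvature (hD : IsKahlerConnection D) (h : A.IsTranslate A' s b)
    (hN : IsNormalExtension D x N) :
    A'.curvature x = A.curvature x + s • A.extOne b hN + s ^ 2 • b.bracket x := by
  ext u v e
  obtain ⟨σ, hσ, rfl⟩ := exists_smoothSec_apply_eq V F e
  have hu := hN.smooth u
  have hv := hN.smooth v
  have h1 : ∀ A : Connection V F E, A.curvature x u v (σ x) =
      A.nabla (fun y => A.nabla σ y (N v y)) x u - A.nabla (fun y => A.nabla σ y (N u y)) x v := by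
    intro A
    have h3 := A.curvature_apply_field hu hv hσ x
    rw [curvOp, hN.lie_eq_zero hD, map_zero, sub_zero, hN.apply_self, hN.apply_self] at h3
    exact h3
  have h2 : ∀ u v : TangentSpace 𝓘(ℝ, V) x, A'.nabla (fun y => A'.nabla σ y (N v y)) x u =
      A.nabla (fun y => A.nabla σ y (N v y)) x u +
      s • (A.covOne b hN u v (σ x) + b.toFun x v (A.nabla σ x u)) +
      (s • b.toFun x u (A.nabla σ x v) + s ^ 2 • b.toFun x u (b.toFun x v (σ x))) := by
    intro u v
    have hv := hN.smooth v
    have hs := A.smoothSec_nabla hσ hv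
    have hb := b.smooth _ hv σ hσ
    rw [h _ (A'.smoothSec_nabla hσ hv)]
    simp only [h σ hσ]
    rw [cov_add A.nabla hs (hb.const_smul s), cov_const_smul A.nabla s hb, covOne_apply,
      A.covEnd_apply (b.smooth _ hv) hσ, hN.apply_self, map_add, LinearMap.map_smul_of_tower]
    module
  simp only [LinearMap.add_apply, LinearMap.smul_apply]
  rw [h1, h1, h2, h2, extOne_apply, EndOneForm.bracket_apply]
  simp only [LinearMap.sub_apply, Module.End.mul_apply]
  module

theorem sum_curvature_J (A : Connection V F E) (x : X) :
    ∑ k, A.curvature x (frame x k) (J x (frame x k)) = (2 : ℝ) • A.lamCurv x := by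
  rw [lamCurv, smul_smul, mul_inv_cancel₀ two_ne_zero, one_smul]

end Connection

end Translate

/-! ### The first variation of the second Chern density integrates to zero. -/

section Topological

variable {V : Type*} [NormedAddCommGroup V] [NormedSpace ℂ V] [FiniteDimensional ℂ V]
  [MeasurableSpace V] [BorelSpace V]
  {X : Type*} [TopologicalSpace X] [T2Space X] [CompactSpace X] [ChartedSpace V X]
  [IsManifold 𝓘(ℂ, V) ω X]
  [RiemannianBundle (fun x : X => TangentSpace 𝓘(ℝ, V) x)]
  [IsContMDiffRiemannianBundle 𝓘(ℝ, V) ∞ V (fun x : X => TangentSpace 𝓘(ℝ, V) x)]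
  {F : Type*} [NormedAddCommGroup F] [NormedSpace ℂ F] [FiniteDimensional ℂ F]
  {E : X → Type*} [TopologicalSpace (TotalSpace F E)]
  [∀ x, NormedAddCommGroup (E x)] [∀ x, InnerProductSpace ℂ (E x)]
  [FiberBundle F E] [VectorBundle ℝ F E] [VectorBundle ℂ F E]
  [ContMDiffVectorBundle ∞ F E 𝓘(ℝ, V)]
  {D : CovariantDerivative 𝓘(ℝ, V) V (fun x : X => TangentSpace 𝓘(ℝ, V) x)}
  {N : Π x : X, TangentSpace 𝓘(ℝ, V) x →ₗ[ℝ] Π y : X, TangentSpace 𝓘(ℝ, V) y}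

namespace Connection

variable (A : Connection V F E)

/-- The pairing of d_A b with F is a difference of two codifferentials. The Bianchi identity is
hidden in the second one. -/
theorem integral_chernForm (hX : IsKahler V X) (hD : IsKahlerConnection D)
    (hN : ∀ x, IsNormalExtension D x (N x)) (b : EndOneForm V F E) {δ : X → ℝ}
    (hδ : ∀ x, δ x = chernForm (frame x) (jMap x) (A.extOne b (hN x)) (A.curvature x)) :
    SmoothFun V δ ∧ integral V δ = 0 := by
  obtain ⟨h1, h2⟩ := A.integral_retr_covOne_mul hD hN b (A.smoothEnd_lamCurv hD) fun x => rfl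
  obtain ⟨h3, h4⟩ := A.integral_retr_covOne_mul_curvature hX hD hN b fun x => rfl
  have h5 := integral_sub (V := V) h1.continuous h3.continuous
  rw [h2, h4, sub_zero] at h5
  -- The factor 4 comes from ΣF(e, Je) = 2 ΛF together with the two equal halves of d_A b. The terms
  -- containing the derivative of ΛF cancel after rotating the frame by J.
  have key : δ = fun x => 4 * (∑ k, (retr (A.covOne b (hN x) (frame x k) (J x (frame x k)) *
        A.lamCurv x) + retr (b.toFun x (J x (frame x k)) *
        A.covEnd (fun y => A.lamCurv y) x (frame x k))) -
      (∑ k, ∑ l, retr (A.covOne b (hN x) (frame x k) (frame x l) *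
        A.curvature x (J x (frame x k)) (J x (frame x l))) -
      ∑ l, retr (b.toFun x (frame x l) *
        A.covEnd (fun y => A.lamCurv y) x (J x (frame x l))))) := by
    ext x
    have e1 := sum_apply_complexStructure (frame x) (j := jMap x) (hX.hermitian x) (J_J x)
      (retrMul.compl₁₂ (b.toFun x) (A.covEnd (fun y => A.lamCurv y) x))
    have e2 := sum_apply_complexStructure (frame x) (j := jMap x) (hX.hermitian x) (J_J x)
      (A.covOne b (hN x))
    simp only [LinearMap.compl₁₂_apply, retrMul_apply, jMap_apply] at e1 e2
    have e3 : ∑ k, ∑ l, retr (A.covOne b (hN x) (frame x l) (frame x k) *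
        A.curvature x (J x (frame x k)) (J x (frame x l))) =
        - ∑ k, ∑ l, retr (A.covOne b (hN x) (frame x k) (frame x l) *
        A.curvature x (J x (frame x k)) (J x (frame x l))) := by
      rw [Finset.sum_comm, ← Finset.sum_neg_distrib]
      refine Finset.sum_congr rfl fun k _ => ?_
      rw [← Finset.sum_neg_distrib]
      refine Finset.sum_congr rfl fun l _ => ?_
      rw [A.curvature_swap, mul_neg, map_neg]
    rw [hδ, chernForm_apply]
    simp only [jMap_apply, extOne_apply, sub_mul, map_sub, Finset.sum_sub_distrib,
      Finset.sum_add_distrib]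
    rw [e2, e3, e1, sum_curvature_J, neg_mul, mul_smul_comm, map_neg, map_smul, ← map_sum,
      ← Finset.sum_mul, smul_eq_mul]
    ring
  rw [key]
  exact ⟨SmoothFun.mul contMDiff_const (ContMDiff.sub h1 h3), by
    rw [integral_const_mul, h5, mul_zero]⟩

end Connection

end Topological

/-! ### Pointwise energy identities. -/

section Energy

variable {V : Type*} [NormedAddCommGroup V] [NormedSpace ℂ V] [FiniteDimensional ℂ V]
  {X : Type*} [TopologicalSpace X] [T2Space X] [ChartedSpace V X] [IsManifold 𝓘(ℂ, V) ω X]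
  [RiemannianBundle (fun x : X => TangentSpace 𝓘(ℝ, V) x)]
  [IsContMDiffRiemannianBundle 𝓘(ℝ, V) ∞ V (fun x : X => TangentSpace 𝓘(ℝ, V) x)]
  {F : Type*} [NormedAddCommGroup F] [NormedSpace ℂ F] [FiniteDimensional ℂ F]
  {E : X → Type*} [TopologicalSpace (TotalSpace F E)]
  [∀ x, NormedAddCommGroup (E x)] [∀ x, InnerProductSpace ℂ (E x)]
  [FiberBundle F E] [VectorBundle ℝ F E] [VectorBundle ℂ F E]
  [ContMDiffVectorBundle ∞ F E 𝓘(ℝ, V)]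
  {D : CovariantDerivative 𝓘(ℝ, V) V (fun x : X => TangentSpace 𝓘(ℝ, V) x)}

theorem fiberTrace_eq_trace (x : X) (a : E x →ₗ[ℂ] E x) :
    fiberTrace F x a = LinearMap.trace ℂ (E x) a :=
  have : FiniteDimensional ℂ (E x) := VectorBundle.finiteDimensional ℂ F E x
  endTrace_eq_trace a

theorem fiberInner_eq_neg_retr {x : X} {a : E x →ₗ[ℂ] E x} (b : E x →ₗ[ℂ] E x) (ha : IsSkew a) :
    fiberInner F x a b = - retr (a * b) :=
  have : FiniteDimensional ℂ (E x) := VectorBundle.finiteDimensional ℂ F E x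
  endInner_eq_neg_retr' a b ha

theorem isSkew_I_smul_rankOne_sub {W : Type*} [NormedAddCommGroup W] [InnerProductSpace ℂ W]
    (w : W) (τ : ℝ) : IsSkew (Complex.I • (rankOne w - (τ : ℂ) • (1 : W →ₗ[ℂ] W))) := by
  intro e e'
  simp only [LinearMap.smul_apply, LinearMap.sub_apply, rankOne_apply, Module.End.one_apply,
    inner_smul_left, inner_smul_right, inner_sub_left, inner_sub_right, Complex.conj_I,
    Complex.conj_ofReal, inner_conj_symm]
  ring

/-- Multiplication by i makes the Hermitian endomorphism skew without changing its norm, so the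
trace formula for skew endomorphisms applies. -/
theorem fiberInner_phiPhiStarSub (τ : ℝ) (φ : Π x, E x) (x : X) :
    fiberInner F x (phiPhiStarSub τ φ x) (phiPhiStarSub τ φ x) =
      - retr ((Complex.I • (rankOne (φ x) - (τ : ℂ) • (1 : E x →ₗ[ℂ] E x))) *
        (Complex.I • (rankOne (φ x) - (τ : ℂ) • (1 : E x →ₗ[ℂ] E x)))) := by
  have hfin : FiniteDimensional ℂ (E x) := VectorBundle.finiteDimensional ℂ F E x
  refine Eq.trans ?_ (fiberInner_eq_neg_retr (F := F) (E := E) (x := x) _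
    (isSkew_I_smul_rankOne_sub (φ x) τ))
  have h : ∀ e : E x, ‖(Complex.I • (rankOne (φ x) - (τ : ℂ) • (1 : E x →ₗ[ℂ] E x))) e‖ =
      ‖phiPhiStarSub τ φ x e‖ := fun e => by
    rw [LinearMap.smul_apply, norm_smul, Complex.norm_I, one_mul]
    rfl
  simp only [fiberInner, endInner_self, h]

namespace Connection

variable (A : Connection V F E)

theorem chernNumberOne_integrand (x : X) :
    ((Complex.I / (2 * (Real.pi : ℂ))) * fiberTrace F x (lambdaCurv A x)).re =
      (2 * Real.pi)⁻¹ * retr (Complex.I • A.lamCurv x) := by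
  have h : lambdaCurv A x = A.lamCurv x := funext fun e => (A.lamCurv_apply x e).symm
  rw [h, fiberTrace_eq_trace, retr_apply, map_smul, smul_eq_mul, ← Complex.re_ofReal_mul]
  congr 1
  push_cast
  ring

theorem re_ch2Form (x : X) (u v w z : TangentSpace 𝓘(ℝ, V) x) :
    (ch2Form A x u v w z).re = - (4 * Real.pi ^ 2)⁻¹ *
      (retr (A.curvature x u v * A.curvature x w z) - retr (A.curvature x u w * A.curvature x v z) +
        retr (A.curvature x u z * A.curvature x v w)) := by
  have h : ∀ u v w z : TangentSpace 𝓘(ℝ, V) x, fiberTrace F x (fun e => A.curv x u v (A.curv x w z e)) =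
      LinearMap.trace ℂ (E x) (A.curvature x u v * A.curvature x w z) := fun u v w z =>
    fiberTrace_eq_trace x (A.curvature x u v * A.curvature x w z)
  rw [ch2Form, h, h, h, retr_apply, retr_apply, retr_apply, ← Complex.sub_re, ← Complex.add_re,
    ← Complex.re_ofReal_mul]
  congr 1
  push_cast
  ring

theorem chernNumberTwo_integrand (hX : IsKahler V X) (x : X) :
    8⁻¹ * ∑ k, ∑ l,
      (ch2Form A x (frame x k) (J x (frame x k)) (frame x l) (J x (frame x l))).re =
      - (32 * Real.pi ^ 2)⁻¹ *
        chernForm (frame x) (jMap x) (A.curvature x) (A.curvature x) := by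
  rw [← sum_chern_eq_chernForm (e := frame x) (j := jMap x) (A.curvature x) (A.curvature x) (hX.hermitian x) (J_J x)]
  simp only [re_ch2Form, ← Finset.mul_sum, jMap_apply]
  ring

variable {A} {φ : Π x, E x}

/-- The moment map is the skew endomorphism ΛF - ½ iP with P = φ ⊗ φ* - τ. Expanding -Re tr of its
square, the rank-one part of the cross term evaluates on φ and the scalar part gives the trace of i
ΛF. -/
theorem fiberInner_momentMap (hE : IsSmoothHermitian V F E) (hA : A.IsUnitary) (τ : ℝ) (x : X) :
    fiberInner F x (momentMap τ A φ x) (momentMap τ A φ x) =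
      - retr (A.lamCurv x * A.lamCurv x) +
        4⁻¹ * fiberInner F x (phiPhiStarSub τ φ x) (phiPhiStarSub τ φ x) +
        (inner ℂ (φ x) (Complex.I • A.lamCurv x (φ x)) : ℂ).re -
        τ * retr (Complex.I • A.lamCurv x) := by
  have hfin : FiniteDimensional ℂ (E x) := VectorBundle.finiteDimensional ℂ F E x
  set L := A.lamCurv x
  set P : E x →ₗ[ℂ] E x := rankOne (φ x) - (τ : ℂ) • 1
  have hP : IsSkew (Complex.I • P) := isSkew_I_smul_rankOne_sub (φ x) τ
  have hm : momentMap τ A φ x = (L - (2⁻¹ : ℝ) • (Complex.I • P) : E x →ₗ[ℂ] E x) := by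
    rw [momentMap_eq, momentEnd]
    congr 2
    rw [← Complex.coe_smul, smul_smul]
    congr 1
    push_cast
    ring
  have hsk : IsSkew (L - (2⁻¹ : ℝ) • (Complex.I • P)) := by
    have h1 := hP.smul 2⁻¹
    have h2 : IsSkew L := hA.isSkew_lamCurv hE x
    intro e e'
    rw [LinearMap.sub_apply, LinearMap.sub_apply, inner_sub_left, inner_sub_right, h1, h2]
    ring
  have h3 : fiberInner F x (phiPhiStarSub τ φ x) (phiPhiStarSub τ φ x) =
      - retr ((Complex.I • P) * (Complex.I • P)) := fiberInner_phiPhiStarSub τ φ x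
  have h4 : retr (rankOne (φ x) * (Complex.I • L)) =
      (inner ℂ (φ x) (Complex.I • L (φ x)) : ℂ).re := by
    have h5 : rankOne (φ x) * (Complex.I • L) =
        ((innerₛₗ ℂ (φ x)).comp (Complex.I • L)).smulRight (φ x) := rfl
    rw [retr_apply, h5, LinearMap.trace_smulRight]
    rfl
  have h6 : retr ((Complex.I • P) * L) = (inner ℂ (φ x) (Complex.I • L (φ x)) : ℂ).re -
      τ * retr (Complex.I • L) := by
    rw [← h4, smul_mul_assoc, ← mul_smul_comm, sub_mul, map_sub, smul_mul_assoc, one_mul,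
      Complex.coe_smul, map_smul, smul_eq_mul]
  rw [hm, fiberInner_eq_neg_retr _ hsk, h3, sub_mul, mul_sub, mul_sub]
  simp only [smul_mul_assoc (2⁻¹ : ℝ), mul_smul_comm (2⁻¹ : ℝ), map_sub, map_smul, smul_eq_mul]
  rw [retr_mul_comm L (Complex.I • P), h6]
  ring

/-- Type (1,1) removes J from the second term and skewness turns traces of squares into negative
norms. Since Re tr (ΛF)² = -|ΛF|², the density is 4(|F|² - |ΛF|²). -/
theorem chernForm_curvature (hE : IsSmoothHermitian V F E)
    (h : A.IsGaugedHolomorphic φ) (x : X) :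
    chernForm (frame x) (jMap x) (A.curvature x) (A.curvature x) =
      4 * (innerTwoEnd F x (A.curv x) (A.curv x) + retr (A.lamCurv x * A.lamCurv x)) := by
  have h1 : ∀ u v, fiberInner F x (A.curv x u v) (A.curv x u v) =
      - retr (A.curvature x u v * A.curvature x u v) := fun u v =>
    fiberInner_eq_neg_retr (A.curvature x u v) (h.unitary.isSkew_curvature hE x u v)
  rw [chernForm_apply, innerTwoEnd]
  simp only [jMap_apply, curvature_J_J h.curv02_eq_zero h.curv20_eq_zero, h1,
    Finset.sum_neg_distrib]
  rw [sum_curvature_J, smul_mul_smul_comm, map_smul, smul_eq_mul]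
  ring

theorem continuous_innerTwoEnd_curv (hD : IsKahlerConnection D) (hE : IsSmoothHermitian V F E)
    (hA : A.IsUnitary) : Continuous fun x => innerTwoEnd F x (A.curv x) (A.curv x) := by
  have h1 : ∀ (x : X) (u v : TangentSpace 𝓘(ℝ, V) x), fiberInner F x (A.curv x u v) (A.curv x u v) =
      - retr (A.curvature x u v * A.curvature x u v) := fun x u v =>
    fiberInner_eq_neg_retr (A.curvature x u v) (hA.isSkew_curvature hE x u v)
  simp only [innerTwoEnd, h1, Finset.sum_neg_distrib]
  -- The double contraction is made smooth one index at a time: the inner sum over l is itself a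
  -- bilinear form in the outer index.
  refine ((SmoothFun.contraction hD (B := fun x => ∑ l, retrMul.compl₁₂
    ((A.curvature x).flip (frame x l)) ((A.curvature x).flip (frame x l))) fun U W hU hW => ?_
    ).continuous.neg.const_mul 2⁻¹).congr fun x => ?_
  · have h2 := SmoothFun.contraction hD (B := fun x => retrMul.compl₁₂ (A.curvature x (U x))
      (A.curvature x (W x))) fun U' W' hU' hW' =>
        ((A.smoothEnd_curvature hU hU').mul (A.smoothEnd_curvature hW hW')).retr
    simp only [LinearMap.sum_apply]
    exact h2
  · simp only [LinearMap.sum_apply]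
    rfl

end Connection

end Energy

/-! ### Independence of the Chern numbers and the energy identity. -/

section Topological

variable {V : Type*} [NormedAddCommGroup V] [NormedSpace ℂ V] [FiniteDimensional ℂ V]
  [MeasurableSpace V] [BorelSpace V]
  {X : Type*} [TopologicalSpace X] [T2Space X] [CompactSpace X] [ChartedSpace V X]
  [IsManifold 𝓘(ℂ, V) ω X]
  [RiemannianBundle (fun x : X => TangentSpace 𝓘(ℝ, V) x)]
  [IsContMDiffRiemannianBundle 𝓘(ℝ, V) ∞ V (fun x : X => TangentSpace 𝓘(ℝ, V) x)]
  {F : Type*} [NormedAddCommGroup F] [NormedSpace ℂ F] [FiniteDimensional ℂ F]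
  {E : X → Type*} [TopologicalSpace (TotalSpace F E)]
  [∀ x, NormedAddCommGroup (E x)] [∀ x, InnerProductSpace ℂ (E x)]
  [FiberBundle F E] [VectorBundle ℝ F E] [VectorBundle ℂ F E]
  [ContMDiffVectorBundle ∞ F E 𝓘(ℝ, V)]
  {φ : Π x, E x}

theorem integral_add_simpson {u f g h : X → ℝ} (hu : Continuous u) (hf : Continuous f)
    (hg : Continuous g) (hh : Continuous h) (hf0 : integral V f = 0) (hg0 : integral V g = 0)
    (hh0 : integral V h = 0) :
    integral V (fun x => u x + 3⁻¹ * (f x + 4 * g x + h x)) = integral V u := by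
  rw [integral_add hu (by fun_prop), integral_const_mul, integral_add (by fun_prop) hh,
    integral_add hf (by fun_prop), integral_const_mul, hf0, hg0, hh0]
  ring

namespace Connection

variable (A B : Connection V F E)

theorem chernNumberOne_eq : chernNumberOne A =
    (2 * Real.pi)⁻¹ * integral V (fun x => retr (Complex.I • A.lamCurv x)) := by
  rw [← integral_const_mul, chernNumberOne]
  simp only [chernNumberOne_integrand]

theorem chernNumberTwo_eq (hX : IsKahler V X) : chernNumberTwo A =
    - (32 * Real.pi ^ 2)⁻¹ * integral V (fun x =>
      chernForm (frame x) (jMap x) (A.curvature x) (A.curvature x)) := by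
  rw [← integral_const_mul, chernNumberTwo]
  simp only [A.chernNumberTwo_integrand hX]

/-- The trace annihilates the bracket of b with itself, so the integrand changes only by the
contraction of d_A b; this is a codifferential because i times the identity is parallel. -/
theorem chernNumberOne_eq_chernNumberOne (hX : IsKahler V X) :
    chernNumberOne B = chernNumberOne A := by
  obtain ⟨D, hD⟩ := hX.exists_connection
  obtain ⟨b, hb⟩ := A.exists_diffForm B
  have hB : A.IsTranslate B 1 b := fun σ hσ x v => by rw [hb σ hσ, one_smul, add_sub_cancel]
  choose N hN using fun x => exists_isNormalExtension hD x
  obtain ⟨h1, h2⟩ := A.integral_retr_covOne_mul hD hN b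
    (SmoothEnd.one.complex_smul (F := F) (E := E) (V := V) Complex.I) fun x => rfl
  have hA : SmoothFun V (fun x => retr (Complex.I • A.lamCurv x)) :=
    ((A.smoothEnd_lamCurv hD).complex_smul _).retr
  have h3 := integral_add (V := V) hA.continuous h1.continuous
  rw [h2, add_zero] at h3
  rw [chernNumberOne_eq, chernNumberOne_eq, ← h3]
  congr 2
  ext x
  have e2 := sum_apply_complexStructure (frame x) (j := jMap x) (hX.hermitian x) (J_J x)
    (A.covOne b (hN x))
  have e3 : B.lamCurv x = A.lamCurv x + ∑ k, A.covOne b (hN x) (frame x k) (J x (frame x k)) +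
      (2⁻¹ : ℝ) • ∑ k, b.bracket x (frame x k) (J x (frame x k)) := by
    simp only [jMap_apply] at e2
    rw [lamCurv, lamCurv, hB.curvature hD (hN x), one_smul, one_pow, one_smul]
    simp only [LinearMap.add_apply, extOne_apply, Finset.sum_add_distrib, Finset.sum_sub_distrib]
    rw [e2]
    module
  have e4 : ∀ u v, retr (Complex.I • b.bracket x u v) = 0 := fun u v => by
    rw [EndOneForm.bracket_apply, smul_sub, ← smul_mul_assoc, ← mul_smul_comm, map_sub,
      retr_mul_comm, sub_self]
  have e5 : retr (Complex.I • (2⁻¹ : ℝ) • ∑ k, b.bracket x (frame x k) (J x (frame x k))) = 0 := by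
    rw [smul_comm, LinearMap.map_smul, Finset.smul_sum, map_sum,
      Finset.sum_eq_zero fun k _ => e4 _ _, smul_zero]
  rw [e3, smul_add, smul_add, map_add, map_add, e5, add_zero, Finset.smul_sum, map_sum]
  simp only [covEnd_complex_smul_one, mul_zero, map_zero, add_zero,
    mul_smul_comm, mul_one]

/-- The curvatures of `A`, the midpoint and `B` are the values at t = 0, 1/2, 1 of the quadratic
path, so Simpson's identity writes the change of density as a combination of three terms of zero
integral. -/
theorem integral_chernForm_eq (hX : IsKahler V X)
    (hA : Continuous fun x : X => chernForm (frame x) (jMap x) (A.curvature x) (A.curvature x)) :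
    integral V (fun x => chernForm (frame x) (jMap x) (B.curvature x) (B.curvature x)) =
      integral V (fun x => chernForm (frame x) (jMap x) (A.curvature x) (A.curvature x)) := by
  obtain ⟨D, hD⟩ := hX.exists_connection
  obtain ⟨b, hb⟩ := A.exists_diffForm B
  have hB : A.IsTranslate B 1 b := fun σ hσ x v => by rw [hb σ hσ, one_smul, add_sub_cancel]
  obtain ⟨C, hC⟩ := exists_isTranslate_half hB
  choose N hN using fun x => exists_isNormalExtension hD x
  obtain ⟨a1, a2⟩ := A.integral_chernForm hX hD hN b fun x => rfl
  obtain ⟨c1, c2⟩ := C.integral_chernForm hX hD hN b fun x => rfl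
  obtain ⟨b1, b2⟩ := B.integral_chernForm hX hD hN b fun x => rfl
  have h3 := integral_add_simpson hA a1.continuous c1.continuous b1.continuous a2 c2 b2
  rw [← h3]
  congr 1
  ext x
  have h4 := chernForm_simpson (e := frame x) (hX.hermitian x) (j := jMap x) (J_J x) (A.curvature x)
    (A.extOne b (hN x)) (b.bracket x)
  have e1 : B.curvature x = A.curvature x + A.extOne b (hN x) + b.bracket x := by
    rw [hB.curvature hD (hN x), one_smul, one_pow, one_smul]
  have e2 : C.curvature x = A.curvature x + (2⁻¹ : ℝ) • A.extOne b (hN x) +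
      (4⁻¹ : ℝ) • b.bracket x := by
    rw [hC.curvature hD (hN x)]
    norm_num
  have e3 : B.extOne b (hN x) = A.extOne b (hN x) + (2 : ℝ) • b.bracket x := by
    rw [hB.extOne (hN x), mul_one]
  have e4 : C.extOne b (hN x) = A.extOne b (hN x) + b.bracket x := by
    rw [hC.extOne (hN x), mul_inv_cancel₀ two_ne_zero, one_smul]
  rw [← e1, ← e2, ← e3, ← e4] at h4
  linarith

end Connection

/-- The Yang–Mills–Higgs functional and the vortex functional differ by a topological constant. -/
theorem yangMillsHiggs_eq (hX : IsKahler V X) (hE : IsSmoothHermitian V F E) (τ : ℝ)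
    (B A : Connection V F E) (h : A.IsGaugedHolomorphic φ) :
    yangMillsHiggs τ A φ = vortexFunctional τ A φ + 2 * Real.pi * τ * chernNumberOne B
      - 8 * Real.pi ^ 2 * chernNumberTwo B := by
  obtain ⟨D, hD⟩ := hX.exists_connection
  have hφ : SmoothSec F V φ := h.smooth
  have hlam := A.smoothEnd_lamCurv hD
  have c1 := A.continuous_innerTwoEnd_curv hD hE h.unitary
  have c2 : Continuous fun x => retr (A.lamCurv x * A.lamCurv x) := (hlam.mul hlam).retr.continuous
  have c3 : Continuous fun x => fiberInner F x (phiPhiStarSub τ φ x) (phiPhiStarSub τ φ x) := by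
    have hP := ((smoothEnd_rankOne hE hφ).sub
      (SmoothEnd.one.complex_smul (τ : ℂ))).complex_smul Complex.I
    exact (hP.mul hP).retr.continuous.neg.congr fun x => (fiberInner_phiPhiStarSub τ φ x).symm
  have c4 : Continuous fun x => (inner ℂ (φ x) (Complex.I • A.lamCurv x (φ x)) : ℂ).re :=
    (smoothFun_re_inner hE hφ (hlam φ hφ).I_smul).continuous
  have c5 : Continuous fun x => retr (Complex.I • A.lamCurv x) :=
    (hlam.complex_smul _).retr.continuous
  have hT : (fun x => chernForm (frame x) (jMap x) (A.curvature x) (A.curvature x)) = fun x =>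
      4 * (innerTwoEnd F x (A.curv x) (A.curv x) + retr (A.lamCurv x * A.lamCurv x)) :=
    funext (Connection.chernForm_curvature hE h)
  have i1 : integral V (fun x =>
      chernForm (frame x) (jMap x) (A.curvature x) (A.curvature x)) =
      4 * (integral V (fun x : X => innerTwoEnd F x (A.curv x) (A.curv x)) +
        integral V (fun x : X => retr (A.lamCurv x * A.lamCurv x))) := by
    rw [hT, integral_const_mul, integral_add c1 c2]
  -- Testing d_A^* d_A φ = i ΛF φ against φ itself expresses ‖d_A φ‖² as the integral of the cross
  -- term.
  have i2 := (h.isAdjointCov hX hE).2 φ hφ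
  have i3 : vortexFunctional τ A φ =
      - integral V (fun x : X => retr (A.lamCurv x * A.lamCurv x)) +
      4⁻¹ * integral V (fun x : X => fiberInner F x (phiPhiStarSub τ φ x) (phiPhiStarSub τ φ x)) +
      integral V (fun x : X => (inner ℂ (φ x) (Complex.I • A.lamCurv x (φ x)) : ℂ).re) -
      τ * integral V (fun x : X => retr (Complex.I • A.lamCurv x)) := by
    rw [vortexFunctional]
    simp only [Connection.fiberInner_momentMap hE h.unitary]
    simp only [← neg_one_mul (retr (A.lamCurv _ * A.lamCurv _))]
    rw [integral_sub (by fun_prop) (by fun_prop), integral_add (by fun_prop) c4,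
      integral_add (by fun_prop) (by fun_prop), integral_const_mul, integral_const_mul,
      integral_const_mul]
    ring
  have hc : Continuous fun x : X =>
      chernForm (frame x) (jMap x) (A.curvature x) (A.curvature x) := by
    rw [hT]
    exact (c1.add c2).const_mul 4
  -- The Chern numbers of `B` are first exchanged for those of `A`; the remaining identity is linear
  -- in the integrals already computed.
  rw [yangMillsHiggs, i3, ← i2, A.chernNumberOne_eq_chernNumberOne B hX, A.chernNumberOne_eq,
    B.chernNumberTwo_eq hX, A.integral_chernForm_eq B hX hc, i1]
  have hpi : Real.pi ≠ 0 := Real.pi_ne_zero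
  field_simp
  ring

end Topological

end VortexFlow

theorem theorem2p1
    {V : Type*} [NormedAddCommGroup V] [NormedSpace ℂ V] [FiniteDimensional ℂ V]
    [MeasurableSpace V] [BorelSpace V]
    {X : Type*} [TopologicalSpace X] [T2Space X] [CompactSpace X] [ChartedSpace V X]
    [IsManifold 𝓘(ℂ, V) ω X]
    [RiemannianBundle (fun x : X => TangentSpace 𝓘(ℝ, V) x)]
    [IsContMDiffRiemannianBundle 𝓘(ℝ, V) ∞ V (fun x : X => TangentSpace 𝓘(ℝ, V) x)]
    (hX : VortexFlow.IsKahler V X)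
    {F : Type*} [NormedAddCommGroup F] [NormedSpace ℂ F] [FiniteDimensional ℂ F]
    {E : X → Type*} [TopologicalSpace (TotalSpace F E)]
    [∀ x, NormedAddCommGroup (E x)] [∀ x, InnerProductSpace ℂ (E x)]
    [FiberBundle F E] [VectorBundle ℝ F E] [VectorBundle ℂ F E]
    [ContMDiffVectorBundle ∞ F E 𝓘(ℝ, V)]
    (hE : VortexFlow.IsSmoothHermitian V F E)
    (τ : ℝ) :
    (∀ (B A : VortexFlow.Connection V F E) (φ : Π x, E x), A.IsGaugedHolomorphic φ →
      VortexFlow.yangMillsHiggs τ A φ = VortexFlow.vortexFunctional τ A φ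
        + 2 * Real.pi * τ * VortexFlow.chernNumberOne B
        - 8 * Real.pi ^ 2 * VortexFlow.chernNumberTwo B) ∧
    (∀ (S : Set ℝ), S.OrdConnected → S.Nontrivial →
      ∀ (A : ℝ → VortexFlow.Connection V F E) (φ : ℝ → Π x, E x),
        (∀ t ∈ S, (A t).IsGaugedHolomorphic (φ t)) →
        (VortexFlow.IsVortexFlow τ S A φ ↔ VortexFlow.IsYangMillsHiggsFlow τ S A φ)) := by
  exact ⟨fun B A _ h => VortexFlow.yangMillsHiggs_eq hX hE τ B A h,
    fun S _ _ A φ h => VortexFlow.isVortexFlow_iff hX hE τ S A φ h⟩
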